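/- **Setting.** A *rectilinear domain* $\mathcal P$ with $h\ge 0$ holes is a compact connected subset of the plane that is the closure of its interior and whose boundary is a union of $h+1$ pairwise disjoint simple closed polygonal cycles made of axis-parallel segments (the edges of $\mathcal P$), consecutive edges being perpendicular. Assume general position: no two edges of $\mathcal P$ are collinear. All paths in the plane are rectilinear (finitely many horizontal and vertical segments); the length of a path is the sum of the lengths of its segments. *Corridor structure.* Extend every vertical edge of $\mathcal P$ inside $\mathcal P$ until it hits the boundary; the extension segments (*diagonals*) decompose $\mathcal P$ into rectangular cells. In the dual graph (nodes: cells; two cells are adjacent if they share a segment of positive length) repeatedly remove degree-one nodes until none is left, then contract all degree-two nodes. The cells of the remaining nodes are the *junction rectangles*. A *corridor* $\mathcal C$ is a connected region of $\mathcal P$ with the junction rectangles removed (taken closed) that has two *doors* $d_1\neq d_2$, i.e. is separated from the junction rectangles by exactly two diagonals; in addition every diagonal $d$ between two junction rectangles is a degenerate corridor with $\mathcal C=d_1=d_2=d$. *Backbone points.* $\mathcal C$ is *open* if some horizontal segment contained in $\mathcal C$ joins $d_1$ to $d_2$; then the endpoints, on the doors, of the highest and of the lowest such segment are backbone points. Otherwise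 $\mathcal C$ is *closed*; then for each door $d_i$ let $H_i$ be the maximal histogram in $\mathcal C$ with base $d_i$ (the points of $\mathcal C$ that see $d_i$ horizontally inside $\mathcal C$) and $w_i$ its window (a segment on $\partial H_i$ that lies in the interior of $\mathcal C$ except for its endpoints) that separates $d_1$ from $d_2$ in $\mathcal C$; the point $q_i\in d_i$ where the extension of $w_i$ inside $\mathcal C$ hits $d_i$ is a backbone point. *Reduced graph.* Let $s$ and $t$ be points that lie in (closed) junction rectangles, and let $\mathcal B$ consist of all backbone points together with $s$ and $t$. A *cut-line tree* of $\mathcal B$ is obtained recursively: the root has the point set $\mathcal B$ and the vertical cut-line through a point of $\mathcal B$ of median $x$-coordinate (at most half of the points strictly on either side), and its subtrees are built in the same way for the points strictly to the left and strictly to the right of that line. For a node with point set $U$ and cut-line $\ell$, every $v\in U$ whose horizontal projection $v'$ on $\ell$ satisfies $\overline{vv'}\subseteq\mathcal P$ defines the Steiner point $v'$. The graph $G(\mathcal B)$ has as vertices the points of $\mathcal B$ and all Steiner points, and as edges (i) all such segments $\overline{vv'}$, (ii) all segments $\overline{p_1p_2}\subseteq\mathcal P$ between two consecutive Steiner points of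 a cut-line, both weighted by their length, and (iii) for every closed corridor $\mathcal C$ the *corridor edge* $q_1q_2$, weighted by the length of a shortest path from $q_1$ to $q_2$ in $\mathcal C$. A path in $G(\mathcal B)$ corresponds to a path in $\mathcal P$: edges of types (i) and (ii) are replaced by the segments themselves, and each corridor edge by a shortest path from $q_1$ to $q_2$ in $\mathcal C$. **Statement.** $\mathcal B$ is finite, it has a cut-line tree, and for every choice of the cut-line tree $G(\mathcal B)$ is path-preserving: there is a shortest $s$-$t$ path in $G(\mathcal B)$, and every shortest $s$-$t$ path in $G(\mathcal B)$ is a shortest $s$-$t$ path in $\mathcal P$. That is, every shortest $s$-$t$ path of $G(\mathcal B)$ has a corresponding path in $\mathcal P$, and each path in $\mathcal P$ corresponding to it is a shortest rectilinear $s$-$t$ path in $\mathcal P$ whose length equals the weight of the graph path. -/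

import Mathlib

/-! Points of the plane, rectilinear paths and their lengths. -/

abbrev Pt : Type := ℝ × ℝ

/-- The length of an axis-parallel segment with the given endpoints (the `L₁` distance). -/
def l1 (p q : Pt) : ℝ := |p.1 - q.1| + |p.2 - q.2|

/-- The length of the polygonal path with the given list of successive points. -/
def pathLength : List Pt → ℝ
  | [] => 0
  | [_] => 0
  | p :: q :: π => l1 p q + pathLength (q :: π)

/-- `π` lists the successive points of a rectilinear path from `p` to `q` inside `D`. -/
def IsRectPath (D : Set Pt) (p q : Pt) (π : List Pt) : Prop :=
  π.head? = some p ∧ π.getLast? = some q ∧ (∀ z ∈ π, z ∈ D) ∧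
    π.IsChain (fun a b => (a.1 = b.1 ∨ a.2 = b.2) ∧ segment ℝ a b ⊆ D)

/-- `π` is a shortest rectilinear path from `p` to `q` in `D`. -/
def IsShortestRectPath (D : Set Pt) (p q : Pt) (π : List Pt) : Prop :=
  IsRectPath D p q π ∧ ∀ π', IsRectPath D p q π' → pathLength π ≤ pathLength π'

/-- The length of a shortest rectilinear path from `p` to `q` in `D`. -/
noncomputable def geodesicDist (D : Set Pt) (p q : Pt) : ℝ :=
  sInf {r | ∃ π, IsRectPath D p q π ∧ r = pathLength π}

/-- A rectilinear domain with `h` holes: a compact connected region of the plane that is the closure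
of its interior and whose boundary is the union of `h + 1` pairwise disjoint simple closed
polygonal cycles made of axis-parallel segments, consecutive ones being perpendicular. -/
structure RectilinearDomain (h : ℕ) where
  carrier : Set Pt
  /-- the number of vertices of each boundary cycle -/
  size : Fin (h + 1) → ℕ
  four_le_size : ∀ c, 4 ≤ size c
  /-- the vertices of each boundary cycle, in cyclic order -/
  vertex : (c : Fin (h + 1)) → ZMod (size c) → Pt
  vertex_ne : ∀ c i, vertex c i ≠ vertex c (i + 1)
  axis_parallel : ∀ c i, (vertex c i).1 = (vertex c (i + 1)).1 ∨ (vertex c i).2 = (vertex c (i + 1)).2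
  alternate : ∀ c i, (vertex c i).1 = (vertex c (i + 1)).1 ↔
    (vertex c (i + 1)).2 = (vertex c (i + 1 + 1)).2
  cycle_simple : ∀ c i j, i ≠ j → j ≠ i + 1 → i ≠ j + 1 →
    Disjoint (segment ℝ (vertex c i) (vertex c (i + 1))) (segment ℝ (vertex c j) (vertex c (j + 1)))
  cycles_disjoint : ∀ c c', c ≠ c' → ∀ i j,
    Disjoint (segment ℝ (vertex c i) (vertex c (i + 1)))
      (segment ℝ (vertex c' j) (vertex c' (j + 1)))
  isCompact : IsCompact carrier
  isConnected : IsConnected carrier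
  closure_interior : closure (interior carrier) = carrier
  frontier_eq : frontier carrier = ⋃ c, ⋃ i, segment ℝ (vertex c i) (vertex c (i + 1))

namespace RectilinearDomain

variable {h : ℕ} (P : RectilinearDomain h)

/-- An edge of the domain. -/
def edge (c : Fin (h + 1)) (i : ZMod (P.size c)) : Set Pt :=
  segment ℝ (P.vertex c i) (P.vertex c (i + 1))

/-- General position: no two edges are collinear. -/
def GeneralPosition : Prop :=
  ∀ (e f : (c : Fin (h + 1)) × ZMod (P.size c)), e ≠ f →
    ¬ Collinear ℝ (P.edge e.1 e.2 ∪ P.edge f.1 f.2)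

/-! The vertical visibility decomposition. -/

/-- The union of all vertical edges together with their extensions inside the domain. -/
def extendedVerticals : Set Pt :=
  {z | ∃ c i, (P.vertex c i).1 = (P.vertex c (i + 1)).1 ∧
    ∃ w ∈ P.edge c i, z.1 = w.1 ∧ segment ℝ z w ⊆ P.carrier}

/-- A cell of the vertical visibility decomposition, i.e. a (closed) face, necessarily a rectangle,
of the subdivision of the domain by the extended vertical edges. -/
def IsCell (R : Set Pt) : Prop :=
  (∃ a b c d : ℝ, a < b ∧ c < d ∧ R = Set.Icc a b ×ˢ Set.Icc c d) ∧
    interior R ⊆ interior P.carrier \ P.extendedVerticals ∧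
    frontier R ⊆ frontier P.carrier ∪ P.extendedVerticals

end RectilinearDomain

/-- Two cells share an edge (a segment of positive length); the shared segment is `R ∩ R'`. -/
def CellAdj (R R' : Set Pt) : Prop := R ≠ R' ∧ (R ∩ R').Nontrivial

/-- The degree of the cell `R` in the dual graph induced on the set `K` of cells. -/
noncomputable def degreeIn (K : Set (Set Pt)) (R : Set Pt) : ℕ∞ :=
  {R' | R' ∈ K ∧ CellAdj R R'}.encard

/-- `PrunesTo K K'`: `K'` arises from `K` by successively removing nodes that have degree one
at the time of their removal. -/
inductive PrunesTo : Set (Set Pt) → Set (Set Pt) → Prop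
  | refl (K) : PrunesTo K K
  | step (K K' R) : R ∈ K → degreeIn K R = 1 → PrunesTo (K \ {R}) K' → PrunesTo K K'

/-- The nodes that survive the subsequent contraction of all degree-two nodes. Contracting a
degree-two node (loops counting twice) does not change the degree of any other node. -/
def junctions (K : Set (Set Pt)) : Set (Set Pt) := {R | R ∈ K ∧ degreeIn K R ≠ 2}

namespace RectilinearDomain

variable {h : ℕ} (P : RectilinearDomain h)

/-- `K` is what remains of the dual graph of the vertical visibility decomposition after removing
degree-one nodes until none is left. -/
def IsPrunedDual (K : Set (Set Pt)) : Prop :=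
  PrunesTo {R | P.IsCell R} K ∧ ∀ R ∈ K, degreeIn K R ≠ 1

/-! Corridors. Throughout, `J` is the set of junction rectangles. -/

/-- The cells that can be reached from `R₀` without using junction rectangles; these cells make up
a connected region of the domain with the junction rectangles removed. -/
def regionCells (J : Set (Set Pt)) (R₀ : Set Pt) : Set (Set Pt) :=
  {R | Relation.ReflTransGen
    (fun A A' => CellAdj A A' ∧ P.IsCell A' ∧ A' ∉ J) R₀ R}

/-- The diagonals that separate a cell of `X` from a junction rectangle. -/
def doors (J X : Set (Set Pt)) : Set (Set Pt) :=
  {d | ∃ R ∈ X, ∃ R' ∈ J, CellAdj R R' ∧ d = R ∩ R'}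

/-- `C` is a corridor with doors `d₁` and `d₂`: either a connected region of the domain with the
junction rectangles removed that has two doors, or (degenerate) a diagonal that bounds two
junction rectangles, both of whose doors are the diagonal itself. -/
def IsCorridor (J : Set (Set Pt)) (C d₁ d₂ : Set Pt) : Prop :=
  (∃ R₀, P.IsCell R₀ ∧ R₀ ∉ J ∧ C = ⋃₀ P.regionCells J R₀ ∧ d₁ ≠ d₂ ∧
      doors J (P.regionCells J R₀) = {d₁, d₂}) ∨
    (∃ R ∈ J, ∃ R' ∈ J, CellAdj R R' ∧ C = R ∩ R' ∧ d₁ = C ∧ d₂ = C)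

end RectilinearDomain

/-! Backbone points of a corridor `C` with doors `d₁` and `d₂`. -/

/-- The heights of the horizontal segments in `C` that join the two doors. -/
def crossingHeights (C d₁ d₂ : Set Pt) : Set ℝ :=
  {y | ∃ p₁ ∈ d₁, ∃ p₂ ∈ d₂, p₁.2 = y ∧ p₂.2 = y ∧ segment ℝ p₁ p₂ ⊆ C}

def IsOpenCorridor (C d₁ d₂ : Set Pt) : Prop := (crossingHeights C d₁ d₂).Nonempty

/-- Endpoints of the upper bridge (the highest crossing segment) and of the lower bridge
(the lowest one). -/
def IsOpenBackbone (C d₁ d₂ : Set Pt) (q : Pt) : Prop :=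
  q ∈ d₁ ∪ d₂ ∧
    (IsGreatest (crossingHeights C d₁ d₂) q.2 ∨ IsLeast (crossingHeights C d₁ d₂) q.2)

/-- The maximal histogram in `C` with (vertical) base `d`: all points of `C` from which `d` is
horizontally visible inside `C`. -/
def maximalHistogram (C d : Set Pt) : Set Pt :=
  {p | ∃ q ∈ d, q.2 = p.2 ∧ segment ℝ p q ⊆ C}

/-- A window of `H` in `C`: a segment on the boundary of `H` that lies in the interior of `C` except
for its two endpoints. -/
def IsWindow (C H w : Set Pt) : Prop :=
  ∃ a b, a ≠ b ∧ w = segment ℝ a b ∧ w ⊆ frontier H ∧ openSegment ℝ a b ⊆ interior C ∧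
    a ∉ interior C ∧ b ∉ interior C

/-- `w` separates `d₁` from `d₂` in `C`. -/
def Separates (C w d₁ d₂ : Set Pt) : Prop :=
  ∀ S ⊆ C, IsPreconnected S → (S ∩ d₁).Nonempty → (S ∩ d₂).Nonempty → (S ∩ w).Nonempty

/-- `q` is the point of the door `d` that is hit by the extension, inside `C`, of the window of the
maximal histogram with base `d` that separates `d` from the other door `d'`. -/
def IsClosedBackbone (C d d' : Set Pt) (q : Pt) : Prop :=
  q ∈ d ∧ ∃ w, IsWindow C (maximalHistogram C d) w ∧ Separates C w d d' ∧
    ∀ p ∈ w, p.2 = q.2 ∧ segment ℝ p q ⊆ C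

/-- The set of all backbone points. -/
def RectilinearDomain.backbone {h : ℕ} (P : RectilinearDomain h) (J : Set (Set Pt)) : Set Pt :=
  {q | ∃ C d₁ d₂, P.IsCorridor J C d₁ d₂ ∧
    ((IsOpenCorridor C d₁ d₂ ∧ IsOpenBackbone C d₁ d₂ q) ∨
      (¬ IsOpenCorridor C d₁ d₂ ∧ IsClosedBackbone C d₁ d₂ q))}

/-! Cut-line trees. -/

/-- A binary tree; each node stores a point through which its vertical cut-line passes. -/
inductive CutTree
  | leaf : CutTree
  | node : Pt → CutTree → CutTree → CutTree

def leftOf (V : Set Pt) (x : ℝ) : Set Pt := {p | p ∈ V ∧ p.1 < x}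

def rightOf (V : Set Pt) (x : ℝ) : Set Pt := {p | p ∈ V ∧ x < p.1}

/-- `T` is a cut-line tree of `V`: the root line passes through a point of `V` of median
`x`-coordinate, and the subtrees are cut-line trees of the points strictly to its left and to its
right. -/
def CutTree.IsCutTree : CutTree → Set Pt → Prop
  | .leaf, V => V = ∅
  | .node m l r, V => m ∈ V ∧ 2 * (leftOf V m.1).encard ≤ V.encard ∧
      2 * (rightOf V m.1).encard ≤ V.encard ∧
      l.IsCutTree (leftOf V m.1) ∧ r.IsCutTree (rightOf V m.1)

/-- The tree `T` on the point set `V` has a node with cut-line `{x} × ℝ` and point set `U`. -/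
def CutTree.HasNode : CutTree → Set Pt → ℝ → Set Pt → Prop
  | .leaf, _, _, _ => False
  | .node m l r, V, x, U => (x = m.1 ∧ U = V) ∨
      l.HasNode (leftOf V m.1) x U ∨ r.HasNode (rightOf V m.1) x U

/-- The Steiner points defined by the points of `U` on the vertical line with abscissa `x`. -/
def steinerPoints (D U : Set Pt) (x : ℝ) : Set Pt :=
  {z | z.1 = x ∧ ∃ v ∈ U, v.2 = z.2 ∧ segment ℝ v z ⊆ D}

/-- Ordinary edges of the graph on `B`, in one of the two orientations: from a point of `B` to a
Steiner point it defines, and from a Steiner point to the next higher one on the same cut-line if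
the two are visible to each other. -/
def IsOrdinaryEdge (D B : Set Pt) (T : CutTree) (p q : Pt) : Prop :=
  ∃ x U, T.HasNode B x U ∧
    ((p ∈ U ∧ q = (x, p.2) ∧ segment ℝ p q ⊆ D) ∨
      (p ∈ steinerPoints D U x ∧ q ∈ steinerPoints D U x ∧ p.2 < q.2 ∧
        (∀ z ∈ steinerPoints D U x, ¬ (p.2 < z.2 ∧ z.2 < q.2)) ∧ segment ℝ p q ⊆ D))

/-! The reduced graph and its paths. -/

/-- A traversed edge of the reduced graph: an ordinary edge from `p` to `q`, or the corridor edge of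
the corridor `C` from `p` to `q`. -/
inductive GraphEdge
  | ordinary (p q : Pt) : GraphEdge
  | corridor (C : Set Pt) (p q : Pt) : GraphEdge

def GraphEdge.src : GraphEdge → Pt
  | .ordinary p _ => p
  | .corridor _ p _ => p

def GraphEdge.tgt : GraphEdge → Pt
  | .ordinary _ q => q
  | .corridor _ _ q => q

noncomputable def GraphEdge.weight : GraphEdge → ℝ
  | .ordinary p q => l1 p q
  | .corridor C p q => geodesicDist C p q

/-- The path `π` in the plane corresponds to the edge: the segment itself for an ordinary edge,
a corridor path (a shortest path inside the corridor) for a corridor edge. -/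
def GraphEdge.Realizes : GraphEdge → List Pt → Prop
  | .ordinary p q, π => π = [p, q]
  | .corridor C p q, π => IsShortestRectPath C p q π

/-- The edges of the reduced graph on the point set `B`, where `J` is the set of junction
rectangles and `T` the cut-line tree of `B` that is used. -/
def RectilinearDomain.reducedGraph {h : ℕ} (P : RectilinearDomain h) (J : Set (Set Pt))
    (B : Set Pt) (T : CutTree) : GraphEdge → Prop
  | .ordinary p q => IsOrdinaryEdge P.carrier B T p q ∨ IsOrdinaryEdge P.carrier B T q p
  | .corridor C q₁ q₂ => ∃ d₁ d₂, P.IsCorridor J C d₁ d₂ ∧ ¬ IsOpenCorridor C d₁ d₂ ∧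
      IsClosedBackbone C d₁ d₂ q₁ ∧ IsClosedBackbone C d₂ d₁ q₂

/-- `γ` is the list of successive edges of a path from `p` to `q` in the graph `E`. -/
def IsGraphPath (E : GraphEdge → Prop) : Pt → Pt → List GraphEdge → Prop
  | p, q, [] => p = q
  | p, q, e :: γ => E e ∧ e.src = p ∧ IsGraphPath E e.tgt q γ

noncomputable def graphWeight (γ : List GraphEdge) : ℝ := (γ.map GraphEdge.weight).sum

def IsShortestGraphPath (E : GraphEdge → Prop) (p q : Pt) (γ : List GraphEdge) : Prop :=
  IsGraphPath E p q γ ∧ ∀ γ', IsGraphPath E p q γ' → graphWeight γ ≤ graphWeight γ'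

/-- The path `π` in the plane corresponds to the graph path `γ` starting at `p`: it is the
concatenation of paths corresponding to the edges of `γ`. -/
def RealizesPath : Pt → List GraphEdge → List Pt → Prop
  | p, [], π => π = [p]
  | _, e :: γ, π => ∃ π₁ π₂, e.Realizes π₁ ∧ RealizesPath e.tgt γ π₂ ∧ π = π₁ ++ π₂.tail

/-! Rectilinear paths. -/

/-! A shortest path in the domain is turned into a graph path that is no longer. Since every graph
path is realized by a planar path of the same length, the two minima agree, and every shortest graph
path is realized by shortest planar paths only.

A planar path is recorded as a chain of cells with the points where it changes cells (`ChainCost`).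
General position makes the cells a `CellSystem`: touching cells share a vertical segment of positive
length, and no three cells have a common point. Loops of a chain can be cut out at no cost, because
a rectangle realizes the `l1` distance between its points. A chain without repetitions between
junction rectangles survives the pruning, since each inner cell has two neighbors on it
(`PrunesTo.mem_of_chain`). Between successive junction rectangles it runs through degree-two cells,
whose region is a corridor with doors at the two ends (`exists_corridorChain`). A cycle in that
region would survive the pruning as well, so the region is tree-like, and a connected set that joins
the doors meets all common sides of successive cells of the chain.

In an open corridor the crossing heights form an interval bounded by sides of cells that the chain
visits, so the path can be pushed into the strip of these heights for free (`clamp_l1_le`). In a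
closed corridor the window at the end of the visible part separates the doors
(`WindowChain.separates`); the path has to meet it and can be led through the backbone point on the
door for free (`IsClosedBackbone.reroute`).

What remains is a sequence of gates linked by free horizontals. Two points of `B` with a free box
between them are joined in the graph at their distance, through a cut-line that separates them
(`BoxFree.reaches`). The invariant `Funnel` carries free boxes from gate to gate: the graph path
turns only at ends of gates, and these belong to `B`. -/

theorem l1_nonneg (p q : Pt) : 0 ≤ l1 p q := by unfold l1; positivity

theorem l1_self (p : Pt) : l1 p p = 0 := by simp [l1]

theorem l1_comm (p q : Pt) : l1 p q = l1 q p := by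
  simp only [l1, abs_sub_comm]

theorem l1_triangle (p q r : Pt) : l1 p r ≤ l1 p q + l1 q r := by
  have h1 := abs_sub_le p.1 q.1 r.1
  have h2 := abs_sub_le p.2 q.2 r.2
  simp only [l1]
  linarith

theorem mem_segment_vert {p q z : Pt} (h : p.1 = q.1) :
    z ∈ segment ℝ p q ↔ z.1 = p.1 ∧ z.2 ∈ Set.uIcc p.2 q.2 := by
  obtain ⟨x, y⟩ := p
  obtain ⟨x', y'⟩ := q
  obtain rfl : x = x' := h
  rw [← Prod.image_mk_segment_right, segment_eq_uIcc]
  constructor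
  · rintro ⟨t, ht, rfl⟩
    exact ⟨rfl, ht⟩
  · rintro ⟨h1, h2⟩
    exact ⟨z.2, h2, Prod.ext h1.symm rfl⟩

theorem mem_segment_horiz {p q z : Pt} (h : p.2 = q.2) :
    z ∈ segment ℝ p q ↔ z.2 = p.2 ∧ z.1 ∈ Set.uIcc p.1 q.1 := by
  obtain ⟨x, y⟩ := p
  obtain ⟨x', y'⟩ := q
  obtain rfl : y = y' := h
  rw [← Prod.image_mk_segment_left, segment_eq_uIcc]
  constructor
  · rintro ⟨t, ht, rfl⟩
    exact ⟨rfl, ht⟩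
  · rintro ⟨h1, h2⟩
    exact ⟨z.1, h2, Prod.ext rfl h1.symm⟩

/-- On an axis-parallel segment, lengths add up. -/
theorem l1_add_of_mem_segment {p q z : Pt} (h : p.1 = q.1 ∨ p.2 = q.2) (hz : z ∈ segment ℝ p q) :
    l1 p z + l1 z q = l1 p q := by
  have key : ∀ a b c : ℝ, c ∈ Set.uIcc a b → |a - c| + |c - b| = |a - b| := by
    intro a b c hc
    rcases Set.mem_uIcc.1 hc with ⟨h1, h2⟩ | ⟨h1, h2⟩
    · rw [abs_of_nonpos, abs_of_nonpos, abs_of_nonpos] <;> linarith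
    · rw [abs_of_nonneg, abs_of_nonneg, abs_of_nonneg] <;> linarith
  rcases h with h | h
  · obtain ⟨h1, h2⟩ := (mem_segment_vert h).1 hz
    have := key _ _ _ h2
    simp only [l1, h1, h, sub_self, abs_zero]
    linarith
  · obtain ⟨h1, h2⟩ := (mem_segment_horiz h).1 hz
    have := key _ _ _ h2
    simp only [l1, h1, h, sub_self, abs_zero]
    linarith

theorem isRectPath_singleton {D : Set Pt} {p : Pt} (hp : p ∈ D) : IsRectPath D p p [p] := by
  refine ⟨rfl, rfl, ?_, by simp⟩
  simpa using hp

theorem isRectPath_cons_cons {D : Set Pt} {p q a b : Pt} {π : List Pt} :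
    IsRectPath D p q (a :: b :: π) ↔
      a = p ∧ (a.1 = b.1 ∨ a.2 = b.2) ∧ segment ℝ a b ⊆ D ∧ IsRectPath D b q (b :: π) := by
  constructor
  · rintro ⟨h1, h2, h3, h4⟩
    rw [List.isChain_cons_cons] at h4
    refine ⟨by simpa using h1, h4.1.1, h4.1.2, rfl, ?_, fun z hz => h3 z (List.mem_cons_of_mem _ hz),
      h4.2⟩
    simpa using h2
  · rintro ⟨rfl, h1, h2, -, h3, h4, h5⟩
    refine ⟨rfl, by simpa using h3, ?_, List.isChain_cons_cons.2 ⟨⟨h1, h2⟩, h5⟩⟩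
    intro z hz
    rcases List.mem_cons.1 hz with rfl | hz
    · exact h2 (left_mem_segment ℝ _ _)
    · exact h4 z hz

theorem isRectPath_singleton_iff {D : Set Pt} {p q a : Pt} :
    IsRectPath D p q [a] ↔ a = p ∧ a = q ∧ a ∈ D := by
  simp [IsRectPath]

theorem not_isRectPath_nil {D : Set Pt} {p q : Pt} : ¬ IsRectPath D p q [] := by
  simp [IsRectPath]

theorem IsRectPath.mono {D D' : Set Pt} (h : D ⊆ D') {p q : Pt} {π : List Pt}
    (hπ : IsRectPath D p q π) : IsRectPath D' p q π :=
  ⟨hπ.1, hπ.2.1, fun z hz => h (hπ.2.2.1 z hz),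
    hπ.2.2.2.imp fun _ _ hab => ⟨hab.1, hab.2.trans h⟩⟩

/-- Concatenation drops the repeated shared point, in the same way as `RealizesPath` does. -/
theorem IsRectPath.append {D : Set Pt} {q r : Pt} {π₂ : List Pt} (h₂ : IsRectPath D q r π₂) :
    ∀ {p : Pt} {π₁ : List Pt}, IsRectPath D p q π₁ →
      IsRectPath D p r (π₁ ++ π₂.tail) ∧
        pathLength (π₁ ++ π₂.tail) = pathLength π₁ + pathLength π₂ := by
  intro p π₁
  induction π₁ generalizing p with
  | nil => intro h; exact (not_isRectPath_nil h).elim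
  | cons a π ih =>
    intro h₁
    cases π with
    | nil =>
      obtain ⟨rfl, rfl, -⟩ := isRectPath_singleton_iff.1 h₁
      match π₂, h₂ with
      | [], h₂ => exact (not_isRectPath_nil h₂).elim
      | [b], h₂ =>
        obtain ⟨rfl, rfl, hb⟩ := isRectPath_singleton_iff.1 h₂
        exact ⟨isRectPath_singleton hb, by simp [pathLength]⟩
      | b :: c :: π', h₂ =>
        obtain ⟨rfl, h⟩ := isRectPath_cons_cons.1 h₂
        exact ⟨h₂, by simp [pathLength]⟩
    | cons b π =>
      obtain ⟨rfl, h1, h2, h3⟩ := isRectPath_cons_cons.1 h₁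
      obtain ⟨h4, h5⟩ := ih h3
      refine ⟨isRectPath_cons_cons.2 ⟨rfl, h1, h2, h4⟩, ?_⟩
      simp only [List.cons_append, pathLength] at h5 ⊢
      linarith

/-- There is a rectilinear path of length `L` from `p` to `q` in `D`. -/
def Conn (D : Set Pt) (p q : Pt) (L : ℝ) : Prop := ∃ π, IsRectPath D p q π ∧ pathLength π = L

namespace Conn

variable {D : Set Pt} {p q r : Pt} {L M : ℝ}

theorem refl (hp : p ∈ D) : Conn D p p 0 := ⟨[p], isRectPath_singleton hp, rfl⟩

theorem seg (h : p.1 = q.1 ∨ p.2 = q.2) (hs : segment ℝ p q ⊆ D) : Conn D p q (l1 p q) :=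
  ⟨[p, q], isRectPath_cons_cons.2 ⟨rfl, h, hs, isRectPath_singleton (hs (right_mem_segment ℝ _ _))⟩,
    by simp [pathLength]⟩

theorem trans (h₁ : Conn D p q L) (h₂ : Conn D q r M) : Conn D p r (L + M) := by
  obtain ⟨π₁, h₁, rfl⟩ := h₁
  obtain ⟨π₂, h₂, rfl⟩ := h₂
  exact ⟨_, (h₂.append h₁).1, (h₂.append h₁).2⟩

theorem mono {D' : Set Pt} (h : D ⊆ D') (h₁ : Conn D p q L) : Conn D' p q L := by
  obtain ⟨π₁, h₁, rfl⟩ := h₁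
  exact ⟨_, h₁.mono h, rfl⟩

/-- Peels off the first segment, so that later arguments need not handle lists of points. -/
theorem induction {motive : Pt → ℝ → Prop} (hq : q ∈ D → motive q 0)
    (step : ∀ p a L, (p.1 = a.1 ∨ p.2 = a.2) → segment ℝ p a ⊆ D → Conn D a q L → motive a L →
      motive p (l1 p a + L)) (h : Conn D p q L) : motive p L := by
  obtain ⟨π, h, rfl⟩ := h
  induction π generalizing p with
  | nil => exact (not_isRectPath_nil h).elim
  | cons a π ih =>
    cases π with
    | nil =>
      obtain ⟨rfl, rfl, ha⟩ := isRectPath_singleton_iff.1 h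
      exact hq ha
    | cons b π =>
      obtain ⟨rfl, h1, h2, h3⟩ := isRectPath_cons_cons.1 h
      exact step _ _ _ h1 h2 ⟨_, h3, rfl⟩ (ih h3)

theorem l1_le (h : Conn D p q L) : l1 p q ≤ L := by
  refine Conn.induction (motive := fun p L => l1 p q ≤ L) (fun _ => (l1_self q).le) ?_ h
  intro p a L _ _ _ ih
  linarith [l1_triangle p a q]

/-- The trace of a path: a connected set at each of whose points the path can be cut. -/
theorem exists_trace (h : Conn D p q L) : ∃ S ⊆ D, IsPreconnected S ∧ p ∈ S ∧ q ∈ S ∧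
    ∀ z ∈ S, ∃ L₁ L₂, Conn D p z L₁ ∧ Conn D z q L₂ ∧ L₁ + L₂ = L := by
  refine Conn.induction (motive := fun p L => ∃ S ⊆ D, IsPreconnected S ∧ p ∈ S ∧ q ∈ S ∧
    ∀ z ∈ S, ∃ L₁ L₂, Conn D p z L₁ ∧ Conn D z q L₂ ∧ L₁ + L₂ = L) ?_ ?_ h
  · intro hq
    refine ⟨{q}, by simpa using hq, isPreconnected_singleton, rfl, rfl, ?_⟩
    rintro z rfl
    exact ⟨0, 0, refl hq, refl hq, by simp⟩
  · intro p a L h1 h2 h3 ih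
    obtain ⟨S, hS, hc, ha, hq, hz⟩ := ih
    refine ⟨segment ℝ p a ∪ S, Set.union_subset h2 hS,
      IsPreconnected.union a (right_mem_segment ℝ _ _) ha (convex_segment _ _).isPreconnected hc,
      Or.inl (left_mem_segment ℝ _ _), Or.inr hq, ?_⟩
    rintro z (hz' | hz')
    · refine ⟨l1 p z, l1 z a + L, seg ?_ ?_, trans (seg ?_ ?_) h3, ?_⟩
      · rcases h1 with h | h
        · exact Or.inl ((mem_segment_vert h).1 hz').1.symm
        · exact Or.inr ((mem_segment_horiz h).1 hz').1.symm
      · exact ((convex_segment p a).segment_subset (left_mem_segment ℝ _ _) hz').trans h2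
      · rcases h1 with h | h
        · exact Or.inl (((mem_segment_vert h).1 hz').1.trans h)
        · exact Or.inr (((mem_segment_horiz h).1 hz').1.trans h)
      · exact ((convex_segment p a).segment_subset hz' (right_mem_segment ℝ _ _)).trans h2
      · rw [← l1_add_of_mem_segment h1 hz']; ring
    · obtain ⟨L₁, L₂, k1, k2, rfl⟩ := hz z hz'
      exact ⟨l1 p a + L₁, L₂, trans (seg h1 h2) k1, k2, by ring⟩

theorem geodesicDist_le (h : Conn D p q L) : geodesicDist D p q ≤ L := by
  obtain ⟨π, h, rfl⟩ := h
  refine csInf_le ⟨0, ?_⟩ ⟨π, h, rfl⟩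
  rintro _ ⟨π', h', rfl⟩
  exact (l1_nonneg p q).trans (l1_le ⟨π', h', rfl⟩)

end Conn

theorem IsShortestRectPath.pathLength_eq {D : Set Pt} {p q : Pt} {π : List Pt}
    (h : IsShortestRectPath D p q π) : pathLength π = geodesicDist D p q := by
  refine le_antisymm (le_csInf ⟨_, π, h.1, rfl⟩ ?_) (Conn.geodesicDist_le ⟨π, h.1, rfl⟩)
  rintro _ ⟨π₁, h₁, rfl⟩
  exact h.2 π₁ h₁

/-! Boxes and chains of boxes. -/

/-- Cells are bare sets, so their sides are recovered as extrema of the projections; the values are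
meaningful only for boxes. -/
noncomputable def xlo (A : Set Pt) : ℝ := sInf (Set.image Prod.fst A)
noncomputable def xhi (A : Set Pt) : ℝ := sSup (Set.image Prod.fst A)
noncomputable def ylo (A : Set Pt) : ℝ := sInf (Set.image Prod.snd A)
noncomputable def yhi (A : Set Pt) : ℝ := sSup (Set.image Prod.snd A)

/-- `A` is an axis-parallel rectangle with nonempty interior. -/
def IsBox (A : Set Pt) : Prop := xlo A < xhi A ∧ ylo A < yhi A ∧
  A = Set.Icc (xlo A) (xhi A) ×ˢ Set.Icc (ylo A) (yhi A)

theorem box_coords {a b c d : ℝ} (hab : a ≤ b) (hcd : c ≤ d) :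
    xlo (Set.Icc a b ×ˢ Set.Icc c d) = a ∧ xhi (Set.Icc a b ×ˢ Set.Icc c d) = b ∧
      ylo (Set.Icc a b ×ˢ Set.Icc c d) = c ∧ yhi (Set.Icc a b ×ˢ Set.Icc c d) = d := by
  simp only [xlo, xhi, ylo, yhi, Set.fst_image_prod _ (Set.nonempty_Icc.2 hcd),
    Set.snd_image_prod (Set.nonempty_Icc.2 hab), csInf_Icc hab, csSup_Icc hab, csInf_Icc hcd,
    csSup_Icc hcd, and_self]

theorem isBox_prod {a b c d : ℝ} (hab : a < b) (hcd : c < d) :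
    IsBox (Set.Icc a b ×ˢ Set.Icc c d) := by
  obtain ⟨h1, h2, h3, h4⟩ := box_coords hab.le hcd.le
  unfold IsBox
  rw [h1, h2, h3, h4]
  exact ⟨hab, hcd, rfl⟩

namespace IsBox

variable {A : Set Pt} (h : IsBox A)
include h

theorem mem_iff {p : Pt} :
    p ∈ A ↔ (xlo A ≤ p.1 ∧ p.1 ≤ xhi A) ∧ ylo A ≤ p.2 ∧ p.2 ≤ yhi A := by
  conv_lhs => rw [h.2.2]
  exact Iff.rfl

theorem isCompact : IsCompact A := by
  rw [h.2.2]; exact isCompact_Icc.prod isCompact_Icc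

theorem convex : Convex ℝ A := by
  rw [h.2.2]; exact (convex_Icc _ _).prod (convex_Icc _ _)

theorem interior_eq :
    interior A = Set.Ioo (xlo A) (xhi A) ×ˢ Set.Ioo (ylo A) (yhi A) := by
  conv_lhs => rw [h.2.2]
  rw [interior_prod_eq, interior_Icc, interior_Icc]

/-- The L-shaped path with corner `(q.1, p.2)` stays in the rectangle and realizes the distance. -/
theorem conn {p q : Pt} (hp : p ∈ A) (hq : q ∈ A) : Conn A p q (l1 p q) := by
  have hc : ((q.1, p.2) : Pt) ∈ A := by
    rw [h.mem_iff] at hp hq ⊢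
    exact ⟨hq.1, hp.2⟩
  have := (Conn.seg (p := p) (q := (q.1, p.2)) (Or.inr rfl) (h.convex.segment_subset hp hc)).trans
    (Conn.seg (q := q) (Or.inl rfl) (h.convex.segment_subset hc hq))
  convert this using 1
  simp [l1]

end IsBox

/-- `ChainCost q p ℓ L`: the path that starts at `p`, runs through the successive sets in the list
`ℓ`, changing sets at common points, and ends at `q`, has cost `L`. -/
inductive ChainCost (q : Pt) : Pt → List (Set Pt) → ℝ → Prop
  | last {p A} : p ∈ A → q ∈ A → ChainCost q p [A] (l1 p q)
  | cons {p z A B ℓ L} : p ∈ A → z ∈ A → ChainCost q z (B :: ℓ) L →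
      ChainCost q p (A :: B :: ℓ) (l1 p z + L)

namespace ChainCost

variable {p q r z : Pt} {ℓ ℓ' : List (Set Pt)} {A B : Set Pt} {L M : ℝ}

theorem ne_nil (h : ChainCost q p ℓ L) : ℓ ≠ [] := by cases h <;> simp

theorem start_mem (h : ChainCost q p (A :: ℓ) L) : p ∈ A := by cases h <;> assumption

theorem l1_le (h : ChainCost q p ℓ L) : l1 p q ≤ L := by
  induction h with
  | last => exact le_rfl
  | @cons p z A B ℓ L _ _ _ ih => linarith [l1_triangle p z q]

theorem append (h₁ : ChainCost q p ℓ L) (h₂ : ChainCost r q ℓ' M) :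
    ChainCost r p (ℓ ++ ℓ') (L + M) := by
  induction h₁ with
  | last hp hq =>
    match ℓ', h₂ with
    | [], h₂ => exact (h₂.ne_nil rfl).elim
    | B :: ℓ', h₂ => exact cons hp hq h₂
  | cons hp hz _ ih =>
    rw [add_assoc]
    exact cons hp hz ih

/-- The cut point `z` is where the chain changes from the last set of `ℓ₁` to `A`. -/
theorem split {ℓ₁ ℓ₂ : List (Set Pt)} (hne : ℓ₁ ≠ []) (h : ChainCost q p (ℓ₁ ++ A :: ℓ₂) L) :
    ∃ z L₁ L₂, ChainCost z p ℓ₁ L₁ ∧ ChainCost q z (A :: ℓ₂) L₂ ∧ L = L₁ + L₂ := by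
  induction ℓ₁ generalizing p L with
  | nil => exact (hne rfl).elim
  | cons B ℓ₁ ih =>
    cases ℓ₁ with
    | nil =>
      cases h with
      | cons hp hz h => exact ⟨_, _, _, last hp hz, h, rfl⟩
    | cons B' ℓ₁ =>
      cases h with
      | cons hp hz h =>
        obtain ⟨w, L₁, L₂, h1, h2, rfl⟩ := ih (by simp) h
        exact ⟨w, _, L₂, cons hp hz h1, h2, by ring⟩

theorem conn {D : Set Pt} (h : ChainCost q p ℓ L) (hb : ∀ A ∈ ℓ, IsBox A ∧ A ⊆ D) :
    Conn D p q L := by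
  induction h with
  | @last p A hp hq => exact ((hb A (by simp)).1.conn hp hq).mono (hb A (by simp)).2
  | @cons p z A B ℓ L hp hz _ ih =>
    exact (((hb A (by simp)).1.conn hp hz).mono (hb A (by simp)).2).trans
      (ih fun A' hA' => hb A' (List.mem_cons_of_mem _ hA'))

/-- If a chain visits `A`, then it can be entered directly at `A`. -/
theorem exists_suffix (h : ChainCost q z ℓ L) (hA : A ∈ ℓ) (hp : p ∈ A) :
    ∃ ℓ' L', (A :: ℓ') <:+ ℓ ∧ ChainCost q p (A :: ℓ') L' ∧ L' ≤ l1 p z + L := by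
  induction h with
  | @last z B hz hq =>
    obtain rfl : A = B := by simpa using hA
    exact ⟨[], _, List.suffix_rfl, last hp hq, l1_triangle _ _ _⟩
  | @cons z z' B B' ℓ L hz hz' h ih =>
    rcases eq_or_ne A B with rfl | hne
    · exact ⟨_, _, List.suffix_rfl, cons hp hz' h, by linarith [l1_triangle p z z']⟩
    · obtain ⟨ℓ', L', h1, h2, h3⟩ := ih (by
        rcases List.mem_cons.1 hA with h | h
        · exact (hne h).elim
        · exact h)
      exact ⟨ℓ', L', h1.trans (List.suffix_cons _ _), h2, by linarith [l1_triangle p z z']⟩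

/-- The tail is shortened first. If the head `A` recurs in it, the chain may be entered directly at
that recurrence, and the triangle inequality shows that nothing is lost. The first and last sets are
kept because they have to remain junction rectangles. -/
theorem exists_nodup (h : ChainCost q p (A :: ℓ) L) :
    ∃ ℓ' L', ChainCost q p (A :: ℓ') L' ∧ L' ≤ L ∧ (A :: ℓ').Nodup ∧ (A :: ℓ') ⊆ A :: ℓ ∧
      (A :: ℓ').getLast? = (A :: ℓ).getLast? := by
  induction ℓ generalizing p A L with
  | nil => exact ⟨[], L, h, le_rfl, by simp, fun _ h => h, rfl⟩
  | cons B ℓ ih =>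
    cases h with
    | @cons _ z _ _ _ L hp hz h =>
      obtain ⟨ℓ', L', h1, h2, h3, h4, h5⟩ := ih h
      by_cases hA : A ∈ B :: ℓ'
      · obtain ⟨ℓ'', L'', k1, k2, k3⟩ := h1.exists_suffix hA hp
        refine ⟨ℓ'', L'', k2, by linarith, h3.sublist k1.sublist, ?_, ?_⟩
        · exact fun x hx => List.mem_cons_of_mem _ (h4 (k1.subset hx))
        · rw [List.getLast?_cons_cons, ← h5]
          obtain ⟨t, ht⟩ := k1
          rw [← ht, List.getLast?_append]
          cases hh : (A :: ℓ'').getLast? with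
          | none => simp at hh
          | some x => rfl
      · refine ⟨B :: ℓ', _, cons hp hz h1, by linarith, List.nodup_cons.2 ⟨hA, h3⟩, ?_, ?_⟩
        · exact List.cons_subset_cons _ h4
        · rw [List.getLast?_cons_cons, h5, List.getLast?_cons_cons]

end ChainCost

/-- A point has a neighborhood in which every point of a finite union of closed sets shares one of
these sets with it. -/
theorem exists_nhds_common {X : Type*} [TopologicalSpace X] {F : Set (Set X)} (hF : F.Finite)
    (hc : ∀ A ∈ F, IsClosed A) (z : X) : ∃ U ∈ nhds z, ∀ w ∈ U, ∀ A ∈ F, w ∈ A → z ∈ A := by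
  refine ⟨(⋃₀ {A | A ∈ F ∧ z ∉ A})ᶜ, ?_, ?_⟩
  · refine IsOpen.mem_nhds ?_ ?_
    · rw [isOpen_compl_iff]
      rw [Set.sUnion_eq_biUnion]
      exact (hF.subset (fun A hA => hA.1 : {A | A ∈ F ∧ z ∉ A} ⊆ F)).isClosed_biUnion
        fun A hA => hc A hA.1
    · rintro ⟨A, hA, hz⟩
      exact hA.2 hz
  · intro w hw A hA hwA
    by_contra hz
    exact hw ⟨A, ⟨hA, hz⟩, hwA⟩

/-- A continuity argument along the segment: near any parameter, a box that contains the moving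
point also contains the limit point, so this one box extends a chain of exact cost from one of the
two parameters to the other. -/
theorem exists_chainCost_segment {F : Set (Set Pt)} (hF : F.Finite) (hb : ∀ A ∈ F, IsBox A)
    {p q : Pt} (hs : segment ℝ p q ⊆ ⋃₀ F) :
    ∃ ℓ, (∀ A ∈ ℓ, A ∈ F) ∧ ChainCost q p ℓ (l1 p q) := by
  set z : ℝ → Pt := fun t => AffineMap.lineMap p q t with hz
  have hzc : Continuous z := AffineMap.lineMap_continuous
  have hz0 : z 0 = p := by simp [hz]
  have hz1 : z 1 = q := by simp [hz]
  have hmem : ∀ t ∈ Set.Icc (0 : ℝ) 1, z t ∈ ⋃₀ F := fun t ht => hs (by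
    rw [segment_eq_image_lineMap]; exact ⟨t, ht, rfl⟩)
  have hl : ∀ s t : ℝ, s ≤ t → l1 (z s) (z t) = (t - s) * l1 p q := by
    intro s t hst
    have e1 : (z s).1 - (z t).1 = (t - s) * (p.1 - q.1) := by
      simp [hz, AffineMap.lineMap_apply]; ring
    have e2 : (z s).2 - (z t).2 = (t - s) * (p.2 - q.2) := by
      simp [hz, AffineMap.lineMap_apply]; ring
    simp only [l1]
    rw [e1, e2, abs_mul, abs_mul, abs_of_nonneg (sub_nonneg.2 hst)]; ring
  -- The cost of the chain up to parameter `t` is exactly the length travelled.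
  let G : ℝ → Prop := fun t => ∃ ℓ, (∀ A ∈ ℓ, A ∈ F) ∧ ChainCost (z t) p ℓ (t * l1 p q)
  have hext : ∀ s t : ℝ, s ≤ t → G s → ∀ A ∈ F, z s ∈ A → z t ∈ A → G t := by
    rintro s t hst ⟨ℓ, hℓ, hG⟩ A hA hs ht
    refine ⟨ℓ ++ [A], ?_, ?_⟩
    · intro B hB
      rcases List.mem_append.1 hB with hB | hB
      · exact hℓ B hB
      · obtain rfl : B = A := by simpa using hB
        exact hA
    · have := hG.append (ChainCost.last hs ht)
      rw [hl s t hst] at this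
      convert this using 1; ring
  have hG0 : G 0 := by
    obtain ⟨A, hA, h0⟩ := hmem 0 (by simp)
    refine ⟨[A], by simpa using hA, ?_⟩
    have := ChainCost.last (A := A) (p := p) (q := z 0) (by rwa [← hz0]) h0
    simpa [hz0, l1_self] using this
  have hcl : ∀ A ∈ F, IsClosed A := fun A hA => (hb A hA).isCompact.isClosed
  -- The parameters up to which chains exist form a closed set that extends to the right of each of
  -- its points below `1`, hence fill the interval.
  have key : Set.Icc (0 : ℝ) 1 ⊆ {t | ∀ s ∈ Set.Icc 0 t, G s} := by
    refine IsClosed.Icc_subset_of_forall_mem_nhdsWithin ?_ ?_ ?_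
    · rw [← closure_subset_iff_isClosed]
      intro t ht
      have htI : t ∈ Set.Icc (0 : ℝ) 1 :=
        isClosed_Icc.closure_subset (closure_mono Set.inter_subset_right ht)
      obtain ⟨U, hU, hU'⟩ := exists_nhds_common hF hcl (z t)
      obtain ⟨s, hsU, hs, hsI⟩ := mem_closure_iff_nhds.1 ht _ (hzc.continuousAt hU)
      have hGt : G t := by
        rcases le_total t s with hts | hst
        · exact hs t ⟨htI.1, hts⟩
        · obtain ⟨A, hA, hsA⟩ := hmem s hsI
          exact hext s t hst (hs s ⟨hsI.1, le_rfl⟩) A hA hsA (hU' _ hsU A hA hsA)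
      refine ⟨fun r hr => ?_, htI⟩
      rcases eq_or_lt_of_le hr.2 with rfl | hrt
      · exact hGt
      · obtain ⟨s', hs'U, hs', -⟩ := mem_closure_iff_nhds.1 ht _ (Ioi_mem_nhds hrt)
        exact hs' r ⟨hr.1, le_of_lt hs'U⟩
    · intro s hs
      obtain rfl : s = 0 := le_antisymm hs.2 hs.1
      exact hG0
    · rintro t ⟨ht, htI⟩
      obtain ⟨U, hU, hU'⟩ := exists_nhds_common hF hcl (z t)
      obtain ⟨b, hb', hbU⟩ := exists_Ico_subset_of_mem_nhds (hzc.continuousAt hU)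
        ⟨1, htI.2⟩
      refine Filter.mem_of_superset (Ioo_mem_nhdsGT (lt_min hb' htI.2)) ?_
      intro s hs r hr
      rcases le_total r t with hrt | htr
      · exact ht r ⟨hr.1, hrt⟩
      · have hrb : r < min b 1 := lt_of_le_of_lt hr.2 hs.2
        obtain ⟨A, hA, hrA⟩ := hmem r ⟨hr.1, (hrb.trans_le (min_le_right _ _)).le⟩
        exact hext t r htr (ht t ⟨htI.1, le_rfl⟩) A hA
          (hU' _ (hbU ⟨htr, hrb.trans_le (min_le_left _ _)⟩) A hA hrA) hrA
  obtain ⟨ℓ, h1, h2⟩ := key (Set.right_mem_Icc.2 zero_le_one) 1 (by simp)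
  rw [hz1, one_mul] at h2
  exact ⟨ℓ, h1, h2⟩

theorem Conn.exists_chainCost {F : Set (Set Pt)} (hF : F.Finite) (hb : ∀ A ∈ F, IsBox A)
    {p q : Pt} {L : ℝ} (h : Conn (⋃₀ F) p q L) :
    ∃ ℓ, (∀ A ∈ ℓ, A ∈ F) ∧ ChainCost q p ℓ L := by
  refine Conn.induction (motive := fun p L => ∃ ℓ, (∀ A ∈ ℓ, A ∈ F) ∧ ChainCost q p ℓ L) ?_ ?_ h
  · intro hq
    obtain ⟨A, hA, hqA⟩ := hq
    refine ⟨[A], by simpa using hA, ?_⟩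
    have := ChainCost.last hqA hqA
    rwa [l1_self] at this
  · intro p a L _ h2 _ ih
    obtain ⟨ℓ, h3, h4⟩ := ih
    obtain ⟨ℓ', h5, h6⟩ := exists_chainCost_segment hF hb h2
    refine ⟨ℓ' ++ ℓ, ?_, h6.append h4⟩
    intro A hA
    rcases List.mem_append.1 hA with hA | hA
    · exact h5 A hA
    · exact h3 A hA

/-- A path inside a finite union of boxes gives rise to a chain without repetitions, with given first
and last boxes. -/
theorem Conn.exists_nodup_chainCost {F : Set (Set Pt)} (hF : F.Finite) (hb : ∀ A ∈ F, IsBox A)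
    {p q : Pt} {L : ℝ} (h : Conn (⋃₀ F) p q L) {A B : Set Pt} (hA : A ∈ F) (hpA : p ∈ A)
    (hB : B ∈ F) (hqB : q ∈ B) :
    ∃ ℓ M, (∀ A' ∈ A :: ℓ, A' ∈ F) ∧ ChainCost q p (A :: ℓ) M ∧ M ≤ L ∧ (A :: ℓ).Nodup ∧
      (A :: ℓ).getLast? = some B := by
  obtain ⟨ℓ, h1, h2⟩ := h.exists_chainCost hF hb
  have h3 := (ChainCost.last hpA hpA).append (h2.append (ChainCost.last hqB hqB))
  rw [l1_self, l1_self, zero_add, add_zero, List.singleton_append] at h3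
  obtain ⟨ℓ', M, h4, h5, h6, h7, h8⟩ := h3.exists_nodup
  refine ⟨ℓ', M, ?_, h4, h5, h6, ?_⟩
  · intro A' hA'
    have := h7 hA'
    simp only [List.mem_cons, List.mem_append, List.not_mem_nil, or_false] at this
    rcases this with rfl | h | rfl
    · exact hA
    · exact h1 _ h
    · exact hB
  · rw [h8, ← List.cons_append, List.getLast?_append]
    rfl


/-! The cells of the vertical visibility decomposition. -/

/-- The combinatorial properties of the cells of the vertical visibility decomposition of a
rectilinear domain in general position: two cells that meet share a vertical segment of positive
length, and all horizontal sides at the same height lie on a common segment that avoids the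
interiors of the cells. -/
structure CellSystem (F : Set (Set Pt)) : Prop where
  finite : F.Finite
  box : ∀ A ∈ F, IsBox A
  touch : ∀ A ∈ F, ∀ B ∈ F, A ≠ B → (A ∩ B).Nonempty →
    (xhi A = xlo B ∨ xhi B = xlo A) ∧ max (ylo A) (ylo B) < min (yhi A) (yhi B)
  horiz : ∀ A ∈ F, ∀ B ∈ F, ∀ R ∈ F, ∀ y, (y = ylo A ∨ y = yhi A) → (y = ylo B ∨ y = yhi B) →
    ylo R < y → y < yhi R → ∀ x ∈ Set.Ioo (xlo R) (xhi R), ∀ a ∈ Set.Icc (xlo A) (xhi A),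
      ∀ b ∈ Set.Icc (xlo B) (xhi B), a ≤ x → ¬ x ≤ b

/-- Off the frontier, the interior and the complement of the closure are a partition into open sets.
Applied to rectangles and half-balls that avoid the boundary of the domain or of a cell. -/
theorem IsPreconnected.subset_interior_or {X : Type*} [TopologicalSpace X] {S T : Set X}
    (hS : IsPreconnected S) (h : Disjoint S (frontier T)) :
    S ⊆ interior T ∨ S ⊆ (closure T)ᶜ := by
  refine hS.subset_or_subset isOpen_interior isClosed_closure.isOpen_compl ?_ ?_
  · rw [Set.disjoint_compl_right_iff_subset]
    exact interior_subset.trans subset_closure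
  · intro x hx
    by_cases hc : x ∈ closure T
    · by_cases hi : x ∈ interior T
      · exact Or.inl hi
      · exact (Set.disjoint_left.1 h hx ⟨hc, hi⟩).elim
    · exact Or.inr hc

theorem Set.Finite.exists_mem_Ioo_notMem {V : Set ℝ} (hV : V.Finite) {a b : ℝ} (h : a < b) :
    ∃ x ∈ Set.Ioo a b, x ∉ V := by
  by_contra! hc
  exact (Set.Ioo_infinite h) (hV.subset hc)

/-- Facts known off the finitely many abscissae of vertical edges extend to closed sides by density.
-/
theorem Set.Finite.Icc_subset_closure_diff {V : Set ℝ} (hV : V.Finite) {a b : ℝ} (h : a < b) :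
    Set.Icc a b ⊆ closure (Set.Ioo a b ∩ Vᶜ) := by
  rw [← closure_Ioo h.ne]
  exact closure_minimal ((hV.countable.dense_compl ℝ).open_subset_closure_inter isOpen_Ioo)
    isClosed_closure

theorem IsBox.frontier_eq {A : Set Pt} (h : IsBox A) :
    frontier A = {z | z ∈ A ∧ (z.1 = xlo A ∨ z.1 = xhi A ∨ z.2 = ylo A ∨ z.2 = yhi A)} := by
  ext z
  rw [frontier, h.isCompact.isClosed.closure_eq, h.interior_eq]
  constructor
  · rintro ⟨h1, h2⟩
    refine ⟨h1, ?_⟩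
    rw [h.mem_iff] at h1
    by_contra! hc
    exact h2 ⟨⟨lt_of_le_of_ne h1.1.1 (Ne.symm hc.1), lt_of_le_of_ne h1.1.2 hc.2.1⟩,
      lt_of_le_of_ne h1.2.1 (Ne.symm hc.2.2.1), lt_of_le_of_ne h1.2.2 hc.2.2.2⟩
  · rintro ⟨h1, h2⟩
    refine ⟨h1, ?_⟩
    rintro ⟨⟨h3, h4⟩, h5, h6⟩
    rcases h2 with h | h | h | h <;> linarith

/-! ### Edges in general position, and how cells touch. -/

namespace RectilinearDomain

variable {h : ℕ} (P : RectilinearDomain h)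

/-- The index type of the edges. -/
abbrev EdgeIdx : Type := (c : Fin (h + 1)) × ZMod (P.size c)

theorem finite_edgeIdx : Finite P.EdgeIdx := by
  have : ∀ c, NeZero (P.size c) := fun c => ⟨by have := P.four_le_size c; omega⟩
  infer_instance

variable {P}

def EdgeIdx.src (e : P.EdgeIdx) : Pt := P.vertex e.1 e.2
def EdgeIdx.tgt (e : P.EdgeIdx) : Pt := P.vertex e.1 (e.2 + 1)
def EdgeIdx.IsVert (e : P.EdgeIdx) : Prop := e.src.1 = e.tgt.1
def EdgeIdx.IsHor (e : P.EdgeIdx) : Prop := e.src.2 = e.tgt.2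

/-- The segment of an edge. -/
def EdgeIdx.carrier (e : P.EdgeIdx) : Set Pt := P.edge e.1 e.2

theorem EdgeIdx.carrier_eq (e : P.EdgeIdx) : e.carrier = segment ℝ e.src e.tgt := rfl

namespace EdgeIdx

variable {e e' : P.EdgeIdx}

theorem isVert_or_isHor (e : P.EdgeIdx) : e.IsVert ∨ e.IsHor := P.axis_parallel e.1 e.2

theorem IsHor.not_isVert (he : e.IsHor) : ¬ e.IsVert := fun hv =>
  P.vertex_ne e.1 e.2 (Prod.ext hv he)

theorem isClosed_carrier (e : P.EdgeIdx) : IsClosed e.carrier := by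
  rw [carrier_eq, segment_eq_image_lineMap]
  exact (isCompact_Icc.image AffineMap.lineMap_continuous).isClosed

theorem IsHor.mem_iff (he : e.IsHor) {z : Pt} :
    z ∈ e.carrier ↔ z.2 = e.src.2 ∧ z.1 ∈ Set.uIcc e.src.1 e.tgt.1 := mem_segment_horiz he

theorem IsVert.mem_iff (he : e.IsVert) {z : Pt} :
    z ∈ e.carrier ↔ z.1 = e.src.1 ∧ z.2 ∈ Set.uIcc e.src.2 e.tgt.2 := mem_segment_vert he

theorem IsHor.exists_isVert_tgt (he : e.IsHor) :
    ∃ e' : P.EdgeIdx, e'.IsVert ∧ e.tgt ∈ e'.carrier := by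
  refine ⟨⟨e.1, e.2 + 1⟩, ?_, left_mem_segment ℝ _ _⟩
  have h1 := P.alternate e.1 e.2
  rcases P.axis_parallel e.1 (e.2 + 1) with h2 | h2
  · exact h2
  · exact (he.not_isVert (h1.2 h2)).elim

theorem IsHor.exists_isVert_src (he : e.IsHor) :
    ∃ e' : P.EdgeIdx, e'.IsVert ∧ e.src ∈ e'.carrier := by
  have h1 := P.alternate e.1 (e.2 - 1)
  have h0 : P.vertex e.1 (e.2 - 1 + 1) = e.src := by rw [sub_add_cancel]; rfl
  rw [sub_add_cancel] at h1
  refine ⟨⟨e.1, e.2 - 1⟩, ?_, ?_⟩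
  · unfold IsVert src tgt
    simp only [sub_add_cancel]
    exact h1.2 he
  · rw [← h0]
    exact right_mem_segment ℝ _ _

/-- Edges that are not consecutive on a cycle are disjoint. For consecutive ones the common point is
determined: its height comes from the horizontal edge, its abscissa from the vertical one. -/
theorem IsHor.eq_src_or_tgt (he : e.IsHor) (he' : e'.IsVert) {z : Pt} (hz : z ∈ e.carrier)
    (hz' : z ∈ e'.carrier) : z = e.src ∨ z = e.tgt := by
  obtain ⟨c, i⟩ := e
  obtain ⟨c', j⟩ := e'
  rcases eq_or_ne c c' with rfl | hc
  · have hij : i ≠ j := by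
      rintro rfl
      exact he.not_isVert he'
    have m1 := he.mem_iff.1 hz
    have m2 := he'.mem_iff.1 hz'
    by_cases h1 : j = i + 1
    · subst h1
      right
      exact Prod.ext m2.1 (m1.1.trans he)
    · by_cases h2 : i = j + 1
      · subst h2
        left
        exact Prod.ext (m2.1.trans he') m1.1
      · exact (Set.disjoint_left.1 (P.cycle_simple c i j hij h1 h2) hz hz').elim
  · exact (Set.disjoint_left.1 (P.cycles_disjoint c c' hc i j) hz hz').elim

end EdgeIdx

theorem mem_frontier_iff {z : Pt} : z ∈ frontier P.carrier ↔ ∃ e : P.EdgeIdx, z ∈ e.carrier := by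
  rw [P.frontier_eq]
  simp only [Set.mem_iUnion]
  exact ⟨fun ⟨c, i, hz⟩ => ⟨⟨c, i⟩, hz⟩, fun ⟨⟨c, i⟩, hz⟩ => ⟨c, i, hz⟩⟩

theorem EdgeIdx.carrier_subset (e : P.EdgeIdx) : e.carrier ⊆ P.carrier := fun _ hz =>
  P.isCompact.isClosed.frontier_subset (mem_frontier_iff.2 ⟨e, hz⟩)

/-- The abscissae of the vertical edges. -/
def vertAbs (P : RectilinearDomain h) : Set ℝ := {x | ∃ e : P.EdgeIdx, e.IsVert ∧ e.src.1 = x}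

/-- The heights of the horizontal edges. -/
def horHeights (P : RectilinearDomain h) : Set ℝ := {y | ∃ e : P.EdgeIdx, e.IsHor ∧ e.src.2 = y}

theorem finite_vertAbs : P.vertAbs.Finite := by
  have := P.finite_edgeIdx
  refine (Set.finite_range (fun e : P.EdgeIdx => e.src.1)).subset ?_
  rintro x ⟨e, -, rfl⟩
  exact ⟨e, rfl⟩

theorem finite_horHeights : P.horHeights.Finite := by
  have := P.finite_edgeIdx
  refine (Set.finite_range (fun e : P.EdgeIdx => e.src.2)).subset ?_
  rintro x ⟨e, -, rfl⟩
  exact ⟨e, rfl⟩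

theorem GeneralPosition.eq_of_isHor (hP : P.GeneralPosition) {e e' : P.EdgeIdx} (he : e.IsHor)
    (he' : e'.IsHor) (h : e.src.2 = e'.src.2) : e = e' := by
  by_contra hne
  refine hP e e' hne ?_
  rw [collinear_iff_exists_forall_eq_smul_vadd]
  refine ⟨e.src, (1, 0), ?_⟩
  have key : ∀ z : Pt, z.2 = e.src.2 → ∃ r : ℝ, z = r • ((1, 0) : Pt) +ᵥ e.src := by
    intro z hz
    refine ⟨z.1 - e.src.1, Prod.ext ?_ ?_⟩ <;> simp [hz]
  rintro z (hz | hz)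
  · exact key z (he.mem_iff.1 hz).1
  · exact key z ((he'.mem_iff.1 hz).1.trans h.symm)

/-- Near a point of a horizontal edge that is on no vertical edge, only one side of the edge belongs
to the domain. -/
theorem GeneralPosition.not_both_sides (hP : P.GeneralPosition) {e : P.EdgeIdx} (he : e.IsHor)
    {z : Pt} (hz : z ∈ e.carrier) (hv : ∀ e' : P.EdgeIdx, e'.IsVert → z ∉ e'.carrier)
    (hup : z ∈ closure (P.carrier ∩ {w | z.2 < w.2}))
    (hdn : z ∈ closure (P.carrier ∩ {w | w.2 < z.2})) : False := by
  have := P.finite_edgeIdx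
  -- The other edges stay away from `z`, so the boundary near `z` lies at the height of `z`.
  have hO : IsClosed (⋃ e' ∈ {e' : P.EdgeIdx | e' ≠ e}, e'.carrier) :=
    (Set.toFinite _).isClosed_biUnion fun e' _ => e'.isClosed_carrier
  have hzO : z ∈ (⋃ e' ∈ {e' : P.EdgeIdx | e' ≠ e}, e'.carrier)ᶜ := by
    simp only [Set.mem_compl_iff, Set.mem_iUnion, not_exists]
    intro e' hne hz'
    rcases e'.isVert_or_isHor with h1 | h1
    · exact hv e' h1 hz'
    · exact hne (hP.eq_of_isHor h1 he ((h1.mem_iff.1 hz').1.symm.trans (he.mem_iff.1 hz).1))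
  obtain ⟨ε, hε, hball⟩ := Metric.isOpen_iff.1 hO.isOpen_compl z hzO
  have hfr : ∀ w ∈ Metric.ball z ε, w ∈ frontier P.carrier → w.2 = z.2 := by
    intro w hw hwf
    obtain ⟨e', he'⟩ := mem_frontier_iff.1 hwf
    rcases eq_or_ne e' e with rfl | hne
    · rw [(he.mem_iff.1 he').1, (he.mem_iff.1 hz).1]
    · exact (hball hw (Set.mem_biUnion hne he')).elim
  -- Each open half-ball misses the boundary, so a single point of the domain in it puts all of it
  -- into the interior.
  have hside : ∀ S : Set Pt, Convex ℝ S → S ⊆ Metric.ball z ε → (∀ w ∈ S, w.2 ≠ z.2) →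
      (S ∩ P.carrier).Nonempty → S ⊆ interior P.carrier := by
    intro S hS hSb hSz ⟨w, hwS, hwP⟩
    rcases hS.isPreconnected.subset_interior_or (T := P.carrier)
      (Set.disjoint_left.2 fun v hv hvf => hSz v hv (hfr v (hSb hv) hvf)) with h1 | h1
    · exact h1
    · exact (h1 hwS (subset_closure hwP)).elim
  have hconv1 : Convex ℝ (Metric.ball z ε ∩ {w : Pt | z.2 < w.2}) :=
    (convex_ball z ε).inter (convex_halfSpace_gt (LinearMap.snd ℝ ℝ ℝ).isLinear _)
  have hconv2 : Convex ℝ (Metric.ball z ε ∩ {w : Pt | w.2 < z.2}) :=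
    (convex_ball z ε).inter (convex_halfSpace_lt (LinearMap.snd ℝ ℝ ℝ).isLinear _)
  have hU := hside _ hconv1 Set.inter_subset_left (fun w hw => ne_of_gt hw.2) (by
    obtain ⟨w, h1, h2⟩ := mem_closure_iff.1 hup _ Metric.isOpen_ball (Metric.mem_ball_self hε)
    exact ⟨w, ⟨h1, h2.2⟩, h2.1⟩)
  have hL := hside _ hconv2 Set.inter_subset_left (fun w hw => ne_of_lt hw.2) (by
    obtain ⟨w, h1, h2⟩ := mem_closure_iff.1 hdn _ Metric.isOpen_ball (Metric.mem_ball_self hε)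
    exact ⟨w, ⟨h1, h2.2⟩, h2.1⟩)
  -- Both half-balls belong to the domain and together are dense in the ball, which makes `z` an
  -- interior point.
  have hdense : Metric.ball z ε ⊆ P.carrier := by
    intro w hw
    have hd : Dense ({z.2}ᶜ : Set ℝ) := dense_compl_singleton _
    have hd' : Dense (Prod.snd ⁻¹' ({z.2}ᶜ : Set ℝ) : Set Pt) :=
      hd.preimage isOpenMap_snd
    have := hd'.open_subset_closure_inter Metric.isOpen_ball hw
    refine P.isCompact.isClosed.closure_subset_iff.2 ?_ this
    rintro v ⟨hv1, hv2⟩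
    rcases lt_or_gt_of_ne (show v.2 ≠ z.2 from hv2) with h1 | h1
    · exact interior_subset (hL ⟨hv1, h1⟩)
    · exact interior_subset (hU ⟨hv1, h1⟩)
  have hzf : z ∈ frontier P.carrier := mem_frontier_iff.2 ⟨e, hz⟩
  exact hzf.2 (mem_interior.2 ⟨_, hdense, Metric.isOpen_ball, Metric.mem_ball_self hε⟩)

theorem IsCell.isBox {R : Set Pt} (hR : P.IsCell R) : IsBox R := by
  obtain ⟨⟨a, b, c, d, h1, h2, rfl⟩, -⟩ := hR
  exact isBox_prod h1 h2

theorem extendedVerticals_fst {z : Pt} (hz : z ∈ P.extendedVerticals) : z.1 ∈ P.vertAbs := by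
  obtain ⟨c, i, h1, w, hw, h2, -⟩ := hz
  refine ⟨⟨c, i⟩, h1, ?_⟩
  rw [h2]
  exact ((EdgeIdx.IsVert.mem_iff (e := ⟨c, i⟩) h1).1 hw).1.symm

theorem EdgeIdx.IsVert.subset_extendedVerticals {e : P.EdgeIdx} (he : e.IsVert) :
    e.carrier ⊆ P.extendedVerticals := by
  intro z hz
  refine ⟨e.1, e.2, he, z, hz, rfl, ?_⟩
  rw [segment_same]
  simpa using e.carrier_subset hz

theorem extendedVerticals_of_segment {z z' : Pt} (hz : z ∈ P.extendedVerticals) (h : z'.1 = z.1)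
    (hs : segment ℝ z' z ⊆ P.carrier) : z' ∈ P.extendedVerticals := by
  obtain ⟨c, i, h1, w, hw, h2, h3⟩ := hz
  refine ⟨c, i, h1, w, hw, h.trans h2, ?_⟩
  intro v hv
  rw [mem_segment_vert (h.trans h2)] at hv
  rcases Set.uIcc_subset_uIcc_union_uIcc (b := z.2) hv.2 with h4 | h4
  · exact hs ((mem_segment_vert h).2 ⟨hv.1, h4⟩)
  · exact h3 ((mem_segment_vert h2).2 ⟨hv.1.trans h, h4⟩)

namespace IsCell

variable {R R' : Set Pt}

theorem subset (hR : P.IsCell R) : R ⊆ P.carrier := by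
  have hb := hR.isBox
  have h1 : interior R ⊆ P.carrier := fun z hz => interior_subset (hR.2.1 hz).1
  have h2 : closure (interior R) = R := by
    rw [hb.interior_eq, closure_prod_eq, closure_Ioo hb.1.ne, closure_Ioo hb.2.1.ne]
    exact hb.2.2.symm
  rw [← h2]
  exact P.isCompact.isClosed.closure_subset_iff.2 h1

/-- A horizontal side of a cell lies on a horizontal edge. -/
theorem exists_isHor (hP : P.GeneralPosition) (hR : P.IsCell R) {y : ℝ}
    (hy : y = ylo R ∨ y = yhi R) :
    ∃ e : P.EdgeIdx, e.IsHor ∧ e.src.2 = y ∧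
      ∀ x ∈ Set.Icc (xlo R) (xhi R), ((x, y) : Pt) ∈ e.carrier := by
  have hb := hR.isBox
  -- Away from the abscissae of vertical edges, a point of the side must lie on a horizontal edge.
  -- General position makes it the same edge for all these points, and density gives the rest.
  have h1 : ∀ x ∈ Set.Ioo (xlo R) (xhi R) ∩ P.vertAbsᶜ,
      ∃ e : P.EdgeIdx, e.IsHor ∧ e.src.2 = y ∧ ((x, y) : Pt) ∈ e.carrier := by
    rintro x ⟨hx, hxV⟩
    have hmem : ((x, y) : Pt) ∈ frontier R := by
      rw [hb.frontier_eq]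
      refine ⟨hb.mem_iff.2 ⟨⟨hx.1.le, hx.2.le⟩, ?_⟩, ?_⟩
      · have := hb.2.1
        rcases hy with rfl | rfl
        · exact ⟨le_rfl, this.le⟩
        · exact ⟨this.le, le_rfl⟩
      · rcases hy with rfl | rfl <;> simp
    rcases hR.2.2 hmem with h2 | h2
    · obtain ⟨e, he⟩ := mem_frontier_iff.1 h2
      rcases e.isVert_or_isHor with h3 | h3
      · exact (hxV ⟨e, h3, (h3.mem_iff.1 he).1.symm⟩).elim
      · exact ⟨e, h3, (h3.mem_iff.1 he).1.symm, he⟩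
    · exact (hxV (extendedVerticals_fst h2)).elim
  obtain ⟨x0, hx0, hx0V⟩ := finite_vertAbs.exists_mem_Ioo_notMem (V := P.vertAbs) hb.1
  obtain ⟨e, he, hey, -⟩ := h1 x0 ⟨hx0, hx0V⟩
  refine ⟨e, he, hey, ?_⟩
  intro x hx
  have hcl : IsClosed {x : ℝ | ((x, y) : Pt) ∈ e.carrier} :=
    e.isClosed_carrier.preimage (by fun_prop)
  refine hcl.closure_subset_iff.2 ?_
    (finite_vertAbs.Icc_subset_closure_diff (V := P.vertAbs) hb.1 hx)
  intro x' hx'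
  obtain ⟨e', he', hey', hm⟩ := h1 x' hx'
  rwa [hP.eq_of_isHor he' he (hey'.trans hey.symm)] at hm

/-- A point of the vertical side at a height without horizontal edges lies on a vertical edge or on
an extension of one. -/
theorem mem_vertAbs (hR : P.IsCell R) {x : ℝ} (hx : x = xlo R ∨ x = xhi R) : x ∈ P.vertAbs := by
  have hb := hR.isBox
  obtain ⟨y, hy, hyH⟩ := finite_horHeights.exists_mem_Ioo_notMem (V := P.horHeights) hb.2.1
  have hmem : ((x, y) : Pt) ∈ frontier R := by
    rw [hb.frontier_eq]
    refine ⟨hb.mem_iff.2 ⟨?_, ⟨hy.1.le, hy.2.le⟩⟩, ?_⟩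
    · have := hb.1
      rcases hx with rfl | rfl
      · exact ⟨le_rfl, this.le⟩
      · exact ⟨this.le, le_rfl⟩
    · rcases hx with rfl | rfl <;> simp
  rcases hR.2.2 hmem with h2 | h2
  · obtain ⟨e, he⟩ := mem_frontier_iff.1 h2
    rcases e.isVert_or_isHor with h3 | h3
    · exact ⟨e, h3, (h3.mem_iff.1 he).1.symm⟩
    · exact (hyH ⟨e, h3, (h3.mem_iff.1 he).1.symm⟩).elim
  · exact extendedVerticals_fst h2

/-- The frontier of `R'` consists of boundary points and extended verticals, both of which the
connected interior of `R` avoids. -/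
theorem interior_subset_interior (hR : P.IsCell R) (hR' : P.IsCell R')
    (hi : (interior R ∩ interior R').Nonempty) : interior R ⊆ interior R' := by
  have hb := hR.isBox
  rcases (hb.convex.interior.isPreconnected).subset_interior_or (T := R')
    (Set.disjoint_left.2 fun z hz hz' => by
      rcases hR'.2.2 hz' with h1 | h1
      · exact h1.2 (hR.2.1 hz).1
      · exact (hR.2.1 hz).2 h1) with h1 | h1
  · exact h1
  · obtain ⟨z, h2, h3⟩ := hi
    exact (h1 h2 (subset_closure (interior_subset h3))).elim

theorem eq_of_interior_inter (hR : P.IsCell R) (hR' : P.IsCell R')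
    (hi : (interior R ∩ interior R').Nonempty) : R = R' := by
  have h1 := (hR.interior_subset_interior hR' hi).antisymm
    (hR'.interior_subset_interior hR (by rwa [Set.inter_comm]))
  have key : ∀ {S : Set Pt}, IsBox S → closure (interior S) = S := fun {S} hb => by
    rw [hb.interior_eq, closure_prod_eq, closure_Ioo hb.1.ne, closure_Ioo hb.2.1.ne]
    exact hb.2.2.symm
  rw [← key hR.isBox, h1, key hR'.isBox]

/-- By general position the upper side of `R` and the lower side of `R'` would lie on the same edge.
At a point inside that edge the domain would lie on both sides, contrary to
`GeneralPosition.not_both_sides`. -/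
theorem not_stacked (hP : P.GeneralPosition) (hR : P.IsCell R) (hR' : P.IsCell R')
    (hm : (R ∩ R').Nonempty) : yhi R ≠ ylo R' := by
  intro hy
  have hb := hR.isBox
  have hb' := hR'.isBox
  obtain ⟨e, he, hey, hmem⟩ := hR.exists_isHor hP (Or.inr rfl)
  obtain ⟨e', he', hey', hmem'⟩ := hR'.exists_isHor hP (Or.inl rfl)
  obtain rfl := hP.eq_of_isHor he he' (by rw [hey, hey', hy])
  obtain ⟨p, hp, hp'⟩ := hm
  rw [hb.mem_iff] at hp
  rw [hb'.mem_iff] at hp'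
  have l1 := hb.1
  have l2 := hb'.1
  have l3 := hb.2.1
  have l4 := hb'.2.1
  -- The middle of the common range of abscissae. If this range is a single point, it is the right
  -- end of one side and the left end of the other, hence still not an end of the edge.
  obtain ⟨x, hx1, hx2, hx3, hx4⟩ : ∃ x, x ∈ Set.Icc (xlo R) (xhi R) ∧
      x ∈ Set.Icc (xlo R') (xhi R') ∧ (xlo R < x ∨ xlo R' < x) ∧ (x < xhi R ∨ x < xhi R') := by
    have a1 : max (xlo R) (xlo R') ≤ min (xhi R) (xhi R') :=
      le_min (max_le l1.le (hp'.1.1.trans hp.1.2)) (max_le (hp.1.1.trans hp'.1.2) l2.le)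
    have a2 := le_max_left (xlo R) (xlo R')
    have a3 := le_max_right (xlo R) (xlo R')
    have a4 := min_le_left (xhi R) (xhi R')
    have a5 := min_le_right (xhi R) (xhi R')
    refine ⟨(max (xlo R) (xlo R') + min (xhi R) (xhi R')) / 2, ⟨by linarith, by linarith⟩,
      ⟨by linarith, by linarith⟩, ?_, ?_⟩
    · by_contra! hc
      rcases max_choice (xlo R) (xlo R') with h1 | h1 <;>
      rcases min_choice (xhi R) (xhi R') with h2 | h2 <;> rw [h1, h2] at hc <;> linarith
    · by_contra! hc
      rcases max_choice (xlo R) (xlo R') with h1 | h1 <;>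
      rcases min_choice (xhi R) (xhi R') with h2 | h2 <;> rw [h1, h2] at hc <;> linarith
  have hz : ((x, yhi R) : Pt) ∈ e.carrier := hmem x hx1
  have hs : ∀ y, y ∈ Set.Icc (xlo R) (xhi R) ∨ y ∈ Set.Icc (xlo R') (xhi R') →
      y ∈ Set.uIcc e.src.1 e.tgt.1 := by
    rintro y (h1 | h1)
    · exact (he.mem_iff.1 (hmem y h1)).2
    · exact (he.mem_iff.1 (hmem' y h1)).2
  have s1 := Set.mem_uIcc.1 (hs _ (Or.inl (Set.left_mem_Icc.2 l1.le)))
  have s2 := Set.mem_uIcc.1 (hs _ (Or.inl (Set.right_mem_Icc.2 l1.le)))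
  have s3 := Set.mem_uIcc.1 (hs _ (Or.inr (Set.left_mem_Icc.2 l2.le)))
  have s4 := Set.mem_uIcc.1 (hs _ (Or.inr (Set.right_mem_Icc.2 l2.le)))
  refine hP.not_both_sides he hz ?_ ?_ ?_
  · intro e' he' hz'
    have hlt : (e.src.1 < x ∧ x < e.tgt.1) ∨ (e.tgt.1 < x ∧ x < e.src.1) := by
      rcases le_total e.src.1 e.tgt.1 with h1 | h1
      · left
        constructor
        · rcases hx3 with h | h
          · rcases s1 with s | s <;> linarith
          · rcases s3 with s | s <;> linarith
        · rcases hx4 with h | h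
          · rcases s2 with s | s <;> linarith
          · rcases s4 with s | s <;> linarith
      · right
        constructor
        · rcases hx3 with h | h
          · rcases s1 with s | s <;> linarith
          · rcases s3 with s | s <;> linarith
        · rcases hx4 with h | h
          · rcases s2 with s | s <;> linarith
          · rcases s4 with s | s <;> linarith
    rcases he.eq_src_or_tgt he' hz hz' with h1 | h1
    · have := congrArg Prod.fst h1
      simp only at this
      rcases hlt with h2 | h2 <;> linarith
    · have := congrArg Prod.fst h1
      simp only at this
      rcases hlt with h2 | h2 <;> linarith
  · have hc : ContinuousWithinAt (fun y : ℝ => ((x, y) : Pt)) (Set.Ioo (yhi R) (yhi R')) (yhi R) := by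
      fun_prop
    refine hc.mem_closure (by rw [closure_Ioo (by linarith)]; exact ⟨le_rfl, by linarith⟩) ?_
    intro y hy'
    exact ⟨hR'.subset (hb'.mem_iff.2 ⟨hx2, hy ▸ hy'.1.le, hy'.2.le⟩), hy'.1⟩
  · have hc : ContinuousWithinAt (fun y : ℝ => ((x, y) : Pt)) (Set.Ioo (ylo R) (yhi R)) (yhi R) := by
      fun_prop
    refine hc.mem_closure (by rw [closure_Ioo (by linarith)]; exact ⟨by linarith, le_rfl⟩) ?_
    intro y hy'
    exact ⟨hR.subset (hb.mem_iff.2 ⟨hx1, hy'.1.le, hy'.2.le⟩), hy'.2⟩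

/-- Since cells are not stacked, their ranges of heights overlap properly; if the ranges of
abscissae did so too, the interiors would meet. -/
theorem touch (hP : P.GeneralPosition) (hR : P.IsCell R) (hR' : P.IsCell R') (hne : R ≠ R')
    (hm : (R ∩ R').Nonempty) : (xhi R = xlo R' ∨ xhi R' = xlo R) ∧
      max (ylo R) (ylo R') < min (yhi R) (yhi R') := by
  have hb := hR.isBox
  have hb' := hR'.isBox
  have n1 := hR.not_stacked hP hR' hm
  have n2 := hR'.not_stacked hP hR (by rwa [Set.inter_comm])
  obtain ⟨p, hp, hp'⟩ := hm
  rw [hb.mem_iff] at hp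
  rw [hb'.mem_iff] at hp'
  have hy : max (ylo R) (ylo R') < min (yhi R) (yhi R') :=
    lt_min (max_lt hb.2.1 (lt_of_le_of_ne (hp'.2.1.trans hp.2.2) n1.symm))
      (max_lt (lt_of_le_of_ne (hp.2.1.trans hp'.2.2) n2.symm) hb'.2.1)
  refine ⟨?_, hy⟩
  by_contra! hc
  have hx : max (xlo R) (xlo R') < min (xhi R) (xhi R') :=
    lt_min (max_lt hb.1 (lt_of_le_of_ne (hp'.1.1.trans hp.1.2) hc.1.symm))
      (max_lt (lt_of_le_of_ne (hp.1.1.trans hp'.1.2) hc.2.symm) hb'.1)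
  obtain ⟨x, hx1, hx2⟩ := exists_between hx
  obtain ⟨y, hy1, hy2⟩ := exists_between hy
  rw [max_lt_iff] at hx1 hy1
  rw [lt_min_iff] at hx2 hy2
  refine hne (hR.eq_of_interior_inter hR' ⟨(x, y), ?_, ?_⟩)
  · rw [hb.interior_eq]
    exact ⟨⟨hx1.1, hx2.1⟩, hy1.1, hy2.1⟩
  · rw [hb'.interior_eq]
    exact ⟨⟨hx1.2, hx2.2⟩, hy1.2, hy2.2⟩

end IsCell

/-- A cell is determined by two abscissae of vertical edges and two heights of horizontal edges. -/
theorem finite_cells (hP : P.GeneralPosition) : {R | P.IsCell R}.Finite := by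
  refine (((finite_vertAbs (P := P)).prod (finite_vertAbs (P := P))).prod
    ((finite_horHeights (P := P)).prod (finite_horHeights (P := P)))).image
    (fun q : (ℝ × ℝ) × (ℝ × ℝ) => Set.Icc q.1.1 q.1.2 ×ˢ Set.Icc q.2.1 q.2.2) |>.subset ?_
  intro R (hR : P.IsCell R)
  obtain ⟨e, he, hey, -⟩ := hR.exists_isHor hP (Or.inl rfl)
  obtain ⟨e', he', hey', -⟩ := hR.exists_isHor hP (Or.inr rfl)
  exact ⟨((xlo R, xhi R), (ylo R, yhi R)), ⟨⟨hR.mem_vertAbs (Or.inl rfl), hR.mem_vertAbs (Or.inr rfl)⟩,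
    ⟨e, he, hey⟩, ⟨e', he', hey'⟩⟩, hR.isBox.2.2.symm⟩

theorem cellSystem (hP : P.GeneralPosition) : CellSystem {R | P.IsCell R} where
  finite := finite_cells hP
  box := fun _ hR => IsCell.isBox hR
  touch := fun _ hR _ hR' hne hm => IsCell.touch hP hR hR' hne hm
  horiz := by
    intro A hA B hB R hR y hyA hyB h1 h2 x hx a ha b hb hax hxb
    obtain ⟨e, he, hey, hm⟩ := IsCell.exists_isHor hP hA hyA
    obtain ⟨e', he', hey', hm'⟩ := IsCell.exists_isHor hP hB hyB
    obtain rfl := hP.eq_of_isHor he he' (hey.trans hey'.symm)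
    -- Both sides lie on the same edge, which then contains the intermediate point; but that point
    -- is interior to `R`.
    have hxe : ((x, y) : Pt) ∈ e.carrier := by
      rw [he.mem_iff]
      refine ⟨hey.symm, ?_⟩
      have h3 := (he.mem_iff.1 (hm a ha)).2
      have h4 := (he.mem_iff.1 (hm' b hb)).2
      exact Set.uIcc_subset_uIcc h3 h4 (Set.Icc_subset_uIcc ⟨hax, hxb⟩)
    have hfr : ((x, y) : Pt) ∈ frontier P.carrier := mem_frontier_iff.2 ⟨e, hxe⟩
    have hR' : P.IsCell R := hR
    refine hfr.2 (hR'.2.1 ?_).1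
    rw [hR'.isBox.interior_eq]
    exact ⟨hx, h1, h2⟩

end RectilinearDomain


/-! ### The cells cover the domain. -/

namespace RectilinearDomain

variable {h : ℕ} {P : RectilinearDomain h}

/-- From an interior point, a vertical ray runs in the interior until it hits the boundary. -/
theorem exists_vertical_up {p : Pt} (hp : p ∈ interior P.carrier) :
    ∃ d > p.2, ((p.1, d) : Pt) ∈ frontier P.carrier ∧
      ∀ y ∈ Set.Ico p.2 d, ((p.1, y) : Pt) ∈ interior P.carrier := by
  set T : Set ℝ := {y | p.2 ≤ y ∧ ((p.1, y) : Pt) ∉ interior P.carrier} with hT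
  have hcont : Continuous fun y : ℝ => ((p.1, y) : Pt) := by fun_prop
  have hTc : IsClosed T := by
    refine isClosed_Ici.inter ?_
    exact (isOpen_interior.preimage hcont).isClosed_compl
  have hTb : BddBelow T := ⟨p.2, fun y hy => hy.1⟩
  have hTn : T.Nonempty := by
    obtain ⟨M, hM⟩ := (P.isCompact.image continuous_snd).bddAbove
    refine ⟨max p.2 (M + 1), le_max_left _ _, fun hc => ?_⟩
    have := hM ⟨_, interior_subset hc, rfl⟩
    have h2 := le_max_right p.2 (M + 1)
    simp only at this
    linarith
  have hd := hTc.csInf_mem hTn hTb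
  set d := sInf T with hdd
  have hlt : p.2 < d := by
    refine lt_of_le_of_ne hd.1 fun hc => hd.2 ?_
    rw [← hc]
    exact hp
  have hin : ∀ y ∈ Set.Ico p.2 d, ((p.1, y) : Pt) ∈ interior P.carrier := by
    intro y hy
    by_contra hc
    exact absurd (csInf_le hTb ⟨hy.1, hc⟩) (not_le.2 hy.2)
  refine ⟨d, hlt, ⟨?_, hd.2⟩, hin⟩
  refine (hcont.continuousWithinAt (s := Set.Ico p.2 d) (x := d)).mem_closure ?_ ?_
  · rw [closure_Ico hlt.ne]
    exact ⟨hlt.le, le_rfl⟩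
  · intro y hy
    exact interior_subset (hin y hy)

theorem exists_vertical_down {p : Pt} (hp : p ∈ interior P.carrier) :
    ∃ c < p.2, ((p.1, c) : Pt) ∈ frontier P.carrier ∧
      ∀ y ∈ Set.Ioc c p.2, ((p.1, y) : Pt) ∈ interior P.carrier := by
  set T : Set ℝ := {y | y ≤ p.2 ∧ ((p.1, y) : Pt) ∉ interior P.carrier} with hT
  have hcont : Continuous fun y : ℝ => ((p.1, y) : Pt) := by fun_prop
  have hTc : IsClosed T := by
    refine isClosed_Iic.inter ?_
    exact (isOpen_interior.preimage hcont).isClosed_compl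
  have hTb : BddAbove T := ⟨p.2, fun y hy => hy.1⟩
  have hTn : T.Nonempty := by
    obtain ⟨M, hM⟩ := (P.isCompact.image continuous_snd).bddBelow
    refine ⟨min p.2 (M - 1), min_le_left _ _, fun hc => ?_⟩
    have := hM ⟨_, interior_subset hc, rfl⟩
    have h2 := min_le_right p.2 (M - 1)
    simp only at this
    linarith
  have hd := hTc.csSup_mem hTn hTb
  set d := sSup T with hdd
  have hlt : d < p.2 := by
    refine lt_of_le_of_ne hd.1 fun hc => hd.2 ?_
    rw [hc]
    exact hp
  have hin : ∀ y ∈ Set.Ioc d p.2, ((p.1, y) : Pt) ∈ interior P.carrier := by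
    intro y hy
    by_contra hc
    exact absurd (le_csSup hTb ⟨hy.2, hc⟩) (not_le.2 hy.1)
  refine ⟨d, hlt, ⟨?_, hd.2⟩, hin⟩
  refine (hcont.continuousWithinAt (s := Set.Ioc d p.2) (x := d)).mem_closure ?_ ?_
  · rw [closure_Ioc hlt.ne]
    exact ⟨le_rfl, hlt.le⟩
  · intro y hy
    exact interior_subset (hin y hy)

/-- The two ends of a horizontal edge lie on vertical edges. -/
theorem EdgeIdx.IsHor.exists_ends {e : P.EdgeIdx} (he : e.IsHor) :
    ∃ l r, (∀ z : Pt, z ∈ e.carrier ↔ z.2 = e.src.2 ∧ l ≤ z.1 ∧ z.1 ≤ r) ∧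
      (∃ e' : P.EdgeIdx, e'.IsVert ∧ ((l, e.src.2) : Pt) ∈ e'.carrier) ∧
      (∃ e' : P.EdgeIdx, e'.IsVert ∧ ((r, e.src.2) : Pt) ∈ e'.carrier) := by
  have hs : ((e.src.1, e.src.2) : Pt) = e.src := rfl
  have ht : ((e.tgt.1, e.src.2) : Pt) = e.tgt := Prod.ext rfl he
  rcases le_total e.src.1 e.tgt.1 with h1 | h1
  · refine ⟨e.src.1, e.tgt.1, fun z => ?_, hs ▸ he.exists_isVert_src, ht ▸ he.exists_isVert_tgt⟩
    rw [he.mem_iff, Set.uIcc_of_le h1]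
    rfl
  · refine ⟨e.tgt.1, e.src.1, fun z => ?_, ht ▸ he.exists_isVert_tgt, hs ▸ he.exists_isVert_src⟩
    rw [he.mem_iff, Set.uIcc_of_ge h1]
    rfl

theorem exists_isHor_of_frontier {z : Pt} (hz : z ∈ frontier P.carrier)
    (hv : z ∉ P.extendedVerticals) : ∃ e : P.EdgeIdx, e.IsHor ∧ z ∈ e.carrier := by
  obtain ⟨e, he⟩ := mem_frontier_iff.1 hz
  rcases e.isVert_or_isHor with h1 | h1
  · exact (hv (h1.subset_extendedVerticals he)).elim
  · exact ⟨e, h1, he⟩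

/-- The vertical through `p` ends on two horizontal edges, at heights `c` and `d`. The cell is the
slab between these heights, widened to both sides up to the nearest vertical edges that meet it. -/
theorem exists_isCell_of_interior (hP : P.GeneralPosition) {p : Pt} (hp : p ∈ interior P.carrier)
    (hpv : p ∉ P.extendedVerticals) : ∃ R, P.IsCell R ∧ p ∈ R := by
  obtain ⟨d, hd, hdf, hdi⟩ := exists_vertical_up hp
  obtain ⟨c, hc, hcf, hci⟩ := exists_vertical_down hp
  have hPc := P.isCompact.isClosed
  have h_int : ∀ y ∈ Set.Ioo c d, ((p.1, y) : Pt) ∈ interior P.carrier := by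
    intro y hy
    rcases le_total y p.2 with h1 | h1
    · exact hci y ⟨hy.1, h1⟩
    · exact hdi y ⟨h1, hy.2⟩
  have hcol : ∀ y ∈ Set.Icc c d, ((p.1, y) : Pt) ∈ P.carrier := by
    intro y hy
    rcases eq_or_lt_of_le hy.1 with rfl | h1
    · exact hPc.frontier_subset hcf
    · rcases eq_or_lt_of_le hy.2 with rfl | h2
      · exact hPc.frontier_subset hdf
      · exact interior_subset (h_int y ⟨h1, h2⟩)
  have hnv : ∀ y ∈ Set.Icc c d, ((p.1, y) : Pt) ∉ P.extendedVerticals := by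
    intro y hy hz
    refine hpv (extendedVerticals_of_segment hz rfl ?_)
    intro v hv
    replace hv := (mem_segment_vert (by rfl)).1 hv
    have : v.2 ∈ Set.Icc c d := Set.uIcc_subset_Icc ⟨hc.le, hd.le⟩ hy hv.2
    have h2 := hcol v.2 this
    rwa [← hv.1] at h2
  obtain ⟨et, het, hmt⟩ := exists_isHor_of_frontier hdf (hnv d ⟨by linarith, le_rfl⟩)
  obtain ⟨eb, heb, hmb⟩ := exists_isHor_of_frontier hcf (hnv c ⟨le_rfl, by linarith⟩)
  obtain ⟨lt, rt, ht, ⟨vl, hvl, hvl'⟩, ⟨vr, hvr, hvr'⟩⟩ := het.exists_ends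
  obtain ⟨lb, rb, hb, ⟨wl, hwl, hwl'⟩, ⟨wr, hwr, hwr'⟩⟩ := heb.exists_ends
  have hdy : et.src.2 = d := ((ht _).1 hmt).1.symm
  have hcy : eb.src.2 = c := ((hb _).1 hmb).1.symm
  rw [hdy] at hvl' hvr' ht
  rw [hcy] at hwl' hwr' hb
  have hnv' : ∀ x, ∀ y ∈ Set.Icc c d, ∀ e : P.EdgeIdx, e.IsVert → ((x, y) : Pt) ∈ e.carrier →
      x ≠ p.1 := by
    rintro x y hy e he hm rfl
    exact hnv y hy (he.subset_extendedVerticals hm)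
  have hcd : c ≤ d := by linarith
  -- abscissae of the vertical edges that block the slab `[c, d]`
  set V : Set ℝ := {x | ∃ y ∈ Set.Icc c d, ∃ e : P.EdgeIdx, e.IsVert ∧ ((x, y) : Pt) ∈ e.carrier}
  have hVf : V.Finite := finite_vertAbs.subset (s := P.vertAbs) (by
    rintro x ⟨y, -, e, he, hm⟩
    exact ⟨e, he, (he.mem_iff.1 hm).1.symm⟩)
  have hVp : ∀ x ∈ V, x ≠ p.1 := by
    rintro x ⟨y, hy, e, he, hm⟩
    exact hnv' x y hy e he hm
  have hlt : lt ∈ V := ⟨d, ⟨hcd, le_rfl⟩, vl, hvl, hvl'⟩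
  have hrt : rt ∈ V := ⟨d, ⟨hcd, le_rfl⟩, vr, hvr, hvr'⟩
  have hlb : lb ∈ V := ⟨c, ⟨le_rfl, hcd⟩, wl, hwl, hwl'⟩
  have hrb : rb ∈ V := ⟨c, ⟨le_rfl, hcd⟩, wr, hwr, hwr'⟩
  have mt := ((ht _).1 hmt).2
  have mb := ((hb _).1 hmb).2
  simp only at mt mb
  obtain ⟨b, ⟨hbV, hbp⟩, hbm⟩ := (hVf.subset (Set.inter_subset_left (t := Set.Ioi p.1))).exists_minimal
    ⟨rt, hrt, lt_of_le_of_ne mt.2 (hVp _ hrt).symm⟩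
  obtain ⟨a, ⟨haV, hap⟩, ham⟩ := (hVf.subset (Set.inter_subset_left (t := Set.Iio p.1))).exists_maximal
    ⟨lt, hlt, lt_of_le_of_ne mt.1 (hVp _ hlt)⟩
  simp only [Set.mem_Ioi, Set.mem_Iio] at hbp hap
  have hbmin : ∀ x ∈ V, p.1 < x → b ≤ x := fun x hx hpx => by
    by_contra! hcon
    exact absurd (hbm ⟨hx, hpx⟩ hcon.le) (not_le.2 hcon)
  have hamax : ∀ x ∈ V, x < p.1 → x ≤ a := fun x hx hpx => by
    by_contra! hcon
    exact absurd (ham ⟨hx, hpx⟩ hcon.le) (not_le.2 hcon)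
  have hVab : ∀ x ∈ V, ¬ (a < x ∧ x < b) := by
    rintro x hx ⟨h1, h2⟩
    rcases lt_or_gt_of_ne (hVp x hx) with h3 | h3
    · linarith [hamax x hx h3]
    · linarith [hbmin x hx h3]
  have ht1 : lt ≤ a := hamax _ hlt (lt_of_le_of_ne mt.1 (hVp _ hlt))
  have ht2 : b ≤ rt := hbmin _ hrt (lt_of_le_of_ne mt.2 (hVp _ hrt).symm)
  have hb1 : lb ≤ a := hamax _ hlb (lt_of_le_of_ne mb.1 (hVp _ hlb))
  have hb2 : b ≤ rb := hbmin _ hrb (lt_of_le_of_ne mb.2 (hVp _ hrb).symm)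
  -- A horizontal edge entering the open rectangle would have its ends beyond `a` and `b`, hence
  -- cross the vertical through `p`, which is interior to the domain between `c` and `d`.
  have hIoo : Set.Ioo a b ×ˢ Set.Ioo c d ⊆ interior P.carrier := by
    have hdis : Disjoint (Set.Ioo a b ×ˢ Set.Ioo c d) (frontier P.carrier) := by
      rw [Set.disjoint_left]
      rintro z ⟨hz1, hz2⟩ hzf
      obtain ⟨e, he⟩ := mem_frontier_iff.1 hzf
      rcases e.isVert_or_isHor with hv | hh
      · exact hVab z.1 ⟨z.2, ⟨hz2.1.le, hz2.2.le⟩, e, hv, he⟩ hz1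
      · obtain ⟨l, r, hm, ⟨v1, hv1, hv1'⟩, ⟨v2, hv2, hv2'⟩⟩ := hh.exists_ends
        obtain ⟨h1, h2, h3⟩ := (hm _).1 he
        rw [← h1] at hv1' hv2' hm
        have hl : l ∈ V := ⟨z.2, ⟨hz2.1.le, hz2.2.le⟩, v1, hv1, hv1'⟩
        have hr : r ∈ V := ⟨z.2, ⟨hz2.1.le, hz2.2.le⟩, v2, hv2, hv2'⟩
        have k1 : l ≤ a := by
          by_contra! hcon
          exact hVab l hl ⟨hcon, by linarith [hz1.2]⟩
        have k2 : b ≤ r := by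
          by_contra! hcon
          exact hVab r hr ⟨by linarith [hz1.1], hcon⟩
        have : ((p.1, z.2) : Pt) ∈ frontier P.carrier :=
          mem_frontier_iff.2 ⟨e, (hm _).2 ⟨rfl, by simp only; linarith, by simp only; linarith⟩⟩
        exact this.2 (h_int _ hz2)
    rcases ((convex_Ioo a b).prod (convex_Ioo c d)).isPreconnected.subset_interior_or hdis with h1 | h1
    · exact h1
    · exact (h1 (show p ∈ _ from ⟨⟨hap, hbp⟩, hc, hd⟩) (subset_closure (interior_subset hp))).elim
  have hIcc : Set.Icc a b ×ˢ Set.Icc c d ⊆ P.carrier := by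
    rw [← closure_Ioo (by linarith : a ≠ b), ← closure_Ioo (by linarith : c ≠ d), ← closure_prod_eq]
    exact hPc.closure_subset_iff.2 (hIoo.trans interior_subset)
  -- The vertical edge that blocks the slab may meet it in a single point; the rest of the side is
  -- part of its extension.
  have hside : ∀ x ∈ V, x ∈ Set.Icc a b → ∀ y ∈ Set.Icc c d,
      ((x, y) : Pt) ∈ P.extendedVerticals := by
    rintro x ⟨y', hy', e, he, hm⟩ hx y hy
    refine extendedVerticals_of_segment (he.subset_extendedVerticals hm) rfl ?_
    intro v hv
    replace hv := (mem_segment_vert (by rfl)).1 hv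
    refine hIcc ⟨?_, Set.uIcc_subset_Icc hy hy' hv.2⟩
    rw [hv.1]
    exact hx
  have hab : a < b := by linarith
  have hcd' : c < d := by linarith
  refine ⟨Set.Icc a b ×ˢ Set.Icc c d, ⟨⟨a, b, c, d, hab, hcd', rfl⟩, ?_, ?_⟩,
    ⟨⟨hap.le, hbp.le⟩, hc.le, hd.le⟩⟩
  · rw [interior_prod_eq, interior_Icc, interior_Icc]
    intro z hz
    refine ⟨hIoo hz, ?_⟩
    -- An extended vertical entering the rectangle would come from an edge point above or below the
    -- slab, and so cross the top or bottom edge at a point with the domain on both sides.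
    rintro ⟨c', i, hv, w, hw, hzw, hseg⟩
    have hvert : EdgeIdx.IsVert (P := P) ⟨c', i⟩ := hv
    have hwc : w.2 ∉ Set.Icc c d := by
      intro hwc
      refine hVab z.1 ⟨w.2, hwc, ⟨c', i⟩, hvert, ?_⟩ hz.1
      rw [hzw]
      exact hw
    have hvz : ∀ y ∈ Set.Icc c d, ∀ e' : P.EdgeIdx, e'.IsVert → ((z.1, y) : Pt) ∉ e'.carrier :=
      fun y hy e' he' hm => hVab z.1 ⟨y, hy, e', he', hm⟩ hz.1
    have hzc := hz.2.1
    have hzd := hz.2.2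
    have hin : ∀ y, y ∈ Set.uIcc z.2 w.2 → ((z.1, y) : Pt) ∈ P.carrier := fun y hy =>
      hseg ((mem_segment_vert hzw).2 ⟨rfl, hy⟩)
    have hcont : Continuous fun y : ℝ => ((z.1, y) : Pt) := by fun_prop
    rcases lt_or_ge w.2 c with hwlt | hwge
    · refine hP.not_both_sides heb (z := (z.1, c))
        ((hb _).2 ⟨rfl, hb1.trans hz.1.1.le, hz.1.2.le.trans hb2⟩)
        (hvz c ⟨le_rfl, hcd⟩) ?_ ?_
      · refine (hcont.continuousWithinAt (s := Set.Ioo c d) (x := c)).mem_closure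
          (by rw [closure_Ioo hcd'.ne]; exact ⟨le_rfl, hcd⟩) ?_
        intro y hy
        exact ⟨interior_subset (hIoo ⟨hz.1, hy⟩), hy.1⟩
      · refine (hcont.continuousWithinAt (s := Set.Ioo w.2 c) (x := c)).mem_closure
          (by rw [closure_Ioo hwlt.ne]; exact ⟨hwlt.le, le_rfl⟩) ?_
        intro y hy
        exact ⟨hin y (Set.mem_uIcc.2 (Or.inr ⟨hy.1.le, hy.2.le.trans hzc.le⟩)), hy.2⟩
    · have hwgt : d < w.2 := by
        by_contra! hcon
        exact hwc ⟨hwge, hcon⟩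
      refine hP.not_both_sides het (z := (z.1, d))
        ((ht _).2 ⟨rfl, ht1.trans hz.1.1.le, hz.1.2.le.trans ht2⟩)
        (hvz d ⟨hcd, le_rfl⟩) ?_ ?_
      · refine (hcont.continuousWithinAt (s := Set.Ioo d w.2) (x := d)).mem_closure
          (by rw [closure_Ioo hwgt.ne]; exact ⟨le_rfl, hwgt.le⟩) ?_
        intro y hy
        exact ⟨hin y (Set.mem_uIcc.2 (Or.inl ⟨hzd.le.trans hy.1.le, hy.2.le⟩)), hy.1⟩
      · refine (hcont.continuousWithinAt (s := Set.Ioo c d) (x := d)).mem_closure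
          (by rw [closure_Ioo hcd'.ne]; exact ⟨hcd, le_rfl⟩) ?_
        intro y hy
        exact ⟨interior_subset (hIoo ⟨hz.1, hy⟩), hy.2⟩
  · rw [(isBox_prod hab hcd').frontier_eq]
    obtain ⟨e1, e2, e3, e4⟩ := box_coords hab.le hcd
    rw [e1, e2, e3, e4]
    rintro z ⟨⟨hz1, hz2⟩, hz⟩
    rcases hz with hz | hz | hz | hz
    · exact Or.inr (hside z.1 (hz ▸ haV) hz1 z.2 hz2)
    · exact Or.inr (hside z.1 (hz ▸ hbV) hz1 z.2 hz2)
    · exact Or.inl (mem_frontier_iff.2 ⟨eb, (hb _).2 ⟨hz, hb1.trans hz1.1, hz1.2.trans hb2⟩⟩)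
    · exact Or.inl (mem_frontier_iff.2 ⟨et, (ht _).2 ⟨hz, ht1.trans hz1.1, hz1.2.trans ht2⟩⟩)

/-- Interior points off the finitely many abscissae of vertical edges lie in cells. These points are
dense in the domain, and the union of the cells is closed. -/
theorem sUnion_cells (hP : P.GeneralPosition) : ⋃₀ {R | P.IsCell R} = P.carrier := by
  refine Set.Subset.antisymm (Set.sUnion_subset fun R hR => IsCell.subset hR) ?_
  have hcl : IsClosed (⋃₀ {R | P.IsCell R}) := by
    rw [Set.sUnion_eq_biUnion]
    exact (finite_cells hP).isClosed_biUnion fun R hR => (IsCell.isBox hR).isCompact.isClosed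
  have hd : Dense (Prod.fst ⁻¹' (P.vertAbsᶜ) : Set Pt) :=
    (finite_vertAbs.countable.dense_compl ℝ).preimage isOpenMap_fst
  have h1 := hd.open_subset_closure_inter (isOpen_interior (s := P.carrier))
  have h2 : interior P.carrier ∩ Prod.fst ⁻¹' (P.vertAbsᶜ) ⊆ ⋃₀ {R | P.IsCell R} := by
    rintro p ⟨hp, hpv⟩
    obtain ⟨R, hR, hpR⟩ := exists_isCell_of_interior hP hp fun hc => hpv (extendedVerticals_fst hc)
    exact ⟨R, hR, hpR⟩
  have h3 : interior P.carrier ⊆ ⋃₀ {R | P.IsCell R} :=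
    h1.trans (hcl.closure_subset_iff.2 h2)
  have h4 := hcl.closure_subset_iff.2 h3
  rwa [P.closure_interior] at h4

end RectilinearDomain


/-! Shortest paths in finite unions of boxes. -/

theorem continuous_l1 : Continuous fun z : Pt × Pt => l1 z.1 z.2 := by
  unfold l1
  fun_prop

/-- For a fixed list of boxes the optimal cost of a chain depends continuously on its starting
point, and is attained. -/
theorem exists_optimal_chainCost {q : Pt} {ℓ : List (Set Pt)} :
    ∀ {A : Set Pt}, (∀ B ∈ A :: ℓ, IsCompact B) → (∃ p L, ChainCost q p (A :: ℓ) L) →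
      ∃ V : Pt → ℝ, Continuous V ∧ ∀ p ∈ A, ChainCost q p (A :: ℓ) (V p) ∧
        ∀ L, ChainCost q p (A :: ℓ) L → V p ≤ L := by
  induction ℓ with
  | nil =>
    rintro A hc ⟨p, L, h⟩
    refine ⟨fun p => l1 p q, continuous_l1.comp
      (by fun_prop : Continuous fun p : Pt => (p, q)), fun p' hp' => ⟨?_, ?_⟩⟩
    · cases h with
      | last _ hq => exact ChainCost.last hp' hq
    · intro L' h'
      exact h'.l1_le
  | cons B ℓ ih =>
    rintro A hc ⟨p, L, h⟩
    cases h with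
    | @cons _ z _ _ _ L hp hz h =>
      obtain ⟨V, hV, hV'⟩ := ih (fun B' hB' => hc B' (List.mem_cons_of_mem _ hB')) ⟨z, L, h⟩
      have hK : IsCompact (A ∩ B) := (hc A (by simp)).inter_right (hc B (by simp)).isClosed
      have hne : (A ∩ B).Nonempty := ⟨z, hz, h.start_mem⟩
      have hf : Continuous ↿fun p z : Pt => l1 p z + V z := by
        exact continuous_l1.add (hV.comp continuous_snd)
      refine ⟨fun p => sInf ((fun z => l1 p z + V z) '' (A ∩ B)), hK.continuous_sInf hf,
        fun p' hp' => ⟨?_, ?_⟩⟩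
      · have hcomp : IsCompact ((fun z => l1 p' z + V z) '' (A ∩ B)) :=
          hK.image (hf.comp (by fun_prop : Continuous fun z : Pt => (p', z)))
        obtain ⟨w, hw, hw'⟩ := hcomp.sInf_mem (hne.image _)
        simp only at hw' ⊢
        rw [← hw']
        exact ChainCost.cons hp' hw.1 (hV' w hw.2).1
      · intro L' h'
        cases h' with
        | @cons _ w _ _ _ L'' _ hw h'' =>
          have hcomp : IsCompact ((fun z => l1 p' z + V z) '' (A ∩ B)) :=
            hK.image (hf.comp (by fun_prop : Continuous fun z : Pt => (p', z)))
          have h1 : sInf ((fun z => l1 p' z + V z) '' (A ∩ B)) ≤ l1 p' w + V w :=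
            csInf_le hcomp.bddBelow ⟨w, ⟨hw, h''.start_mem⟩, rfl⟩
          have h2 := (hV' w h''.start_mem).2 _ h''
          simp only
          linarith

theorem finite_nodup_lists {α : Type*} {F : Set α} (hF : F.Finite) :
    {ℓ : List α | ℓ.Nodup ∧ ∀ A ∈ ℓ, A ∈ F}.Finite := by
  have : Finite F := hF
  refine ((List.finite_length_le F hF.toFinset.card).image (List.map Subtype.val)).subset ?_
  rintro ℓ ⟨h1, h2⟩
  refine ⟨ℓ.attach.map fun x => ⟨x.1, h2 x.1 x.2⟩, ?_, ?_⟩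
  · simp only [Set.mem_ofPred_eq, List.length_map, List.length_attach]
    classical
    rw [← List.toFinset_card_of_nodup h1]
    refine Finset.card_le_card fun x hx => ?_
    simpa using h2 x (by simpa using hx)
  · simp [List.map_map, Function.comp_def]

/-- Every path is dominated by a chain without repetitions. There are finitely many lists without
repetitions, and each feasible one attains its optimal cost by compactness. -/
theorem exists_isShortestRectPath {F : Set (Set Pt)} (hF : F.Finite) (hb : ∀ A ∈ F, IsBox A)
    {p q : Pt} {L : ℝ} (h : Conn (⋃₀ F) p q L) : ∃ π, IsShortestRectPath (⋃₀ F) p q π := by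
  have hfeas : ∀ M, Conn (⋃₀ F) p q M → ∃ ℓ M', (ℓ.Nodup ∧ ∀ A ∈ ℓ, A ∈ F) ∧ ChainCost q p ℓ M' ∧
      M' ≤ M := by
    intro M hM
    have hp : p ∈ ⋃₀ F := by
      obtain ⟨S, hS, -, hpS, -⟩ := hM.exists_trace
      exact hS hpS
    have hq : q ∈ ⋃₀ F := by
      obtain ⟨S, hS, -, -, hqS, -⟩ := hM.exists_trace
      exact hS hqS
    obtain ⟨A, hA, hpA⟩ := hp
    obtain ⟨B, hB, hqB⟩ := hq
    obtain ⟨ℓ, M', h1, h2, h3, h4, -⟩ := hM.exists_nodup_chainCost hF hb hA hpA hB hqB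
    exact ⟨A :: ℓ, M', ⟨h4, h1⟩, h2, h3⟩
  set S : Set (List (Set Pt)) := {ℓ | (ℓ.Nodup ∧ ∀ A ∈ ℓ, A ∈ F) ∧ ∃ M, ChainCost q p ℓ M}
  have hSf : S.Finite := (finite_nodup_lists hF).subset fun ℓ hℓ => hℓ.1
  have hopt : ∀ ℓ ∈ S, ∃ v, ChainCost q p ℓ v ∧ ∀ M, ChainCost q p ℓ M → v ≤ M := by
    rintro ℓ ⟨⟨-, h1⟩, M, h2⟩
    cases ℓ with
    | nil => exact (h2.ne_nil rfl).elim
    | cons A ℓ =>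
      obtain ⟨V, -, hV⟩ := exists_optimal_chainCost
        (fun B hB => (hb B (h1 B hB)).isCompact) ⟨p, M, h2⟩
      exact ⟨V p, (hV p h2.start_mem).1, (hV p h2.start_mem).2⟩
  choose! v hv hv' using hopt
  have hSn : S.Nonempty := by
    obtain ⟨ℓ, M', h1, h2, -⟩ := hfeas L h
    exact ⟨ℓ, h1, M', h2⟩
  obtain ⟨ℓ, hℓ, hmin⟩ := Set.exists_min_image S v hSf hSn
  obtain ⟨π, hπ, hlen⟩ := (hv ℓ hℓ).conn (D := ⋃₀ F)
    fun A hA => ⟨hb A (hℓ.1.2 A hA), Set.subset_sUnion_of_mem (hℓ.1.2 A hA)⟩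
  refine ⟨π, hπ, fun π' hπ' => ?_⟩
  obtain ⟨ℓ', M', h1, h2, h3⟩ := hfeas _ ⟨π', hπ', rfl⟩
  have hS' : ℓ' ∈ S := ⟨h1, M', h2⟩
  rw [hlen]
  exact (hmin ℓ' hS').trans ((hv' ℓ' hS' M' h2).trans h3)

/-- A connected subset of a finite union of closed sets passes from one of the sets to another by
steps between sets that meet on it. -/
theorem IsPreconnected.reflTransGen_of_finite_closed {X : Type*} [TopologicalSpace X]
    {F : Set (Set X)} (hF : F.Finite) (hc : ∀ A ∈ F, IsClosed A) {S : Set X}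
    (hS : IsPreconnected S) (hSF : S ⊆ ⋃₀ F) {A B : Set X} (hA : A ∈ F) (hB : B ∈ F)
    (hSA : (S ∩ A).Nonempty) (hSB : (S ∩ B).Nonempty) :
    Relation.ReflTransGen (fun A B => A ∈ F ∧ B ∈ F ∧ (A ∩ B ∩ S).Nonempty) A B := by
  by_contra hcon
  set r := Relation.ReflTransGen (fun A B : Set X => A ∈ F ∧ B ∈ F ∧ (A ∩ B ∩ S).Nonempty) A
  have hcl : ∀ G ⊆ F, IsClosed (⋃₀ G) := fun G hG => by
    rw [Set.sUnion_eq_biUnion]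
    exact (hF.subset hG).isClosed_biUnion fun A hA => hc A (hG hA)
  obtain ⟨z, hzS, ⟨C, hC, hzC⟩, ⟨C', hC', hzC'⟩⟩ := isPreconnected_closed_iff.1 hS
    (⋃₀ {C | C ∈ F ∧ r C}) (⋃₀ {C | C ∈ F ∧ ¬ r C}) (hcl _ fun _ h => h.1) (hcl _ fun _ h => h.1)
    (by
      intro z hz
      obtain ⟨C, hC, hzC⟩ := hSF hz
      by_cases h : r C
      · exact Or.inl ⟨C, ⟨hC, h⟩, hzC⟩
      · exact Or.inr ⟨C, ⟨hC, h⟩, hzC⟩)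
    (hSA.mono fun z hz => ⟨hz.1, A, ⟨hA, Relation.ReflTransGen.refl⟩, hz.2⟩)
    (hSB.mono fun z hz => ⟨hz.1, B, ⟨hB, hcon⟩, hz.2⟩)
  exact hC'.2 (hC.2.tail ⟨hC.1, hC'.1, z, ⟨hzC, hzC'⟩, hzS⟩)

theorem conn_of_reflTransGen {F : Set (Set Pt)} (hb : ∀ A ∈ F, IsBox A) {A B : Set Pt}
    (hA : A ∈ F)
    (h : Relation.ReflTransGen (fun A B => A ∈ F ∧ B ∈ F ∧ (A ∩ B).Nonempty) A B) {p q : Pt}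
    (hp : p ∈ A) (hq : q ∈ B) : ∃ L, Conn (⋃₀ F) p q L := by
  induction h generalizing q with
  | refl => exact ⟨_, ((hb A hA).conn hp hq).mono (Set.subset_sUnion_of_mem hA)⟩
  | tail _ h ih =>
    obtain ⟨h1, h2, z, hz, hz'⟩ := h
    obtain ⟨L, hL⟩ := ih hz
    exact ⟨_, hL.trans (((hb _ h2).conn hz' hq).mono (Set.subset_sUnion_of_mem h2))⟩

namespace CellSystem

variable {F : Set (Set Pt)} (hF : CellSystem F) {A B C : Set Pt}
include hF

/-- Cells that merely touch share a whole vertical segment. The two witnesses lie on the vertical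
through a common point, at the ends of the common range of heights. -/
theorem cellAdj_iff (hA : A ∈ F) (hB : B ∈ F) : CellAdj A B ↔ A ≠ B ∧ (A ∩ B).Nonempty := by
  constructor
  · rintro ⟨h1, h2⟩
    exact ⟨h1, h2.nonempty⟩
  · rintro ⟨h1, h2⟩
    refine ⟨h1, ?_⟩
    obtain ⟨-, hy⟩ := hF.touch A hA B hB h1 h2
    obtain ⟨z, hz, hz'⟩ := h2
    rw [(hF.box A hA).mem_iff] at hz
    rw [(hF.box B hB).mem_iff] at hz'
    rw [max_lt_iff, lt_min_iff, lt_min_iff] at hy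
    refine ⟨(z.1, max (ylo A) (ylo B)), ⟨?_, ?_⟩, (z.1, min (yhi A) (yhi B)), ⟨?_, ?_⟩, ?_⟩
    · exact (hF.box A hA).mem_iff.2 ⟨hz.1, le_max_left _ _, max_le hy.1.1.le hy.2.1.le⟩
    · exact (hF.box B hB).mem_iff.2 ⟨hz'.1, le_max_right _ _, max_le hy.1.2.le hy.2.2.le⟩
    · exact (hF.box A hA).mem_iff.2 ⟨hz.1, le_min hy.1.1.le hy.1.2.le, min_le_left _ _⟩
    · exact (hF.box B hB).mem_iff.2 ⟨hz'.1, le_min hy.2.1.le hy.2.2.le, min_le_right _ _⟩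
    · intro hc
      have := congrArg Prod.snd hc
      simp only at this
      have h3 : max (ylo A) (ylo B) < min (yhi A) (yhi B) :=
        max_lt (lt_min hy.1.1 hy.1.2) (lt_min hy.2.1 hy.2.2)
      exact h3.ne this

/-- No three cells have a common point. -/
theorem not_three (hA : A ∈ F) (hB : B ∈ F) (hC : C ∈ F) (hAB : A ≠ B) (hAC : A ≠ C)
    (hBC : B ≠ C) {z : Pt} (zA : z ∈ A) (zB : z ∈ B) (zC : z ∈ C) : False := by
  have h1 := (hF.touch A hA B hB hAB ⟨z, zA, zB⟩).1
  have h2 := (hF.touch A hA C hC hAC ⟨z, zA, zC⟩).1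
  have h3 := (hF.touch B hB C hC hBC ⟨z, zB, zC⟩).1
  have bA := hF.box A hA
  have bB := hF.box B hB
  have bC := hF.box C hC
  rw [bA.mem_iff] at zA
  rw [bB.mem_iff] at zB
  rw [bC.mem_iff] at zC
  have := bA.1
  have := bB.1
  have := bC.1
  rcases h1 with h1 | h1 <;> rcases h2 with h2 | h2 <;> rcases h3 with h3 | h3 <;> linarith

end CellSystem


/-! Pruning of the dual graph, and chains of cells between junction rectangles. -/

theorem PrunesTo.subset {K K' : Set (Set Pt)} (h : PrunesTo K K') : K' ⊆ K := by
  induction h with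
  | refl => exact subset_rfl
  | step K K' R _ _ _ ih => exact ih.trans Set.sdiff_subset

/-- A set of nodes each of which has two neighbors in the set, or survives the pruning, survives the
pruning as a whole. -/
theorem PrunesTo.subset_of_two_neighbors {K K' Y : Set (Set Pt)} (h : PrunesTo K K') (hY : Y ⊆ K)
    (h2 : ∀ R ∈ Y, R ∈ K' ∨ ∃ R₁ ∈ Y ∪ K', ∃ R₂ ∈ Y ∪ K', R₁ ≠ R₂ ∧ CellAdj R R₁ ∧ CellAdj R R₂) :
    Y ⊆ K' := by
  induction h with
  | refl => exact hY
  | step K K' R hR hdeg hK ih =>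
    refine ih (fun R' hR' => ⟨hY hR', ?_⟩) h2
    -- A removed node of `Y` would have two neighbors in the current graph, hence degree above one.
    rintro rfl
    have hsub := hK.subset
    rcases h2 R' hR' with h3 | ⟨R₁, h3, R₂, h4, hne, h5, h6⟩
    · exact (hsub h3).2 rfl
    · have hK' : ∀ S ∈ Y ∪ K', S ∈ K := by
        rintro S (hS | hS)
        · exact hY hS
        · exact (hsub hS).1
      have : (1 : ℕ∞) < degreeIn K R' :=
        Set.one_lt_encard_iff.2 ⟨R₁, R₂, ⟨hK' _ h3, h5⟩, ⟨hK' _ h4, h6⟩, hne⟩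
      exact this.ne' hdeg

theorem CellAdj.symm {A B : Set Pt} (h : CellAdj A B) : CellAdj B A :=
  ⟨h.1.symm, by rw [Set.inter_comm]; exact h.2⟩

/-- The graph of adjacent cells in the set `X`. -/
def cellGraph (X : Set (Set Pt)) : SimpleGraph (Set Pt) where
  Adj A B := A ∈ X ∧ B ∈ X ∧ CellAdj A B
  symm := ⟨fun _ _ h => ⟨h.2.1, h.1, h.2.2.symm⟩⟩
  loopless := ⟨fun _ h => h.2.2.1 rfl⟩

theorem cellGraph_walk_support {X : Set (Set Pt)} {u v : Set Pt} (p : (cellGraph X).Walk u v)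
    (hu : u ∈ X) : ∀ w ∈ p.support, w ∈ X := by
  induction p with
  | nil => simpa using hu
  | cons h p ih =>
    intro w hw
    rw [SimpleGraph.Walk.support_cons, List.mem_cons] at hw
    rcases hw with rfl | hw
    · exact hu
    · exact ih h.2.1 w hw

/-- Every pair of touching sets in `X` is a bridge of the touching graph of `X`. -/
def TreeLike (X : Set (Set Pt)) : Prop :=
  ∀ A ∈ X, ∀ B ∈ X, A ≠ B → (A ∩ B).Nonempty → ¬ Relation.ReflTransGen
    (fun C D => C ∈ X ∧ D ∈ X ∧ (C ∩ D).Nonempty ∧ ¬ (C = A ∧ D = B) ∧ ¬ (C = B ∧ D = A)) A B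

/-- A chain `A 0, A 1, …, A n, A (n + 1)` of cells of the pruned dual graph in which `A 1, …, A n`
have degree two and belong to the connected set `X` of cells, and `A 0`, `A (n + 1)` do not. -/
structure CorridorChain (F K X : Set (Set Pt)) (n : ℕ) (A : ℕ → Set Pt) : Prop where
  sys : CellSystem F
  prunes : PrunesTo F K
  one_le : 1 ≤ n
  inj : ∀ i ≤ n + 1, ∀ j ≤ n + 1, A i = A j → i = j
  mem_K : ∀ i ≤ n + 1, A i ∈ K
  degree : ∀ i, 1 ≤ i → i ≤ n → degreeIn K (A i) = 2
  first_notMem : A 0 ∉ X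
  last_notMem : A (n + 1) ∉ X
  touch : ∀ i ≤ n, (A i ∩ A (i + 1)).Nonempty
  subset : X ⊆ F
  mem_X : ∀ i, 1 ≤ i → i ≤ n → A i ∈ X
  conn : ∀ R ∈ X, Relation.ReflTransGen (fun B C => B ∈ X ∧ C ∈ X ∧ CellAdj B C) R (A 1)

namespace CorridorChain

variable {F K X : Set (Set Pt)} {n : ℕ} {A : ℕ → Set Pt} (h : CorridorChain F K X n A)
include h

theorem mem_F {i : ℕ} (hi : i ≤ n + 1) : A i ∈ F := h.prunes.subset (h.mem_K i hi)

theorem adj {i : ℕ} (hi : i ≤ n) : CellAdj (A i) (A (i + 1)) := by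
  rw [h.sys.cellAdj_iff (h.mem_F (by omega)) (h.mem_F (by omega))]
  refine ⟨fun hc => ?_, h.touch i hi⟩
  have := h.inj i (by omega) (i + 1) (by omega) hc
  omega

/-- The predecessor and the successor on the chain already exhaust the degree two. -/
theorem neighbor {i : ℕ} (h1 : 1 ≤ i) (h2 : i ≤ n) {R : Set Pt} (hR : R ∈ K)
    (hadj : CellAdj (A i) R) : R = A (i - 1) ∨ R = A (i + 1) := by
  have hpair : ({A (i - 1), A (i + 1)} : Set (Set Pt)) ⊆ {R' | R' ∈ K ∧ CellAdj (A i) R'} := by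
    rintro R' (rfl | rfl)
    · refine ⟨h.mem_K _ (by omega), ?_⟩
      have := (h.adj (i := i - 1) (by omega)).symm
      rwa [Nat.sub_add_cancel h1] at this
    · exact ⟨h.mem_K _ (by omega), h.adj h2⟩
  have hne : A (i - 1) ≠ A (i + 1) := fun hc => by
    have := h.inj (i - 1) (by omega) (i + 1) (by omega) hc
    omega
  have heq := (Set.toFinite ({A (i - 1), A (i + 1)} : Set (Set Pt))).eq_of_subset_of_encard_le hpair
    (by rw [Set.encard_pair hne]; exact (h.degree i h1 h2).le)
  have : R ∈ ({A (i - 1), A (i + 1)} : Set (Set Pt)) := by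
    rw [heq]
    exact ⟨hR, hadj⟩
  simpa using this

/-- A cell of `X` that has a neighbor in the pruned graph outside `X`, or belongs to the pruned graph,
is joined to `A 1` inside the pruned graph. -/
theorem exists_walk {R : Set Pt} (hR : R ∈ X) (hK : R ∈ K ∨ ∃ R' ∈ K, R' ∉ X ∧ CellAdj R R') :
    ∃ p : (cellGraph X).Walk R (A 1), ∀ S ∈ p.support, S ∈ K := by
  classical
  have hreach : (cellGraph X).Reachable R (A 1) :=
    (SimpleGraph.reachable_iff_reflTransGen _ _).2 (h.conn R hR)
  obtain ⟨p, hp⟩ := hreach.exists_isPath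
  have hX := cellGraph_walk_support p hR
  refine ⟨p, ?_⟩
  -- Inner cells of the path have two neighbors on it, the end `A 1` is in `K`, and the start `R`
  -- either is in `K` or has the outside cell `R'` as its second neighbor.
  refine h.prunes.subset_of_two_neighbors (Y := {S | S ∈ p.support})
    (fun S hS => h.subset (hX S hS)) ?_
  intro S hS
  obtain ⟨i, rfl, hi⟩ := SimpleGraph.Walk.mem_support_iff_exists_getVert.1 hS
  have hmem : ∀ j, p.getVert j ∈ p.support := fun j => p.getVert_mem_support j
  rcases eq_or_lt_of_le hi with rfl | hi
  · left
    rw [SimpleGraph.Walk.getVert_length]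
    exact h.mem_K 1 (by omega)
  · have hnext := p.adj_getVert_succ hi
    rcases Nat.eq_zero_or_pos i with rfl | hi0
    · rw [SimpleGraph.Walk.getVert_zero] at hnext ⊢
      rcases hK with hK | ⟨R', h1, h2, h3⟩
      · exact Or.inl hK
      · refine Or.inr ⟨R', Or.inr h1, p.getVert (0 + 1), Or.inl (hmem _), ?_, h3, hnext.2.2⟩
        rintro rfl
        exact h2 hnext.2.1
    · have hprev := p.adj_getVert_succ (i := i - 1) (by omega)
      rw [Nat.sub_add_cancel hi0] at hprev
      refine Or.inr ⟨_, Or.inl (hmem (i - 1)), _, Or.inl (hmem (i + 1)), ?_, hprev.2.2.symm,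
        hnext.2.2⟩
      intro hc
      have := hp.getVert_injOn (show i - 1 ≤ p.length by omega) (show i + 1 ≤ p.length by omega) hc
      omega

/-- Backwards along the walk, a neighbor in `K` of some `A i` is `A (i - 1)` or `A (i + 1)`. The
walk cannot leave the chain at its ends because `A 0` and `A (n + 1)` are not in `X`. -/
theorem eq_of_walk {R S : Set Pt} (p : (cellGraph X).Walk R S) (hR : R ∈ X)
    (hp : ∀ T ∈ p.support, T ∈ K) (hS : ∃ i, 1 ≤ i ∧ i ≤ n ∧ S = A i) :
    ∃ i, 1 ≤ i ∧ i ≤ n ∧ R = A i := by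
  induction p with
  | nil => exact hS
  | @cons u v w hadj p ih =>
    obtain ⟨i, h1, h2, rfl⟩ := ih hadj.2.1 (fun T hT => hp T (by
      rw [SimpleGraph.Walk.support_cons]; exact List.mem_cons_of_mem _ hT)) hS
    have huK : u ∈ K := hp u (by simp)
    rcases h.neighbor h1 h2 huK hadj.2.2.symm with rfl | rfl
    · refine ⟨i - 1, ?_, by omega, rfl⟩
      by_contra hc
      have : i - 1 = 0 := by omega
      exact h.first_notMem (this ▸ hR)
    · refine ⟨i + 1, by omega, ?_, rfl⟩
      by_contra hc
      have : i = n := by omega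
      subst this
      exact h.last_notMem hR

theorem eq_of_mem {R : Set Pt} (hR : R ∈ X) (hK : R ∈ K ∨ ∃ R' ∈ K, R' ∉ X ∧ CellAdj R R') :
    ∃ i, 1 ≤ i ∧ i ≤ n ∧ R = A i := by
  obtain ⟨p, hp⟩ := h.exists_walk hR hK
  exact h.eq_of_walk p hR hp ⟨1, le_rfl, h.one_le, rfl⟩

/-- A cell of `X` next to a surviving outside cell belongs to the chain, and on the chain only the
two ends have such a neighbor. Hence the region has no further doors. -/
theorem door_eq {R R' : Set Pt} (hR : R ∈ X) (hR' : R' ∈ K) (hX : R' ∉ X) (hadj : CellAdj R R') :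
    (R = A 1 ∧ R' = A 0) ∨ (R = A n ∧ R' = A (n + 1)) := by
  obtain ⟨i, h1, h2, rfl⟩ := h.eq_of_mem hR (Or.inr ⟨R', hR', hX, hadj⟩)
  rcases h.neighbor h1 h2 hR' hadj with rfl | rfl
  · left
    have : i = 1 := by
      by_contra hc
      exact hX (h.mem_X (i - 1) (by omega) (by omega))
    subst this
    exact ⟨rfl, rfl⟩
  · right
    have : i = n := by
      by_contra hc
      exact hX (h.mem_X (i + 1) (by omega) (by omega))
    subst this
    exact ⟨rfl, rfl⟩

/-- The cells of a cycle have two neighbors on it, so they survive the pruning and belong to the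
chain. With `A i` the cycle contains both its neighbors, so it would run down to `A 0`, which is not
in `X`. -/
theorem isAcyclic : (cellGraph X).IsAcyclic := by
  intro v c hc
  have hv : v ∈ X := by
    cases c with
    | nil => exact (hc.not_nil (by simp)).elim
    | cons hadj _ => exact hadj.1
  have hX := cellGraph_walk_support c hv
  have htwo : ∀ R ∈ c.support, ∃ R₁ ∈ c.support, ∃ R₂ ∈ c.support, R₁ ≠ R₂ ∧ CellAdj R R₁ ∧
      CellAdj R R₂ := by
    intro R hR
    have h2 := hc.ncard_neighborSet_toSubgraph_eq_two hR
    obtain ⟨R₁, R₂, hne, heq⟩ := Set.ncard_eq_two.1 h2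
    have key : ∀ S ∈ c.toSubgraph.neighborSet R, S ∈ c.support ∧ CellAdj R S := by
      intro S hS
      rw [SimpleGraph.Subgraph.mem_neighborSet] at hS
      exact ⟨(SimpleGraph.Walk.mem_verts_toSubgraph _).1 hS.snd_mem, hS.adj_sub.2.2⟩
    have k1 := key R₁ (by rw [heq]; simp)
    have k2 := key R₂ (by rw [heq]; simp)
    exact ⟨R₁, k1.1, R₂, k2.1, hne, k1.2, k2.2⟩
  have hK : ∀ R ∈ c.support, R ∈ K := by
    refine h.prunes.subset_of_two_neighbors (Y := {S | S ∈ c.support})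
      (fun S hS => h.subset (hX S hS)) ?_
    intro R hR
    obtain ⟨R₁, k1, R₂, k2, k3, k4, k5⟩ := htwo R hR
    exact Or.inr ⟨R₁, Or.inl k1, R₂, Or.inl k2, k3, k4, k5⟩
  have hdesc : ∀ i, i ≤ n → A i ∉ c.support := by
    intro i
    induction i with
    | zero => exact fun _ hc => h.first_notMem (hX _ hc)
    | succ i ih =>
      intro hi hmem
      obtain ⟨R₁, k1, R₂, k2, k3, k4, k5⟩ := htwo _ hmem
      have := ih (by omega)
      rcases h.neighbor (by omega) hi (hK _ k1) k4 with e1 | e1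
      · rw [Nat.add_sub_cancel] at e1
        exact this (e1 ▸ k1)
      · rcases h.neighbor (by omega) hi (hK _ k2) k5 with e2 | e2
        · rw [Nat.add_sub_cancel] at e2
          exact this (e2 ▸ k2)
        · exact k3 (e1.trans e2.symm)
  have hvs : v ∈ c.support := c.start_mem_support
  obtain ⟨i, h1, h2, rfl⟩ := h.eq_of_mem hv (Or.inl (hK v hvs))
  exact hdesc i h2 hvs

theorem treeLike : TreeLike X := by
  intro B hB C hC hne hm hr
  have hadj : (cellGraph X).Adj B C :=
    ⟨hB, hC, (h.sys.cellAdj_iff (h.subset hB) (h.subset hC)).2 ⟨hne, hm⟩⟩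
  have hb := SimpleGraph.isAcyclic_iff_forall_isBridge.1 h.isAcyclic
    ((SimpleGraph.mem_edgeSet _).2 hadj)
  rw [SimpleGraph.isBridge_iff] at hb
  refine hb ?_
  have key : ∀ D, Relation.ReflTransGen
      (fun C' D => C' ∈ X ∧ D ∈ X ∧ (C' ∩ D).Nonempty ∧ ¬ (C' = B ∧ D = C) ∧ ¬ (C' = C ∧ D = B)) B D →
      ((cellGraph X).deleteEdges {s(B, C)}).Reachable B D := by
    intro D hD
    induction hD with
    | refl => exact SimpleGraph.Reachable.refl _
    | @tail D E _ hDE ih =>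
      obtain ⟨k1, k2, k3, k4, k5⟩ := hDE
      -- A nonempty set touches itself but is not adjacent to itself, so trivial steps are dropped.
      by_cases hDE : D = E
      · rwa [← hDE]
      · refine ih.trans (SimpleGraph.Adj.reachable ?_)
        rw [SimpleGraph.deleteEdges_adj]
        refine ⟨⟨k1, k2, (h.sys.cellAdj_iff (h.subset k1) (h.subset k2)).2 ⟨hDE, k3⟩⟩, ?_⟩
        simp only [Set.mem_singleton_iff, Sym2.eq_iff]
        tauto
  exact key C hr

/-- If the doors agreed, a point of them would lie in the three cells `A 0`, `A 1` and `A (n + 1)`.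
-/
theorem doors_ne : A 0 ∩ A 1 ≠ A n ∩ A (n + 1) := by
  intro hc
  obtain ⟨z, z0, z1⟩ := h.touch 0 (by omega)
  have hz : z ∈ A n ∩ A (n + 1) := hc ▸ ⟨z0, z1⟩
  have h1 := h.one_le
  refine h.sys.not_three (h.mem_F (i := 0) (by omega)) (h.mem_F (i := 1) (by omega))
    (h.mem_F (i := n + 1) le_rfl) ?_ ?_ ?_ z0 z1 hz.2
  · intro hc; have := h.inj 0 (by omega) 1 (by omega) hc; omega
  · intro hc; have := h.inj 0 (by omega) (n + 1) (by omega) hc; omega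
  · intro hc; have := h.inj 1 (by omega) (n + 1) (by omega) hc; omega

end CorridorChain


/-! Separation and horizontal visibility along a chain of cells. -/

/-- A chain `A 0, …, A (n + 1)` of distinct successively touching cells, where `A 1, …, A n` belong to
the tree-like set `X` of cells. -/
structure BoxChain (F X : Set (Set Pt)) (n : ℕ) (A : ℕ → Set Pt) : Prop where
  sys : CellSystem F
  one_le : 1 ≤ n
  inj : ∀ i ≤ n + 1, ∀ j ≤ n + 1, A i = A j → i = j
  mem_F : ∀ i ≤ n + 1, A i ∈ F
  touch : ∀ i ≤ n, (A i ∩ A (i + 1)).Nonempty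
  subset : X ⊆ F
  mem_X : ∀ i, 1 ≤ i → i ≤ n → A i ∈ X
  tree : TreeLike X

theorem CorridorChain.boxChain {F K X : Set (Set Pt)} {n : ℕ} {A : ℕ → Set Pt}
    (h : CorridorChain F K X n A) : BoxChain F X n A :=
  ⟨h.sys, h.one_le, h.inj, fun _ hi => h.mem_F hi, h.touch, h.subset, h.mem_X, h.treeLike⟩

/-- Touching cells meet along vertical sides only; doors are therefore vertical. -/
theorem CellSystem.fst_eq {F : Set (Set Pt)} (hF : CellSystem F) {A B : Set Pt} (hA : A ∈ F)
    (hB : B ∈ F) (hne : A ≠ B) {z z' : Pt} (hz : z ∈ A ∩ B) (hz' : z' ∈ A ∩ B) : z.1 = z'.1 := by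
  have h1 := (hF.touch A hA B hB hne ⟨z, hz⟩).1
  obtain ⟨a, b⟩ := hz
  obtain ⟨c, d⟩ := hz'
  rw [(hF.box A hA).mem_iff] at a c
  rw [(hF.box B hB).mem_iff] at b d
  rcases h1 with h1 | h1 <;> linarith

namespace BoxChain

variable {F X : Set (Set Pt)} {n : ℕ} {A : ℕ → Set Pt}

/-- Exchanges the two doors. -/
theorem reverse (h : BoxChain F X n A) : BoxChain F X n (fun i => A (n + 1 - i)) where
  sys := h.sys
  one_le := h.one_le
  inj i hi j hj hij := by
    have := h.inj _ (by omega) _ (by omega) hij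
    omega
  mem_F i hi := h.mem_F _ (by omega)
  touch i hi := by
    have := h.touch (n - i) (by omega)
    rw [Set.inter_comm] at this
    rwa [show n - i + 1 = n + 1 - i by omega, show n - i = n + 1 - (i + 1) by omega] at this
  subset := h.subset
  mem_X i h1 h2 := h.mem_X _ (by omega) (by omega)
  tree := h.tree

variable (h : BoxChain F X n A)
include h

theorem box {i : ℕ} (hi : i ≤ n + 1) : IsBox (A i) := h.sys.box _ (h.mem_F i hi)

theorem ne {i j : ℕ} (hi : i ≤ n + 1) (hj : j ≤ n + 1) (hij : i ≠ j) : A i ≠ A j :=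
  fun hc => hij (h.inj i hi j hj hc)

theorem finite_X : X.Finite := h.sys.finite.subset h.subset

theorem isClosed_of_mem {R : Set Pt} (hR : R ∈ X) : IsClosed R :=
  (h.sys.box R (h.subset hR)).isCompact.isClosed

theorem subset_sUnion {i : ℕ} (h1 : 1 ≤ i) (h2 : i ≤ n) : A i ⊆ ⋃₀ X :=
  Set.subset_sUnion_of_mem (h.mem_X i h1 h2)

/-- Every connected subset of the region that joins the two ends of the chain passes through all
common sides of successive cells. -/
theorem inter_nonempty_of_isPreconnected {S : Set Pt} (hS : S ⊆ ⋃₀ X) (hc : IsPreconnected S)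
    (h0 : (S ∩ (A 0 ∩ A 1)).Nonempty) (hn : (S ∩ (A n ∩ A (n + 1))).Nonempty) {i : ℕ}
    (hi : i ≤ n) : (S ∩ (A i ∩ A (i + 1))).Nonempty := by
  rcases Nat.eq_zero_or_pos i with rfl | hi0
  · exact h0
  rcases eq_or_lt_of_le hi with rfl | hin
  · exact hn
  by_contra hcon
  have hone := h.one_le
  have hr := hc.reflTransGen_of_finite_closed h.finite_X (fun R hR => h.isClosed_of_mem hR) hS
    (h.mem_X 1 le_rfl hone) (h.mem_X n hone le_rfl)
    (h0.mono fun z hz => ⟨hz.1, hz.2.2⟩) (hn.mono fun z hz => ⟨hz.1, hz.2.1⟩)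
  -- If `S` missed the common side, the cells met by `S` would link `A 1` to `A n` without the step
  -- between `A i` and `A (i + 1)`. Completed by the two outer pieces of the chain, this is a detour
  -- around a bridge.
  refine h.tree (A i) (h.mem_X i hi0 hi) (A (i + 1)) (h.mem_X _ (by omega) (by omega))
    (h.ne (by omega) (by omega) (by omega)) (h.touch i hi) ?_
  set r : Set Pt → Set Pt → Prop := fun C D => C ∈ X ∧ D ∈ X ∧ (C ∩ D).Nonempty ∧
    ¬ (C = A i ∧ D = A (i + 1)) ∧ ¬ (C = A (i + 1) ∧ D = A i) with hrdef
  have hmid : Relation.ReflTransGen r (A 1) (A n) := by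
    refine Relation.ReflTransGen.mono ?_ _ _ hr
    rintro C D ⟨k1, k2, z, hz, hzS⟩
    refine ⟨k1, k2, ⟨z, hz⟩, ?_, ?_⟩
    · rintro ⟨rfl, rfl⟩
      exact hcon ⟨z, hzS, hz⟩
    · rintro ⟨rfl, rfl⟩
      exact hcon ⟨z, hzS, hz.2, hz.1⟩
  have hstep : ∀ a, 1 ≤ a → a + 1 ≤ n → a ≠ i → r (A (a + 1)) (A a) := by
    intro a h1 h2 hne
    refine ⟨h.mem_X _ (by omega) h2, h.mem_X _ h1 (by omega), ?_, ?_, ?_⟩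
    · rw [Set.inter_comm]
      exact h.touch a (by omega)
    · rintro ⟨e1, e2⟩
      have := h.inj _ (by omega) _ (by omega) e1
      have := h.inj _ (by omega) _ (by omega) e2
      omega
    · rintro ⟨e1, e2⟩
      have := h.inj _ (by omega) _ (by omega) e2
      omega
  have hdown : ∀ a, 1 ≤ a → ∀ b, a ≤ b → b ≤ n → (b ≤ i ∨ i < a) →
      Relation.ReflTransGen r (A b) (A a) := by
    intro a ha b hab
    induction b, hab using Nat.le_induction with
    | base => exact fun _ _ => Relation.ReflTransGen.refl
    | succ b hb ih =>
      intro h1 h2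
      exact Relation.ReflTransGen.head (hstep b (by omega) h1 (by omega))
        (ih (by omega) (by omega))
  exact ((hdown 1 le_rfl i hi0 hi (Or.inl le_rfl)).trans hmid).trans
    (hdown (i + 1) (by omega) n (by omega) le_rfl (Or.inr (by omega)))

theorem mem_inter {i : ℕ} (hi : i ≤ n) {z : Pt} (hz : z ∈ A i ∩ A (i + 1)) {y : ℝ}
    (h1 : ylo (A i) ≤ y ∧ y ≤ yhi (A i)) (h2 : ylo (A (i + 1)) ≤ y ∧ y ≤ yhi (A (i + 1))) :
    ((z.1, y) : Pt) ∈ A i ∩ A (i + 1) := by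
  have b1 := h.box (i := i) (by omega)
  have b2 := h.box (i := i + 1) (by omega)
  exact ⟨b1.mem_iff.2 ⟨(b1.mem_iff.1 hz.1).1, h1⟩, b2.mem_iff.2 ⟨(b2.mem_iff.1 hz.2).1, h2⟩⟩

/-- A crossing segment is connected, so it meets every common side of successive cells. Conversely,
at a height shared by all cells, the pieces between successive common sides join up. -/
theorem mem_crossingHeights_iff {y : ℝ} :
    y ∈ crossingHeights (⋃₀ X) (A 0 ∩ A 1) (A n ∩ A (n + 1)) ↔
      ∀ i ≤ n + 1, ylo (A i) ≤ y ∧ y ≤ yhi (A i) := by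
  have hone := h.one_le
  constructor
  · rintro ⟨p₁, hp₁, p₂, hp₂, rfl, h2, hs⟩ i hi
    have key : ∀ i ≤ n, ((ylo (A i) ≤ p₁.2 ∧ p₁.2 ≤ yhi (A i)) ∧
        ylo (A (i + 1)) ≤ p₁.2 ∧ p₁.2 ≤ yhi (A (i + 1))) := by
      intro i hi
      obtain ⟨z, hz, hz1, hz2⟩ := h.inter_nonempty_of_isPreconnected hs
        (convex_segment _ _).isPreconnected ⟨p₁, left_mem_segment ℝ _ _, hp₁⟩
        ⟨p₂, right_mem_segment ℝ _ _, hp₂⟩ hi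
      have hzy := ((mem_segment_horiz h2.symm).1 hz).1
      rw [← hzy]
      exact ⟨((h.box (by omega)).mem_iff.1 hz1).2, ((h.box (by omega)).mem_iff.1 hz2).2⟩
    rcases Nat.eq_zero_or_pos i with rfl | hi0
    · exact (key 0 (by omega)).1
    · have := (key (i - 1) (by omega)).2
      rwa [Nat.sub_add_cancel hi0] at this
  · intro hy
    have hz : ∀ i ≤ n, ∃ x : ℝ, ((x, y) : Pt) ∈ A i ∩ A (i + 1) := by
      intro i hi
      obtain ⟨z, hz⟩ := h.touch i hi
      exact ⟨z.1, h.mem_inter hi hz (hy i (by omega)) (hy (i + 1) (by omega))⟩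
    choose! x hx using hz
    have key : ∀ m ≤ n, segment ℝ ((x 0, y) : Pt) (x m, y) ⊆ ⋃₀ X := by
      intro m
      induction m with
      | zero =>
        intro _
        rw [segment_same]
        simpa using h.subset_sUnion le_rfl hone (hx 0 (by omega)).2
      | succ m ih =>
        intro hm z hz
        obtain ⟨hz1, hz2⟩ := (mem_segment_horiz (by rfl)).1 hz
        rcases Set.uIcc_subset_uIcc_union_uIcc (b := x m) hz2 with h3 | h3
        · exact ih (by omega) ((mem_segment_horiz (by rfl)).2 ⟨hz1, h3⟩)
        · refine h.subset_sUnion (i := m + 1) (by omega) hm ((h.box (by omega)).convex.segment_subset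
            (hx m (by omega)).2 (hx (m + 1) hm).1 ?_)
          exact (mem_segment_horiz (by rfl)).2 ⟨hz1, h3⟩
    exact ⟨_, hx 0 (by omega), _, hx n le_rfl, rfl, rfl, key n le_rfl⟩

/-- The crossing heights of an open corridor form a closed interval, whose end is the height of some
cell of the chain. -/
theorem exists_crossing_interval
    (ho : (crossingHeights (⋃₀ X) (A 0 ∩ A 1) (A n ∩ A (n + 1))).Nonempty) :
    ∃ lo hi, lo ≤ hi ∧ crossingHeights (⋃₀ X) (A 0 ∩ A 1) (A n ∩ A (n + 1)) = Set.Icc lo hi ∧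
      (∃ i ≤ n + 1, ylo (A i) = lo) ∧ ∃ i ≤ n + 1, yhi (A i) = hi := by
  obtain ⟨y, hy⟩ := ho
  rw [h.mem_crossingHeights_iff] at hy
  obtain ⟨i, hi, hi'⟩ := Finset.exists_max_image (Finset.range (n + 2)) (fun i => ylo (A i))
    ⟨0, by simp⟩
  obtain ⟨j, hj, hj'⟩ := Finset.exists_min_image (Finset.range (n + 2)) (fun i => yhi (A i))
    ⟨0, by simp⟩
  simp only [Finset.mem_range] at hi hi' hj hj'
  refine ⟨ylo (A i), yhi (A j), ((hy i (by omega)).1).trans (hy j (by omega)).2, ?_,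
    ⟨i, by omega, rfl⟩, ⟨j, by omega, rfl⟩⟩
  ext y'
  rw [h.mem_crossingHeights_iff]
  constructor
  · intro h1
    exact ⟨(h1 i (by omega)).1, (h1 j (by omega)).2⟩
  · intro h1 a ha
    exact ⟨(hi' a (by omega)).trans h1.1, h1.2.trans (hj' a (by omega))⟩

end BoxChain

/-- A number, moved into the interval `[lo, hi]`. -/
noncomputable def clamp (lo hi y : ℝ) : ℝ := max lo (min y hi)

theorem clamp_mem {lo hi : ℝ} (h : lo ≤ hi) (y : ℝ) : clamp lo hi y ∈ Set.Icc lo hi :=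
  ⟨le_max_left _ _, max_le h (min_le_right _ _)⟩

/-- A path that visits points below `hi` and above `lo` may be rerouted through the strip between
the heights `lo` and `hi`. -/
theorem clamp_l1_le {lo hi L : ℝ} (h : lo ≤ hi) {p q a b : Pt} (ha : a.2 ≤ hi) (hb : lo ≤ b.2)
    (hL1 : l1 p a + l1 a q ≤ L) (hL2 : l1 p b + l1 b q ≤ L) :
    l1 p (p.1, clamp lo hi p.2) + l1 (p.1, clamp lo hi p.2) (q.1, clamp lo hi q.2) +
      l1 (q.1, clamp lo hi q.2) q ≤ L := by
  have t1 := abs_sub_le p.1 a.1 q.1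
  have t2 := abs_sub_le p.1 b.1 q.1
  simp only [l1, clamp, sub_self, abs_zero] at *
  -- Horizontally the triangle inequality suffices. Vertically, if both heights are above `hi` the
  -- visit to `a` pays for the detour, and if both are below `lo` the visit to `b` does; otherwise
  -- clamping costs nothing.
  suffices |p.2 - max lo (min p.2 hi)| + |max lo (min p.2 hi) - max lo (min q.2 hi)| +
      |max lo (min q.2 hi) - q.2| ≤ max (|p.2 - a.2| + |a.2 - q.2|) (|p.2 - b.2| + |b.2 - q.2|) by
    rcases le_max_iff.1 this with h1 | h1 <;> linarith
  have u1 := le_abs_self (p.2 - a.2)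
  have u2 := neg_le_abs (a.2 - q.2)
  have u3 := neg_le_abs (p.2 - b.2)
  have u4 := le_abs_self (b.2 - q.2)
  have u5 := neg_le_abs (p.2 - a.2)
  have u6 := le_abs_self (a.2 - q.2)
  rw [le_max_iff]
  rcases le_total p.2 hi with h1 | h1 <;> rcases le_total q.2 hi with h2 | h2 <;>
    rcases le_total lo p.2 with h3 | h3 <;> rcases le_total lo q.2 with h4 | h4 <;>
    simp only [min_eq_left, min_eq_right, max_eq_left, max_eq_right, h1, h2, h3, h4, h, sub_self,
      abs_zero, zero_add, add_zero] <;>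
    first
    | (left; linarith [abs_sub_le p.2 a.2 q.2])
    | (left; rw [abs_of_nonneg (by linarith), abs_of_nonpos (by linarith)]; linarith)
    | (left; rw [abs_of_nonneg (by linarith), abs_of_nonneg (by linarith)]; linarith)
    | (left; rw [abs_of_nonpos (by linarith), abs_of_nonpos (by linarith)]; linarith)
    | (right; rw [abs_of_nonpos (by linarith), abs_of_nonneg (by linarith)]; linarith)
    | (left; rw [abs_of_nonneg (by linarith), abs_of_nonneg (by linarith),
        abs_of_nonneg (by linarith)]; linarith)
    | (left; rw [abs_of_nonpos (by linarith), abs_of_nonpos (by linarith),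
        abs_of_nonpos (by linarith)]; linarith)


/-! The window of a maximal histogram that separates the two doors of a closed corridor. -/

theorem reflTransGen_symm {α : Type*} {r : α → α → Prop} (hs : ∀ a b, r a b → r b a) {a b : α}
    (h : Relation.ReflTransGen r a b) : Relation.ReflTransGen r b a := by
  induction h with
  | refl => exact Relation.ReflTransGen.refl
  | tail _ h ih => exact Relation.ReflTransGen.head (hs _ _ h) ih

/-- A chain of cells that runs to the right as long as it is visible from its first door, up to the
cell `A k`, and leaves that cell above the visible heights; `A j` is the last cell that bounds the
visible heights from above. -/
structure WindowChain (F X : Set (Set Pt)) (n : ℕ) (A : ℕ → Set Pt) (j k : ℕ) : Prop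
    extends BoxChain F X n A where
  lt : j < k
  le : k ≤ n
  right : ∀ i < k, xhi (A i) = xlo (A (i + 1))
  mem : ∀ i ≤ k, ylo (A i) ≤ yhi (A j) ∧ yhi (A j) ≤ yhi (A i)
  gt : ∀ i, j < i → i ≤ k → yhi (A j) < yhi (A i)
  above : yhi (A j) < ylo (A (k + 1))

/-- The cells of `X` that are crossed by the horizontal ray to the right of the point `(x₀, y₀)`. -/
def row (X : Set (Set Pt)) (x₀ y₀ : ℝ) : Set (Set Pt) :=
  {Q | Q ∈ X ∧ x₀ ≤ xlo Q ∧ ylo Q < y₀ ∧ y₀ < yhi Q ∧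
    ∀ x ∈ Set.Icc x₀ (xhi Q), ((x, y₀) : Pt) ∈ ⋃₀ X}

theorem mem_interior_union {Q Q' : Set Pt} (hQ : IsBox Q) (hQ' : IsBox Q') (hx : xhi Q = xlo Q')
    {y : ℝ} (h1 : ylo Q < y ∧ y < yhi Q) (h2 : ylo Q' < y ∧ y < yhi Q') :
    ((xhi Q, y) : Pt) ∈ interior (Q ∪ Q') := by
  have b1 := hQ.1
  have b2 := hQ'.1
  refine mem_interior.2 ⟨Set.Ioo (xlo Q) (xhi Q') ×ˢ
    Set.Ioo (max (ylo Q) (ylo Q')) (min (yhi Q) (yhi Q')), ?_, isOpen_Ioo.prod isOpen_Ioo,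
    ⟨⟨b1, by simp only; linarith⟩, max_lt h1.1 h2.1, lt_min h1.2 h2.2⟩⟩
  rintro z ⟨⟨h3, h4⟩, h5, h6⟩
  rw [max_lt_iff] at h5
  rw [lt_min_iff] at h6
  rcases le_total z.1 (xhi Q) with h7 | h7
  · exact Or.inl (hQ.mem_iff.2 ⟨⟨h3.le, h7⟩, h5.1.le, h6.1.le⟩)
  · exact Or.inr (hQ'.mem_iff.2 ⟨⟨hx ▸ h7, h4.le⟩, h5.2.le, h6.2.le⟩)

namespace WindowChain

variable {F X : Set (Set Pt)} {n : ℕ} {A : ℕ → Set Pt} {j k : ℕ}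
variable (h : WindowChain F X n A j k)
include h

theorem isBox_of_mem {Q : Set Pt} (hQ : Q ∈ X) : IsBox Q := h.sys.box Q (h.subset hQ)

theorem xhi_le {a b : ℕ} (hab : a ≤ b) (hb : b ≤ k) : xhi (A a) ≤ xhi (A b) := by
  induction b, hab using Nat.le_induction with
  | base => exact le_rfl
  | succ b hab ih =>
    have h1 := ih (by omega)
    have h2 := h.right b (by omega)
    have h3 := (h.box (i := b + 1) (by have := h.le; omega)).1
    linarith

theorem xlo_lt {i : ℕ} (hi : i ≤ j) : xlo (A i) < xhi (A j) := by
  have h1 := h.lt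
  have h2 := h.le
  have h3 := (h.box (i := i) (by omega)).1
  have h4 := h.xhi_le hi h1.le
  linarith

theorem corner_mem : ((xhi (A j), yhi (A j)) : Pt) ∈ A j := by
  have h1 := h.lt
  have h2 := h.le
  have b := h.box (i := j) (by omega)
  exact b.mem_iff.2 ⟨⟨b.1.le, le_rfl⟩, b.2.1.le, le_rfl⟩

theorem ylo_succ_lt : ylo (A (j + 1)) < yhi (A j) := by
  have h1 := h.lt
  have h2 := h.le
  have h3 := (h.sys.touch (A j) (h.mem_F j (by omega)) (A (j + 1)) (h.mem_F _ (by omega))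
    (h.ne (by omega) (by omega) (by omega)) (h.touch j (by omega))).2
  rw [max_lt_iff, lt_min_iff, lt_min_iff] at h3
  exact h3.2.1

theorem corner_mem' : ((xhi (A j), yhi (A j)) : Pt) ∈ A (j + 1) := by
  have h1 := h.lt
  have h2 := h.le
  have b := h.box (i := j + 1) (by omega)
  have h3 := h.right j h1
  have h4 := b.1
  refine b.mem_iff.2 ⟨⟨h3.ge, ?_⟩, h.mem (j + 1) h1⟩
  simp only
  linarith

/-- Only two cells contain the corner. -/
theorem eq_of_corner_mem {Q : Set Pt} (hQ : Q ∈ F) (hm : ((xhi (A j), yhi (A j)) : Pt) ∈ Q) :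
    Q = A j ∨ Q = A (j + 1) := by
  have h1 := h.lt
  have h2 := h.le
  by_contra! hc
  exact h.sys.not_three hQ (h.mem_F j (by omega)) (h.mem_F (j + 1) (by omega)) hc.1 hc.2
    (h.ne (by omega) (by omega) (by omega)) hm h.corner_mem h.corner_mem'

/-- Otherwise the top of `A j` and a side of `Q` would lie on one horizontal segment that avoids the
interiors of cells, yet runs through the interior of `A (j + 1)`. -/
theorem height_ne {Q : Set Pt} (hQ : Q ∈ F) (hx : xhi (A j) < xhi Q) :
    yhi (A j) ≠ ylo Q ∧ yhi (A j) ≠ yhi Q := by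
  have h1 := h.lt
  have h2 := h.le
  by_contra hc
  have hc' : yhi (A j) = ylo Q ∨ yhi (A j) = yhi Q := by tauto
  have b := h.box (i := j + 1) (by omega)
  have bj := h.box (i := j) (by omega)
  have bQ := h.sys.box Q hQ
  have h3 := h.right j h1
  obtain ⟨x, hx1, hx2⟩ := exists_between (lt_min hx (h3 ▸ b.1 : xhi (A j) < xhi (A (j + 1))))
  rw [lt_min_iff] at hx2
  exact h.sys.horiz (A j) (h.mem_F j (by omega)) Q hQ (A (j + 1)) (h.mem_F _ (by omega)) (yhi (A j))
    (Or.inr rfl) hc' h.ylo_succ_lt (h.gt _ (by omega) h1) x ⟨h3 ▸ hx1, hx2.2⟩ (xhi (A j))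
    ⟨bj.1.le, le_rfl⟩ (xhi Q) ⟨bQ.1.le, le_rfl⟩ hx1.le hx2.1.le

theorem height_strict {Q : Set Pt} (hQ : Q ∈ F) (hx : xhi (A j) < xhi Q)
    (hy : ylo Q ≤ yhi (A j) ∧ yhi (A j) ≤ yhi Q) : ylo Q < yhi (A j) ∧ yhi (A j) < yhi Q :=
  ⟨lt_of_le_of_ne hy.1 (h.height_ne hQ hx).1.symm, lt_of_le_of_ne hy.2 (h.height_ne hQ hx).2⟩

theorem visible {i : ℕ} (h1 : 1 ≤ i) (h2 : i ≤ k) :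
    ∀ x ∈ Set.Icc (xhi (A 0)) (xhi (A i)), ((x, yhi (A j)) : Pt) ∈ ⋃₀ X := by
  have hk := h.le
  induction i, h1 using Nat.le_induction with
  | base =>
    intro x hx
    refine h.subset_sUnion (i := 1) le_rfl h.one_le ((h.box (by omega)).mem_iff.2
      ⟨⟨?_, hx.2⟩, h.mem 1 h2⟩)
    rw [← h.right 0 (by omega)]
    exact hx.1
  | succ i hi ih =>
    intro x hx
    rcases le_total x (xhi (A i)) with h3 | h3
    · exact ih (by omega) x ⟨hx.1, h3⟩
    · refine h.subset_sUnion (i := i + 1) (by omega) (by omega) ((h.box (by omega)).mem_iff.2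
        ⟨⟨?_, hx.2⟩, h.mem _ h2⟩)
      rw [← h.right i (by omega)]
      exact h3

theorem mem_row {i : ℕ} (h1 : j < i) (h2 : i ≤ k) : A i ∈ row X (xhi (A j)) (yhi (A j)) := by
  have hk := h.le
  have h3 := h.right (i - 1) (by omega)
  rw [Nat.sub_add_cancel (by omega)] at h3
  have h4 := h.xhi_le (a := j) (b := i - 1) (by omega) (by omega)
  have b := (h.box (i := i) (by omega)).1
  have hs := h.height_strict (h.mem_F i (by omega)) (by linarith) (h.mem i h2)
  refine ⟨h.mem_X i (by omega) (by omega), by linarith, hs.1, hs.2, ?_⟩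
  intro x hx
  exact h.visible (by omega) h2 x ⟨(h.xhi_le (Nat.zero_le j) h.lt.le).trans hx.1, hx.2⟩

/-- A visible point just left of `Q` lies in a cell of `X` that also contains the point of the row
on the left side of `Q`. Touching `Q` from the left, this cell ends exactly at `xlo Q`. -/
theorem exists_pred {Q : Set Pt} (hQ : Q ∈ X) (hy : ylo Q < yhi (A j) ∧ yhi (A j) < yhi Q)
    {x₁ : ℝ} (hlt : x₁ < xlo Q) (hx₁ : xhi (A j) ≤ x₁)
    (hvis : ∀ x ∈ Set.Ico x₁ (xlo Q), ((x, yhi (A j)) : Pt) ∈ ⋃₀ X) :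
    ∃ Q' ∈ X, xhi Q' = xlo Q ∧ ylo Q' < yhi (A j) ∧ yhi (A j) < yhi Q' := by
  obtain ⟨U, hU, hU'⟩ := exists_nhds_common h.finite_X (fun R hR => h.isClosed_of_mem hR)
    ((xlo Q, yhi (A j)) : Pt)
  have hc : ContinuousAt (fun x : ℝ => ((x, yhi (A j)) : Pt)) (xlo Q) := by fun_prop
  obtain ⟨l, hl, hlU⟩ := exists_Ioc_subset_of_mem_nhds (hc hU) ⟨x₁, hlt⟩
  obtain ⟨x, hx1, hx2⟩ := exists_between (max_lt hl hlt)
  rw [max_lt_iff] at hx1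
  obtain ⟨Q', hQ', hm⟩ := hvis x ⟨hx1.2.le, hx2⟩
  have hm' := hU' _ (hlU ⟨hx1.1, hx2.le⟩) Q' hQ' hm
  have bQ := h.isBox_of_mem hQ
  have bQ' := h.isBox_of_mem hQ'
  have hmQ : ((xlo Q, yhi (A j)) : Pt) ∈ Q := bQ.mem_iff.2 ⟨⟨le_rfl, bQ.1.le⟩, hy.1.le, hy.2.le⟩
  rw [bQ'.mem_iff] at hm
  have hne : Q ≠ Q' := by
    rintro rfl
    exact absurd hm.1.1 (not_le.2 hx2)
  have b1 := bQ.1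
  have hxe : xhi Q' = xlo Q := by
    rcases (h.sys.touch Q (h.subset hQ) Q' (h.subset hQ') hne ⟨_, hmQ, hm'⟩).1 with h5 | h5
    · have := hm.1.1
      simp only at this
      linarith
    · exact h5
  exact ⟨Q', hQ', hxe, h.height_strict (h.subset hQ') (by linarith) (bQ'.mem_iff.1 hm').2⟩

theorem exists_succ {Q : Set Pt} (hQ : Q ∈ X) (hy : ylo Q < yhi (A j) ∧ yhi (A j) < yhi Q)
    {x₁ : ℝ} (hlt : xhi Q < x₁) (hx₁ : xhi (A j) ≤ xhi Q)
    (hvis : ∀ x ∈ Set.Ioc (xhi Q) x₁, ((x, yhi (A j)) : Pt) ∈ ⋃₀ X) :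
    ∃ Q' ∈ X, xhi Q = xlo Q' ∧ ylo Q' < yhi (A j) ∧ yhi (A j) < yhi Q' := by
  obtain ⟨U, hU, hU'⟩ := exists_nhds_common h.finite_X (fun R hR => h.isClosed_of_mem hR)
    ((xhi Q, yhi (A j)) : Pt)
  have hc : ContinuousAt (fun x : ℝ => ((x, yhi (A j)) : Pt)) (xhi Q) := by fun_prop
  obtain ⟨l, hl, hlU⟩ := exists_Ico_subset_of_mem_nhds (hc hU) ⟨x₁, hlt⟩
  obtain ⟨x, hx1, hx2⟩ := exists_between (lt_min hl hlt)
  rw [lt_min_iff] at hx2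
  obtain ⟨Q', hQ', hm⟩ := hvis x ⟨hx1, hx2.2.le⟩
  have hm' := hU' _ (hlU ⟨hx1.le, hx2.1⟩) Q' hQ' hm
  have bQ := h.isBox_of_mem hQ
  have bQ' := h.isBox_of_mem hQ'
  have hmQ : ((xhi Q, yhi (A j)) : Pt) ∈ Q := bQ.mem_iff.2 ⟨⟨bQ.1.le, le_rfl⟩, hy.1.le, hy.2.le⟩
  rw [bQ'.mem_iff] at hm
  have hne : Q ≠ Q' := by
    rintro rfl
    exact absurd hm.1.2 (not_le.2 hx1)
  have b1 := bQ.1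
  have b2 := bQ'.1
  have hxe : xhi Q = xlo Q' := by
    rcases (h.sys.touch Q (h.subset hQ) Q' (h.subset hQ') hne ⟨_, hmQ, hm'⟩).1 with h5 | h5
    · exact h5
    · have := hm.1.2
      simp only at this
      linarith
  exact ⟨Q', hQ', hxe, h.height_strict (h.subset hQ') (by linarith) (bQ'.mem_iff.1 hm').2⟩

theorem eq_of_row_of_xlo {Q : Set Pt} (hQ : Q ∈ row X (xhi (A j)) (yhi (A j)))
    (hx : xlo Q = xhi (A j)) : Q = A (j + 1) := by
  have b := h.isBox_of_mem hQ.1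
  rcases h.eq_of_corner_mem (h.subset hQ.1)
    (b.mem_iff.2 ⟨⟨hx.le, hx ▸ b.1.le⟩, hQ.2.2.1.le, hQ.2.2.2.1.le⟩) with rfl | h1
  · exact absurd hQ.2.2.2.1 (lt_irrefl _)
  · exact h1

theorem exists_row_pred {Q : Set Pt} (hQ : Q ∈ row X (xhi (A j)) (yhi (A j)))
    (hx : xhi (A j) < xlo Q) :
    ∃ Q' ∈ row X (xhi (A j)) (yhi (A j)), xhi Q' = xlo Q := by
  obtain ⟨hQX, h1, h2, h3, h4⟩ := hQ
  have bQ := h.isBox_of_mem hQX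
  obtain ⟨Q', hQ', hxe, h5, h6⟩ := h.exists_pred hQX ⟨h2, h3⟩ hx le_rfl
    fun x hx => h4 x ⟨hx.1, hx.2.le.trans bQ.1.le⟩
  have bQ' := h.isBox_of_mem hQ'
  refine ⟨Q', ⟨hQ', ?_, h5, h6, fun x hx => h4 x ⟨hx.1, hx.2.trans (hxe ▸ bQ.1.le)⟩⟩, hxe⟩
  -- A predecessor starting left of the corner would contain it, so it would be `A j`, which does
  -- not rise above the row height, or `A (j + 1)`, which starts at the corner.
  by_contra! hc
  rcases h.eq_of_corner_mem (h.subset hQ') (bQ'.mem_iff.2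
    ⟨⟨hc.le, by simp only; linarith⟩, h5.le, h6.le⟩) with rfl | rfl
  · exact lt_irrefl _ h6
  · have := h.right j h.lt
    linarith

theorem row_inter_nonempty {Q Q' : Set Pt} (hQ : Q ∈ row X (xhi (A j)) (yhi (A j)))
    (hQ' : Q' ∈ row X (xhi (A j)) (yhi (A j))) (hx : xhi Q' = xlo Q) : 
    ((xlo Q, yhi (A j)) : Pt) ∈ Q ∩ Q' := by
  have bQ := h.isBox_of_mem hQ.1
  have bQ' := h.isBox_of_mem hQ'.1
  exact ⟨bQ.mem_iff.2 ⟨⟨le_rfl, bQ.1.le⟩, hQ.2.2.1.le, hQ.2.2.2.1.le⟩,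
    bQ'.mem_iff.2 ⟨⟨hx ▸ bQ'.1.le, hx.ge⟩, hQ'.2.2.1.le, hQ'.2.2.2.1.le⟩⟩

theorem finite_row : (row X (xhi (A j)) (yhi (A j))).Finite := h.finite_X.subset fun _ hQ => hQ.1

/-- The leftmost row cell not linked to `A (j + 1)` would have a predecessor in the row, which
starts further left and is therefore linked. -/
theorem row_connected {Q : Set Pt} (hQ : Q ∈ row X (xhi (A j)) (yhi (A j))) :
    Relation.ReflTransGen (fun C D => C ∈ row X (xhi (A j)) (yhi (A j)) ∧
      D ∈ row X (xhi (A j)) (yhi (A j)) ∧ (C ∩ D).Nonempty) Q (A (j + 1)) := by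
  by_contra hc
  set r : Set Pt → Set Pt → Prop := fun C D => C ∈ row X (xhi (A j)) (yhi (A j)) ∧
      D ∈ row X (xhi (A j)) (yhi (A j)) ∧ (C ∩ D).Nonempty
  obtain ⟨Q₀, ⟨h1, h2⟩, h3⟩ := Set.exists_min_image
    {Q | Q ∈ row X (xhi (A j)) (yhi (A j)) ∧ ¬ Relation.ReflTransGen r Q (A (j + 1))} xlo
    (h.finite_row.subset fun Q hQ => hQ.1) ⟨Q, hQ, hc⟩
  rcases eq_or_lt_of_le h1.2.1 with h4 | h4
  · rw [h.eq_of_row_of_xlo h1 h4.symm] at h2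
    exact h2 Relation.ReflTransGen.refl
  · obtain ⟨Q', h5, h6⟩ := h.exists_row_pred h1 h4
    have h7 : Relation.ReflTransGen r Q' (A (j + 1)) := by
      by_contra h8
      have := h3 Q' ⟨h5, h8⟩
      have b := (h.isBox_of_mem h5.1).1
      linarith
    exact h2 (h7.head ⟨h1, h5, _, h.row_inter_nonempty h1 h5 h6⟩)

/-- Two attachments to the row of the same component of the remaining cells coincide. -/
theorem attachment_unique {B B' Q Q' : Set Pt} (hB : B ∈ X \ row X (xhi (A j)) (yhi (A j)))
    (hB' : B' ∈ X \ row X (xhi (A j)) (yhi (A j))) (hQ : Q ∈ row X (xhi (A j)) (yhi (A j)))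
    (hQ' : Q' ∈ row X (xhi (A j)) (yhi (A j))) (hBQ : (B ∩ Q).Nonempty)
    (hBQ' : (B' ∩ Q').Nonempty)
    (hr : Relation.ReflTransGen (fun C D => C ∈ X \ row X (xhi (A j)) (yhi (A j)) ∧
      D ∈ X \ row X (xhi (A j)) (yhi (A j)) ∧ (C ∩ D).Nonempty) B B') : B = B' ∧ Q = Q' := by
  by_contra hne
  have hBQne : B ≠ Q := by
    rintro rfl
    exact hB.2 hQ
  -- Different attachments give a second route from `B` to `Q`: through the component to `B'`, over
  -- to `Q'` and back along the row. But `B` and `Q` form a bridge.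
  refine h.tree B hB.1 Q hQ.1 hBQne hBQ ?_
  have s1 := Relation.ReflTransGen.mono (p := fun C D => C ∈ X ∧ D ∈ X ∧ (C ∩ D).Nonempty ∧
    ¬ (C = B ∧ D = Q) ∧ ¬ (C = Q ∧ D = B)) (fun C D hCD => ⟨hCD.1.1, hCD.2.1.1, hCD.2.2,
      fun hc => hCD.2.1.2 (hc.2 ▸ hQ), fun hc => hCD.1.2 (hc.1 ▸ hQ)⟩) _ _ hr
  have hrow := (h.row_connected hQ').trans (reflTransGen_symm
    (fun C D hCD => ⟨hCD.2.1, hCD.1, by rw [Set.inter_comm]; exact hCD.2.2⟩) (h.row_connected hQ))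
  have s3 := Relation.ReflTransGen.mono (p := fun C D => C ∈ X ∧ D ∈ X ∧ (C ∩ D).Nonempty ∧
    ¬ (C = B ∧ D = Q) ∧ ¬ (C = Q ∧ D = B)) (fun C D hCD => ⟨hCD.1.1, hCD.2.1.1, hCD.2.2,
      fun hc => hB.2 (hc.1 ▸ hCD.1), fun hc => hB.2 (hc.2 ▸ hCD.2.1)⟩) _ _ hrow
  refine (s1.tail ⟨hB'.1, hQ'.1, hBQ', ?_, ?_⟩).trans s3
  · rintro ⟨rfl, rfl⟩
    exact hne ⟨rfl, rfl⟩
  · rintro ⟨rfl, -⟩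
    exact hB'.2 hQ

/-- The window. -/
theorem separates {xr : ℝ} (hxr : ∀ Q ∈ row X (xhi (A j)) (yhi (A j)), xhi Q ≤ xr) :
    Separates (⋃₀ X) (segment ℝ ((xhi (A j), yhi (A j)) : Pt) (xr, yhi (A j))) (A 0 ∩ A 1)
      (A n ∩ A (n + 1)) := by
  intro S hS hSc hS0 hSn
  set u := xhi (A j) with hu
  set β := yhi (A j) with hβ
  have hk := h.le
  have hjk := h.lt
  have hone := h.one_le
  set T : Set Pt → Set Pt → Prop := fun C D => C ∈ X \ row X u β ∧ D ∈ X \ row X u β ∧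
    (C ∩ D).Nonempty with hT
  have hTs : ∀ C D, T C D → T D C := fun C D hCD =>
    ⟨hCD.2.1, hCD.1, by rw [Set.inter_comm]; exact hCD.2.2⟩
  -- the components of the remaining cells that are attached to the row from below
  set Low : Set (Set Pt) := {C | C ∈ X \ row X u β ∧ ∃ B ∈ X \ row X u β, ∃ Q ∈ row X u β,
    (B ∩ Q).Nonempty ∧ (∀ z ∈ B ∩ Q, z.2 ≤ β) ∧ Relation.ReflTransGen T C B} with hLow
  have hw : ∀ Q ∈ row X u β, ∀ z ∈ Q, z.2 = β →
      z ∈ segment ℝ ((u, β) : Pt) (xr, β) := by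
    intro Q hQ z hz hzβ
    have hzx := ((h.isBox_of_mem hQ.1).mem_iff.1 hz).1
    refine (mem_segment_horiz (by rfl)).2 ⟨hzβ, Set.mem_uIcc.2 (Or.inl ⟨?_, ?_⟩)⟩
    · exact hQ.2.1.trans hzx.1
    · exact hzx.2.trans (hxr Q hQ)
  have hcl : ∀ (G : Set (Set Pt)) (V : Set Pt), G ⊆ X → IsClosed V →
      IsClosed (⋃ Q ∈ G, Q ∩ V) := fun G V hG hV =>
    (h.finite_X.subset hG).isClosed_biUnion fun Q hQ => (h.isClosed_of_mem (hG hQ)).inter hV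
  have hlowc : IsClosed {z : Pt | z.2 ≤ β} := isClosed_le continuous_snd continuous_const
  have hupc : IsClosed {z : Pt | β ≤ z.2} := isClosed_le continuous_const continuous_snd
  have hrowX : row X u β ⊆ X := fun Q hQ => hQ.1
  -- Two closed sets cover `S`: the cells of `Low` with the lower halves of the row, and the other
  -- cells with the upper halves. Points of `S` on the first door are in the former, those on the
  -- last door in the latter, and a common point turns out to lie on the window.
  have hS' : S ⊆ ((⋃ Q ∈ Low, Q ∩ Set.univ) ∪ ⋃ Q ∈ row X u β, Q ∩ {z : Pt | z.2 ≤ β}) ∪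
      ((⋃ Q ∈ (X \ row X u β) \ Low, Q ∩ Set.univ) ∪
        ⋃ Q ∈ row X u β, Q ∩ {z : Pt | β ≤ z.2}) := by
    intro z hz
    obtain ⟨Q, hQ, hzQ⟩ := hS hz
    by_cases hrow : Q ∈ row X u β
    · rcases le_total z.2 β with h1 | h1
      · exact Or.inl (Or.inr (Set.mem_biUnion hrow ⟨hzQ, h1⟩))
      · exact Or.inr (Or.inr (Set.mem_biUnion hrow ⟨hzQ, h1⟩))
    · by_cases hl : Q ∈ Low
      · exact Or.inl (Or.inl (Set.mem_biUnion hl ⟨hzQ, trivial⟩))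
      · exact Or.inr (Or.inl (Set.mem_biUnion (⟨⟨hQ, hrow⟩, hl⟩ : Q ∈ (X \ row X u β) \ Low)
          ⟨hzQ, trivial⟩))
  obtain ⟨z, hzS, hzlo, hzup⟩ := isPreconnected_closed_iff.1 hSc _ _
    ((hcl Low Set.univ (fun Q hQ => hQ.1.1) isClosed_univ).union (hcl _ _ hrowX hlowc))
    ((hcl ((X \ row X u β) \ Low) Set.univ (fun Q hQ => hQ.1.1) isClosed_univ).union
      (hcl _ _ hrowX hupc)) hS'
    (by
      obtain ⟨z, hz, hz0, hz1⟩ := hS0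
      refine ⟨z, hz, ?_⟩
      rcases Nat.eq_zero_or_pos j with hj | hj
      · refine Or.inr (Set.mem_biUnion (h.mem_row (i := 1) (by omega) (by omega)) ⟨hz1, ?_⟩)
        rw [Set.mem_ofPred_eq, hβ, hj]
        exact ((h.box (by omega)).mem_iff.1 hz0).2.2
      · have hoff : ∀ i, 1 ≤ i → i ≤ j → A i ∈ X \ row X u β := fun i h1 h2 =>
          ⟨h.mem_X i h1 (by omega), fun hc => absurd hc.2.1 (not_le.2 (h.xlo_lt h2))⟩
        have hreach : ∀ i, 1 ≤ i → i ≤ j → Relation.ReflTransGen T (A 1) (A i) := by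
          intro i h1
          induction i, h1 using Nat.le_induction with
          | base => exact fun _ => Relation.ReflTransGen.refl
          | succ i hi ih =>
            intro h2
            exact (ih (by omega)).tail ⟨hoff i hi (by omega), hoff _ (by omega) h2,
              h.touch i (by omega)⟩
        refine Or.inl (Set.mem_biUnion (x := A 1) ⟨hoff 1 le_rfl hj, A j, hoff j hj le_rfl,
          A (j + 1), h.mem_row (by omega) (by omega), h.touch j (by omega), ?_,
          hreach j hj le_rfl⟩ ⟨hz1, trivial⟩)
        intro z' hz'
        exact ((h.box (by omega)).mem_iff.1 hz'.1).2.2)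
    (by
      obtain ⟨z, hz, hz0, hz1⟩ := hSn
      refine ⟨z, hz, ?_⟩
      rcases eq_or_lt_of_le hk with hkn | hkn
      · subst hkn
        refine Or.inr (Set.mem_biUnion (h.mem_row hjk le_rfl) ⟨hz0, ?_⟩)
        exact h.above.le.trans ((h.box (by omega)).mem_iff.1 hz1).2.1
      · have h0 : A (k + 1) ∈ X \ row X u β :=
          ⟨h.mem_X _ (by omega) (by omega), fun hc => absurd hc.2.2.1 (not_lt.2 h.above.le)⟩
        have ht : (A (k + 1) ∩ A k).Nonempty := by
          rw [Set.inter_comm]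
          exact h.touch k hk
        have hreach : ∀ i, k + 1 ≤ i → i ≤ n →
            A i ∈ X \ row X u β ∧ Relation.ReflTransGen T (A (k + 1)) (A i) := by
          intro i h1
          induction i, h1 using Nat.le_induction with
          | base => exact fun _ => ⟨h0, Relation.ReflTransGen.refl⟩
          | succ i hi ih =>
            intro h2
            obtain ⟨h3, h4⟩ := ih (by omega)
            -- The chain cannot come back to the row: the new attachment would have to be the one at
            -- `A k`.
            have h5 : A (i + 1) ∈ X \ row X u β := by
              refine ⟨h.mem_X _ (by omega) h2, fun hc => ?_⟩
              obtain ⟨-, h6⟩ := h.attachment_unique h0 h3 (h.mem_row hjk le_rfl) hc ht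
                (h.touch i (by omega)) h4
              have := h.inj _ (by omega) _ (by omega) h6
              omega
            exact ⟨h5, h4.tail ⟨h3, h5, h.touch i (by omega)⟩⟩
        obtain ⟨h1, h2⟩ := hreach n (by omega) le_rfl
        refine Or.inl (Set.mem_biUnion (x := A n) (⟨h1, ?_⟩ : A n ∈ (X \ row X u β) \ Low)
          ⟨hz0, trivial⟩)
        -- The component of `A n` is attached to the row only through `A (k + 1)` and `A k`, and
        -- this contact is above the window.
        rintro ⟨-, B, hB, Q, hQ, h3, h4, h5⟩
        obtain ⟨rfl, rfl⟩ := h.attachment_unique h0 hB (h.mem_row hjk le_rfl) hQ ht h3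
          (h2.trans h5)
        obtain ⟨z', hz'⟩ := ht
        have h6 := h4 z' hz'
        have h7 := ((h.box (by omega)).mem_iff.1 hz'.1).2.1
        have h8 := h.above
        linarith)
  refine ⟨z, hzS, ?_⟩
  rcases hzlo with hzlo | hzlo <;> rcases hzup with hzup | hzup <;>
    obtain ⟨C, hC, hzC, hzC'⟩ := Set.mem_iUnion₂.1 hzlo <;>
    obtain ⟨D, hD, hzD, hzD'⟩ := Set.mem_iUnion₂.1 hzup
  · refine (hD.2 ⟨hD.1, ?_⟩).elim
    obtain ⟨hCr, B, hB, Q, hQ, h3, h4, h5⟩ := hC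
    exact ⟨B, hB, Q, hQ, h3, h4, h5.head ⟨hD.1, hCr, z, hzD, hzC⟩⟩
  · obtain ⟨hCr, B, hB, Q, hQ, h3, h4, h5⟩ := hC
    obtain ⟨rfl, rfl⟩ := h.attachment_unique hCr hB hD hQ ⟨z, hzC, hzD⟩ h3 h5
    exact hw D hD z hzD (le_antisymm (h4 z ⟨hzC, hzD⟩) hzD')
  -- A contact below the window between a row cell `C` and a cell `D` not attached from below. Their
  -- common side also reaches above the window, so `D` crosses its height. If `D` is left of `C`,
  -- three cells meet in a point or `D` contains the corner, both impossible; if it is right of `C`,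
  -- it belongs to the row.
  · exfalso
    have hne : D ≠ C := by
      rintro rfl
      exact hD.1.2 hC
    have hz' : ∃ z' ∈ D ∩ C, β < z'.2 := by
      by_contra! hc
      exact hD.2 ⟨hD.1, D, hD.1, C, hC, ⟨z, hzD, hzC⟩, hc, Relation.ReflTransGen.refl⟩
    obtain ⟨z', hz'm, hz'β⟩ := hz'
    have hDX := hD.1.1
    have hCX := hC.1
    have bC := h.isBox_of_mem hCX
    have bD := h.isBox_of_mem hDX
    have mD := bD.mem_iff.1 hzD
    have mC := bC.mem_iff.1 hzC
    have mD' := bD.mem_iff.1 hz'm.1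
    have hβD : ylo D ≤ β ∧ β ≤ yhi D := ⟨mD.2.1.trans hzC', hz'β.le.trans mD'.2.2⟩
    have hzβD : ((z.1, β) : Pt) ∈ D := bD.mem_iff.2 ⟨mD.1, hβD⟩
    have hzβC : ((z.1, β) : Pt) ∈ C := bC.mem_iff.2 ⟨mC.1, hC.2.2.1.le, hC.2.2.2.1.le⟩
    have bC1 := bC.1
    have bD1 := bD.1
    have hCu := hC.2.1
    rcases (h.sys.touch D (h.subset hDX) C (h.subset hCX) hne ⟨z, hzD, hzC⟩).1 with h1 | h1
    · have hzx : z.1 = xlo C := le_antisymm (h1 ▸ mD.1.2) mC.1.1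
      rcases eq_or_lt_of_le hCu with h2 | h2
      · rcases h.eq_of_corner_mem (h.subset hDX) (by
          rw [← hβ, ← hu, h2, ← hzx]; exact hzβD) with h3 | h3
        · rw [h3] at mD'
          exact absurd mD'.2.2 (not_le.2 hz'β)
        · exact hne (h3.trans (h.eq_of_row_of_xlo hC h2.symm).symm)
      · obtain ⟨Q', h5, h6⟩ := h.exists_row_pred hC h2
        have h7 := (h.row_inter_nonempty hC h5 h6).2
        rw [← hzx] at h7
        have hQC : Q' ≠ C := by
          rintro rfl
          linarith
        have hQD : Q' ≠ D := by
          rintro rfl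
          exact hD.1.2 h5
        exact h.sys.not_three (h.subset h5.1) (h.subset hCX) (h.subset hDX) hQC hQD hne.symm h7
          hzβC hzβD
    · have hs := h.height_strict (h.subset hDX) (by linarith) hβD
      refine hD.1.2 ⟨hDX, by linarith, hs.1, hs.2, ?_⟩
      intro x hx
      rcases le_total x (xhi C) with h2 | h2
      · exact hC.2.2.2.2 x ⟨hx.1, h2⟩
      · exact ⟨D, hDX, bD.mem_iff.2 ⟨⟨h1 ▸ h2, hx.2⟩, hβD⟩⟩
  · exact hw C hC z hzC (le_antisymm hzC' hzD')

end WindowChain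


/-! ### The window and its backbone point. -/

namespace WindowChain

variable {F X : Set (Set Pt)} {n : ℕ} {A : ℕ → Set Pt} {j k : ℕ}
variable (h : WindowChain F X n A j k)
include h

/-- The point is inside a cell or on a vertical side between two cells that both cross this height;
tops and bottoms are excluded by `height_strict`. -/
theorem mem_interior {xr x : ℝ} (h1 : xhi (A j) < x) (h2 : x < xr)
    (hvis : ∀ x ∈ Set.Icc (xhi (A j)) xr, ((x, yhi (A j)) : Pt) ∈ ⋃₀ X) :
    ((x, yhi (A j)) : Pt) ∈ interior (⋃₀ X) := by
  obtain ⟨Q, hQ, hm⟩ := hvis x ⟨h1.le, h2.le⟩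
  have b := h.isBox_of_mem hQ
  have m := b.mem_iff.1 hm
  have hs := h.height_strict (h.subset hQ) (h1.trans_le m.1.2) m.2
  rcases eq_or_lt_of_le m.1.1 with h3 | h3
  · simp only at h3
    obtain ⟨Q', hQ', h4, h5⟩ := h.exists_pred hQ hs (x₁ := xhi (A j)) (by linarith) le_rfl
      fun x' hx' => hvis x' ⟨hx'.1, by linarith [hx'.2]⟩
    have := mem_interior_union (h.isBox_of_mem hQ') b h4 h5 hs
    rw [h4, h3] at this
    exact interior_mono (Set.union_subset (Set.subset_sUnion_of_mem hQ')
      (Set.subset_sUnion_of_mem hQ)) this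
  · rcases eq_or_lt_of_le m.1.2 with h4 | h4
    · simp only at h4
      obtain ⟨Q', hQ', h5, h6⟩ := h.exists_succ hQ hs (x₁ := xr) (by linarith) (by linarith)
        fun x' hx' => hvis x' ⟨by linarith [hx'.1], hx'.2⟩
      have := mem_interior_union b (h.isBox_of_mem hQ') h5 hs h6
      rw [← h4] at this
      exact interior_mono (Set.union_subset (Set.subset_sUnion_of_mem hQ)
        (Set.subset_sUnion_of_mem hQ')) this
    · refine interior_mono (Set.subset_sUnion_of_mem hQ) ?_
      rw [b.interior_eq]
      exact ⟨⟨h3, h4⟩, hs⟩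

/-- Only `A j` and `A (j + 1)` come near the corner. Points slightly to the left of it and above it
are above the first and left of the second. -/
theorem corner_notMem_interior :
    ((xhi (A j), yhi (A j)) : Pt) ∉ interior (⋃₀ X) := by
  intro hc
  obtain ⟨U, hU, hU'⟩ := exists_nhds_common h.finite_X (fun R hR => h.isClosed_of_mem hR)
    ((xhi (A j), yhi (A j)) : Pt)
  have hcont : ContinuousAt (fun t : ℝ => ((xhi (A j) - t, yhi (A j) + t) : Pt)) 0 := by fun_prop
  have hN : U ∩ interior (⋃₀ X) ∈ nhds ((fun t : ℝ => ((xhi (A j) - t, yhi (A j) + t) : Pt)) 0) := by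
    simp only [sub_zero, add_zero]
    exact Filter.inter_mem hU (isOpen_interior.mem_nhds hc)
  obtain ⟨l, hl, hlU⟩ := exists_Ico_subset_of_mem_nhds (hcont hN) ⟨1, one_pos⟩
  have hl2 : l / 2 ∈ Set.Ico 0 l := ⟨by linarith, by linarith⟩
  obtain ⟨h1, h2⟩ := hlU hl2
  obtain ⟨Q, hQ, hm⟩ := interior_subset h2
  have m := (h.isBox_of_mem hQ).mem_iff.1 hm
  simp only at m
  rcases h.eq_of_corner_mem (h.subset hQ) (hU' _ h1 Q hQ hm) with rfl | rfl
  · linarith [m.2.2]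
  · have := h.right j h.lt
    linarith [m.1.1]

/-- The window runs from the corner of `A j` to the right end of the row cell that reaches furthest;
its extension to the left hits the first door. -/
theorem exists_closedBackbone :
    ∃ q, IsClosedBackbone (⋃₀ X) (A 0 ∩ A 1) (A n ∩ A (n + 1)) q := by
  have hk := h.le
  have hjk := h.lt
  have hone := h.one_le
  obtain ⟨Q, hQ, hmax⟩ := Set.exists_max_image _ xhi h.finite_row
    ⟨_, h.mem_row (i := j + 1) (by omega) (by omega)⟩
  have bQ := h.isBox_of_mem hQ.1
  have bQ1 := bQ.1
  have hQu := hQ.2.1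
  have hvis := hQ.2.2.2.2
  have hlt : xhi (A j) < xhi Q := by linarith
  have hx0 : xhi (A 0) ≤ xhi (A j) := h.xhi_le (Nat.zero_le j) hjk.le
  have hvis' : ∀ x ∈ Set.Icc (xhi (A 0)) (xhi Q), ((x, yhi (A j)) : Pt) ∈ ⋃₀ X := by
    intro x hx
    rcases le_total x (xhi (A j)) with h1 | h1
    · refine h.visible (i := j + 1) (by omega) (by omega) x ⟨hx.1, h1.trans ?_⟩
      exact h.xhi_le (Nat.le_succ j) hjk
    · exact hvis x ⟨h1, hx.2⟩
  have hseg : ∀ x ∈ Set.Icc (xhi (A j)) (xhi Q),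
      segment ℝ ((x, yhi (A j)) : Pt) (xhi (A 0), yhi (A j)) ⊆ ⋃₀ X := by
    intro x hx z hz
    obtain ⟨h1, h2⟩ := (mem_segment_horiz (by rfl)).1 hz
    rw [Set.uIcc_of_ge (hx0.trans hx.1)] at h2
    have := hvis' z.1 ⟨h2.1, h2.2.trans hx.2⟩
    rwa [← (show z.2 = yhi (A j) from h1)] at this
  have hq : ((xhi (A 0), yhi (A j)) : Pt) ∈ A 0 ∩ A 1 := by
    have b0 := h.box (i := 0) (by omega)
    have b1 := h.box (i := 1) (by omega)
    have h01 := h.right 0 (by omega)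
    refine ⟨b0.mem_iff.2 ⟨⟨b0.1.le, le_rfl⟩, h.mem 0 (by omega)⟩,
      b1.mem_iff.2 ⟨⟨h01.ge, ?_⟩, h.mem 1 (by omega)⟩⟩
    have := b1.1
    simp only at h01 ⊢
    linarith
  have hwmem : ∀ z ∈ segment ℝ ((xhi (A j), yhi (A j)) : Pt) (xhi Q, yhi (A j)),
      z.2 = yhi (A j) ∧ z.1 ∈ Set.Icc (xhi (A j)) (xhi Q) := by
    intro z hz
    obtain ⟨h1, h2⟩ := (mem_segment_horiz (by rfl)).1 hz
    rw [Set.uIcc_of_le hlt.le] at h2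
    exact ⟨h1, h2⟩
  refine ⟨(xhi (A 0), yhi (A j)), hq,
    segment ℝ ((xhi (A j), yhi (A j)) : Pt) (xhi Q, yhi (A j)), ?_,
    h.separates hmax, ?_⟩
  · refine ⟨_, _, ?_, rfl, ?_, ?_, h.corner_notMem_interior, ?_⟩
    · intro hc
      exact hlt.ne (congrArg Prod.fst hc)
    · intro z hz
      obtain ⟨hz2, hz1⟩ := hwmem z hz
      have hzeq : z = (z.1, yhi (A j)) := Prod.ext rfl hz2
      refine ⟨subset_closure ⟨_, hq, hz2.symm, ?_⟩, ?_⟩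
      · have := hseg z.1 hz1
        rwa [← hzeq] at this
      · intro h_int
        -- points slightly above the window do not see the door
        have hcont : ContinuousAt (fun y : ℝ => ((z.1, y) : Pt)) (yhi (A j)) := by fun_prop
        obtain ⟨l, hl, hlU⟩ := exists_Ico_subset_of_mem_nhds
          (hcont (mem_interior_iff_mem_nhds.1 (hzeq ▸ h_int))) ⟨yhi (A j) + 1, by linarith⟩
        have hfin : {y | ∃ R ∈ X, y = ylo R ∧ yhi (A j) < y}.Finite :=
          (h.finite_X.image ylo).subset (by
            rintro y ⟨R, hR, rfl, -⟩
            exact ⟨R, hR, rfl⟩)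
        -- A height above the window but below every cell bottom that is higher than the window, so
        -- that no cell begins in between.
        obtain ⟨y, hy1, hy2, hy3⟩ : ∃ y, yhi (A j) < y ∧ y < l ∧
            ∀ R ∈ X, ylo R ≤ y → ylo R ≤ yhi (A j) := by
          rcases Set.eq_empty_or_nonempty {y | ∃ R ∈ X, y = ylo R ∧ yhi (A j) < y} with he | hne
          · obtain ⟨y, h1, h2⟩ := exists_between hl
            refine ⟨y, h1, h2, fun R hR _ => ?_⟩
            by_contra! hc
            have : ylo R ∈ {y | ∃ R ∈ X, y = ylo R ∧ yhi (A j) < y} := ⟨R, hR, rfl, hc⟩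
            rw [he] at this
            exact this
          · obtain ⟨m, ⟨R₀, hR₀, rfl, hm⟩, hmin⟩ := Set.exists_min_image _ id hfin hne
            obtain ⟨y, h1, h2⟩ := exists_between (lt_min hl hm)
            rw [lt_min_iff] at h2
            refine ⟨y, h1, h2.1, fun R hR hRy => ?_⟩
            by_contra! hc
            have := hmin (ylo R) ⟨R, hR, rfl, hc⟩
            simp only [id] at this
            linarith [h2.2]
        obtain ⟨q', ⟨hq0, hq1⟩, hq2, hqs⟩ := hlU ⟨hy1.le, hy2⟩
        have b0 := h.box (i := 0) (by omega)
        simp only at hq2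
        rcases Nat.eq_zero_or_pos j with hj | hj
        -- For `j = 0` the door itself does not reach above the top of `A 0`.
        · have := (b0.mem_iff.1 hq0).2.2
          rw [hj] at hy1
          linarith
        · have hqx : q'.1 = xhi (A 0) := h.sys.fst_eq (h.mem_F 0 (by omega)) (h.mem_F 1 (by omega))
            (h.ne (by omega) (by omega) (by omega)) ⟨hq0, hq1⟩ hq
          have hx01 : xhi (A 0) < xhi (A j) := by
            rw [h.right 0 (by omega)]
            exact h.xlo_lt hj
          -- The line of sight passes just left of the vertical through the corner. A cell there
          -- would also contain the corner, but `A j` is too low and `A (j + 1)` too far to the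
          -- right.
          obtain ⟨U, hU, hU'⟩ := exists_nhds_common h.finite_X (fun R hR => h.isClosed_of_mem hR)
            ((xhi (A j), y) : Pt)
          have hc2 : ContinuousAt (fun x : ℝ => ((x, y) : Pt)) (xhi (A j)) := by fun_prop
          obtain ⟨l', hl', hlU'⟩ := exists_Ioc_subset_of_mem_nhds (hc2 hU) ⟨xhi (A 0), hx01⟩
          obtain ⟨x, hx1, hx2⟩ := exists_between (max_lt hl' hx01)
          rw [max_lt_iff] at hx1
          have hxC : ((x, y) : Pt) ∈ ⋃₀ X := by
            refine hqs ((mem_segment_horiz (by exact hq2.symm)).2 ⟨rfl, ?_⟩)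
            rw [hqx]
            exact Set.mem_uIcc.2 (Or.inr ⟨hx1.2.le, hx2.le.trans hz1.1⟩)
          obtain ⟨R, hR, hxR⟩ := hxC
          have bR := h.isBox_of_mem hR
          have m1 := bR.mem_iff.1 hxR
          have m2 := bR.mem_iff.1 (hU' _ (hlU' ⟨hx1.1, hx2.le⟩) R hR hxR)
          simp only at m1 m2
          rcases h.eq_of_corner_mem (h.subset hR) (bR.mem_iff.2
            ⟨m2.1, hy3 R hR m1.2.1, hy1.le.trans m1.2.2⟩) with rfl | rfl
          · linarith [m1.2.2]
          · have := h.right j hjk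
            linarith [m1.1.1]
    · intro z hz
      have hzs := hwmem z (openSegment_subset_segment _ _ _ hz)
      have hz1 : z.1 ∈ Set.Ioo (xhi (A j)) (xhi Q) := by
        refine ⟨lt_of_le_of_ne hzs.2.1 fun hc => ?_, lt_of_le_of_ne hzs.2.2 fun hc => ?_⟩
        · have hzl : z = (xhi (A j), yhi (A j)) := Prod.ext hc.symm hzs.1
          rw [hzl, left_mem_openSegment_iff] at hz
          exact hlt.ne (congrArg Prod.fst hz)
        · have hzl : z = (xhi Q, yhi (A j)) := Prod.ext hc hzs.1
          rw [hzl, right_mem_openSegment_iff] at hz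
          exact hlt.ne (congrArg Prod.fst hz)
      have := h.mem_interior hz1.1 hz1.2 hvis
      rwa [← hzs.1] at this
    -- Were the right end interior, the row would go on to a further cell.
    · intro hc
      have hcont : ContinuousAt (fun x : ℝ => ((x, yhi (A j)) : Pt)) (xhi Q) := by fun_prop
      obtain ⟨l, hl, hlU⟩ := exists_Ico_subset_of_mem_nhds
        (hcont (mem_interior_iff_mem_nhds.1 hc)) ⟨xhi Q + 1, by linarith⟩
      obtain ⟨x₁, hx1, hx2⟩ := exists_between hl
      obtain ⟨Q', hQ', h5, h6, h7⟩ := h.exists_succ hQ.1 ⟨hQ.2.2.1, hQ.2.2.2.1⟩ hx1 hlt.le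
        fun x hx => hlU ⟨hx.1.le, hx.2.trans_lt hx2⟩
      have bQ' := h.isBox_of_mem hQ'
      have hrow : Q' ∈ row X (xhi (A j)) (yhi (A j)) := by
        refine ⟨hQ', by linarith, h6, h7, ?_⟩
        intro x hx
        rcases le_total x (xhi Q) with h8 | h8
        · exact hvis x ⟨hx.1, h8⟩
        · exact ⟨Q', hQ', bQ'.mem_iff.2 ⟨⟨h5 ▸ h8, hx.2⟩, h6.le, h7.le⟩⟩
      have := hmax Q' hrow
      have := bQ'.1
      linarith
  · intro z hz
    obtain ⟨hz2, hz1⟩ := hwmem z hz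
    refine ⟨hz2, ?_⟩
    have hzeq : z = (z.1, yhi (A j)) := Prod.ext rfl hz2
    rw [hzeq]
    exact hseg z.1 hz1

end WindowChain


/-! Reflections, and the backbone points of a closed corridor. -/

section Symmetry

variable {σ : Pt ≃L[ℝ] Pt}

theorem image_segment_equiv (σ : Pt ≃L[ℝ] Pt) (a b : Pt) :
    σ '' segment ℝ a b = segment ℝ (σ a) (σ b) :=
  image_segment ℝ (σ : Pt →ₗ[ℝ] Pt).toAffineMap a b

theorem image_openSegment_equiv (σ : Pt ≃L[ℝ] Pt) (a b : Pt) :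
    σ '' openSegment ℝ a b = openSegment ℝ (σ a) (σ b) :=
  image_openSegment ℝ (σ : Pt →ₗ[ℝ] Pt).toAffineMap a b

/-- Only equality of heights has to be preserved, so the same statement serves both reflections. -/
theorem image_maximalHistogram (hσ : ∀ p q : Pt, (σ p).2 = (σ q).2 ↔ p.2 = q.2) (C d : Set Pt) :
    σ '' maximalHistogram C d = maximalHistogram (σ '' C) (σ '' d) := by
  ext z
  constructor
  · rintro ⟨p, ⟨q, hq, h1, h2⟩, rfl⟩
    refine ⟨σ q, ⟨q, hq, rfl⟩, (hσ _ _).2 h1, ?_⟩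
    rw [← image_segment_equiv]
    exact Set.image_mono h2
  · rintro ⟨_, ⟨q, hq, rfl⟩, h1, h2⟩
    obtain ⟨p, rfl⟩ := σ.surjective z
    rw [← image_segment_equiv, Set.image_subset_image_iff σ.injective] at h2
    exact ⟨p, ⟨q, hq, (hσ _ _).1 h1, h2⟩, rfl⟩

theorem IsClosedBackbone.image (hσ : ∀ p q : Pt, (σ p).2 = (σ q).2 ↔ p.2 = q.2) {C d d' : Set Pt}
    {q : Pt} (h : IsClosedBackbone C d d' q) :
    IsClosedBackbone (σ '' C) (σ '' d) (σ '' d') (σ q) := by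
  obtain ⟨hq, w, ⟨a, b, hab, rfl, hw, ho, ha, hb⟩, hsep, hp⟩ := h
  have h_int : interior (σ '' C) = σ '' interior C := (σ.toHomeomorph.image_interior C).symm
  refine ⟨⟨q, hq, rfl⟩, σ '' segment ℝ a b, ⟨σ a, σ b, σ.injective.ne hab, image_segment_equiv _ _ _,
    ?_, ?_, ?_, ?_⟩, ?_, ?_⟩
  · rw [← image_maximalHistogram hσ]
    have := σ.toHomeomorph.image_frontier (maximalHistogram C d)
    exact (Set.image_mono hw).trans this.le
  · rw [h_int, ← image_openSegment_equiv]
    exact Set.image_mono ho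
  · rwa [h_int, σ.injective.mem_set_image]
  · rwa [h_int, σ.injective.mem_set_image]
  · intro S hS hc h1 h2
    obtain ⟨T, rfl⟩ : ∃ T, S = σ '' T := ⟨_, (Set.image_preimage_eq S σ.surjective).symm⟩
    rw [Set.image_subset_image_iff σ.injective] at hS
    rw [← Set.image_inter σ.injective, Set.image_nonempty] at h1 h2 ⊢
    exact hsep T hS ((σ.toHomeomorph.isPreconnected_image).1 hc) h1 h2
  · rintro _ ⟨p, hpw, rfl⟩
    refine ⟨(hσ _ _).2 (hp p hpw).1, ?_⟩
    rw [← image_segment_equiv]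
    exact Set.image_mono (hp p hpw).2

theorem TreeLike.image (hσ : ∀ p, σ (σ p) = p) {X : Set (Set Pt)} (h : TreeLike X) :
    TreeLike (Set.image σ '' X) := by
  have hinv : ∀ A : Set Pt, σ '' (σ '' A) = A := fun A => by
    rw [← Set.image_comp, show σ ∘ σ = id from funext hσ, Set.image_id]
  rintro _ ⟨A, hA, rfl⟩ _ ⟨B, hB, rfl⟩ hne h_int hr
  rw [← Set.image_inter σ.injective, Set.image_nonempty] at h_int
  refine h A hA B hB (fun hc => hne (by rw [hc])) h_int ?_
  have := Relation.ReflTransGen.lift (Set.image σ)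
    (p := fun C D => C ∈ X ∧ D ∈ X ∧ (C ∩ D).Nonempty ∧ ¬ (C = A ∧ D = B) ∧ ¬ (C = B ∧ D = A))
    ?_ _ _ hr
  · simpa only [Function.onFun, hinv] using this
  · rintro _ _ ⟨⟨C, hC, rfl⟩, ⟨D, hD, rfl⟩, h1, h2, h3⟩
    rw [← Set.image_inter σ.injective, Set.image_nonempty] at h1
    simp only [Function.onFun, hinv]
    refine ⟨hC, hD, h1, ?_, ?_⟩
    · rintro ⟨rfl, rfl⟩
      exact h2 ⟨rfl, rfl⟩
    · rintro ⟨rfl, rfl⟩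
      exact h3 ⟨rfl, rfl⟩

theorem BoxChain.image (hσ : ∀ p, σ (σ p) = p) {F X : Set (Set Pt)} {n : ℕ} {A : ℕ → Set Pt}
    (h : BoxChain F X n A) (hF : CellSystem (Set.image σ '' F)) :
    BoxChain (Set.image σ '' F) (Set.image σ '' X) n (fun i => σ '' A i) where
  sys := hF
  one_le := h.one_le
  inj i hi j hj hij := h.inj i hi j hj (σ.injective.image_injective hij)
  mem_F i hi := ⟨_, h.mem_F i hi, rfl⟩
  touch i hi := by
    rw [← Set.image_inter σ.injective, Set.image_nonempty]
    exact h.touch i hi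
  subset := Set.image_mono h.subset
  mem_X i h1 h2 := ⟨_, h.mem_X i h1 h2, rfl⟩
  tree := h.tree.image hσ

theorem BoxChain.exists_closedBackbone_of_image (hσ : ∀ p, σ (σ p) = p)
    (hσ2 : ∀ p q : Pt, (σ p).2 = (σ q).2 ↔ p.2 = q.2) {X : Set (Set Pt)}
    {n : ℕ} {A : ℕ → Set Pt}
    (h : ∃ q, IsClosedBackbone (⋃₀ (Set.image σ '' X)) (σ '' A 0 ∩ σ '' A 1)
      (σ '' A n ∩ σ '' A (n + 1)) q) :
    ∃ q, IsClosedBackbone (⋃₀ X) (A 0 ∩ A 1) (A n ∩ A (n + 1)) q := by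
  have hinv : ∀ A : Set Pt, σ '' (σ '' A) = A := fun A => by
    rw [← Set.image_comp, show σ ∘ σ = id from funext hσ, Set.image_id]
  obtain ⟨q, hq⟩ := h
  refine ⟨σ q, ?_⟩
  have := hq.image hσ2
  rwa [← Set.image_sUnion, ← Set.image_inter σ.injective, ← Set.image_inter σ.injective, hinv, hinv,
    hinv] at this

end Symmetry

/-- The reflection in the vertical axis. -/
noncomputable def flipX : Pt ≃L[ℝ] Pt :=
  (ContinuousLinearEquiv.neg ℝ).prodCongr (ContinuousLinearEquiv.refl ℝ ℝ)

/-- The reflection in the horizontal axis. -/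
noncomputable def flipY : Pt ≃L[ℝ] Pt :=
  (ContinuousLinearEquiv.refl ℝ ℝ).prodCongr (ContinuousLinearEquiv.neg ℝ)

theorem flipX_apply (p : Pt) : flipX p = (-p.1, p.2) := rfl

theorem flipY_apply (p : Pt) : flipY p = (p.1, -p.2) := rfl

theorem IsBox.image_flipX {A : Set Pt} (h : IsBox A) : IsBox (flipX '' A) ∧
    xlo (flipX '' A) = -xhi A ∧ xhi (flipX '' A) = -xlo A ∧ ylo (flipX '' A) = ylo A ∧
      yhi (flipX '' A) = yhi A := by
  have : flipX '' A = Set.Icc (-xhi A) (-xlo A) ×ˢ Set.Icc (ylo A) (yhi A) := by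
    ext z
    constructor
    · rintro ⟨p, hp, rfl⟩
      rw [h.mem_iff] at hp
      exact ⟨⟨neg_le_neg hp.1.2, neg_le_neg hp.1.1⟩, hp.2⟩
    · intro hz
      refine ⟨(-z.1, z.2), h.mem_iff.2 ⟨⟨le_neg.1 hz.1.2, neg_le.1 hz.1.1⟩, hz.2⟩, ?_⟩
      simp [flipX_apply]
  rw [this]
  exact ⟨isBox_prod (neg_lt_neg h.1) h.2.1, box_coords (neg_le_neg h.1.le) h.2.1.le⟩

theorem IsBox.image_flipY {A : Set Pt} (h : IsBox A) : IsBox (flipY '' A) ∧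
    xlo (flipY '' A) = xlo A ∧ xhi (flipY '' A) = xhi A ∧ ylo (flipY '' A) = -yhi A ∧
      yhi (flipY '' A) = -ylo A := by
  have : flipY '' A = Set.Icc (xlo A) (xhi A) ×ˢ Set.Icc (-yhi A) (-ylo A) := by
    ext z
    constructor
    · rintro ⟨p, hp, rfl⟩
      rw [h.mem_iff] at hp
      exact ⟨hp.1, ⟨neg_le_neg hp.2.2, neg_le_neg hp.2.1⟩⟩
    · intro hz
      refine ⟨(z.1, -z.2), h.mem_iff.2 ⟨hz.1, ⟨le_neg.1 hz.2.2, neg_le.1 hz.2.1⟩⟩, ?_⟩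
      simp [flipY_apply]
  rw [this]
  exact ⟨isBox_prod h.1 (neg_lt_neg h.2.1), box_coords h.1.le (neg_le_neg h.2.1.le)⟩

theorem CellSystem.image_flipX {F : Set (Set Pt)} (h : CellSystem F) :
    CellSystem (Set.image flipX '' F) where
  finite := h.finite.image _
  box := by
    rintro _ ⟨A, hA, rfl⟩
    exact (h.box A hA).image_flipX.1
  touch := by
    rintro _ ⟨A, hA, rfl⟩ _ ⟨B, hB, rfl⟩ hne h_int
    rw [← Set.image_inter flipX.injective, Set.image_nonempty] at h_int
    obtain ⟨h1, h2⟩ := h.touch A hA B hB (fun hc => hne (by rw [hc])) h_int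
    obtain ⟨-, a1, a2, a3, a4⟩ := (h.box A hA).image_flipX
    obtain ⟨-, b1, b2, b3, b4⟩ := (h.box B hB).image_flipX
    rw [a1, a2, a3, a4, b1, b2, b3, b4, neg_inj, neg_inj]
    exact ⟨h1.symm.imp Eq.symm Eq.symm, h2⟩
  horiz := by
    rintro _ ⟨A, hA, rfl⟩ _ ⟨B, hB, rfl⟩ _ ⟨R, hR, rfl⟩
    obtain ⟨-, a1, a2, a3, a4⟩ := (h.box A hA).image_flipX
    obtain ⟨-, b1, b2, b3, b4⟩ := (h.box B hB).image_flipX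
    obtain ⟨-, r1, r2, r3, r4⟩ := (h.box R hR).image_flipX
    rw [a1, a2, a3, a4, b1, b2, b3, b4, r1, r2, r3, r4]
    intro y hy1 hy2 hy3 hy4 x hx a ha b hb hax hxb
    -- The reflection reverses left and right, so the two outer cells change roles.
    exact h.horiz B hB A hA R hR y hy2 hy1 hy3 hy4 (-x) ⟨lt_neg.1 hx.2, neg_lt.1 hx.1⟩ (-b)
      ⟨le_neg.1 hb.2, neg_le.1 hb.1⟩ (-a) ⟨le_neg.1 ha.2, neg_le.1 ha.1⟩ (neg_le_neg hxb)
      (neg_le_neg hax)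

theorem CellSystem.image_flipY {F : Set (Set Pt)} (h : CellSystem F) :
    CellSystem (Set.image flipY '' F) where
  finite := h.finite.image _
  box := by
    rintro _ ⟨A, hA, rfl⟩
    exact (h.box A hA).image_flipY.1
  touch := by
    rintro _ ⟨A, hA, rfl⟩ _ ⟨B, hB, rfl⟩ hne h_int
    rw [← Set.image_inter flipY.injective, Set.image_nonempty] at h_int
    obtain ⟨h1, h2⟩ := h.touch A hA B hB (fun hc => hne (by rw [hc])) h_int
    obtain ⟨-, a1, a2, a3, a4⟩ := (h.box A hA).image_flipY
    obtain ⟨-, b1, b2, b3, b4⟩ := (h.box B hB).image_flipY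
    rw [a1, a2, a3, a4, b1, b2, b3, b4, max_neg_neg, min_neg_neg, neg_lt_neg_iff]
    exact ⟨h1, h2⟩
  horiz := by
    rintro _ ⟨A, hA, rfl⟩ _ ⟨B, hB, rfl⟩ _ ⟨R, hR, rfl⟩
    obtain ⟨-, a1, a2, a3, a4⟩ := (h.box A hA).image_flipY
    obtain ⟨-, b1, b2, b3, b4⟩ := (h.box B hB).image_flipY
    obtain ⟨-, r1, r2, r3, r4⟩ := (h.box R hR).image_flipY
    rw [a1, a2, a3, a4, b1, b2, b3, b4, r1, r2, r3, r4]
    intro y hy1 hy2 hy3 hy4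
    exact h.horiz A hA B hB R hR (-y) (hy1.symm.imp neg_eq_iff_eq_neg.2 neg_eq_iff_eq_neg.2)
      (hy2.symm.imp neg_eq_iff_eq_neg.2 neg_eq_iff_eq_neg.2) (lt_neg.1 hy4) (neg_lt.1 hy3)

/-! ### Backbone points on the doors of a closed corridor. -/

namespace BoxChain

variable {F X : Set (Set Pt)} {n : ℕ} {A : ℕ → Set Pt} (h : BoxChain F X n A)
include h

/-- All cells before `A m` contain the height of the lowest top, so the chain cannot turn back among
them: three cells would share a point of that height. It thus runs to the right and yields a
`WindowChain`. -/
theorem exists_closedBackbone_of_right_up (hx : xhi (A 0) = xlo (A 1)) {m j : ℕ} (hm : m ≤ n + 1)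
    (hj : j < m) (hc : ∀ i < m, ylo (A i) ≤ yhi (A j) ∧ yhi (A j) ≤ yhi (A i))
    (hu : yhi (A j) < ylo (A m)) :
    ∃ q, IsClosedBackbone (⋃₀ X) (A 0 ∩ A 1) (A n ∩ A (n + 1)) q := by
  obtain ⟨k, rfl⟩ : ∃ k, m = k + 1 := ⟨m - 1, by omega⟩
  have hk : yhi (A j) < yhi (A k) := by
    obtain ⟨z, hz1, hz2⟩ := h.touch k (by omega)
    have h1 := ((h.box (by omega)).mem_iff.1 hz1).2.2
    have h2 := ((h.box hm).mem_iff.1 hz2).2.1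
    linarith
  have hright : ∀ i < k, xhi (A i) = xlo (A (i + 1)) := by
    intro i
    induction i with
    | zero => exact fun _ => hx
    | succ i ih =>
      intro hi
      have hi' := ih (by omega)
      refine (h.sys.touch _ (h.mem_F (i + 1) (by omega)) _ (h.mem_F (i + 1 + 1) (by omega))
        (h.ne (by omega) (by omega) (by omega)) (h.touch _ (by omega))).1.resolve_right fun h1 => ?_
      have b0 := h.box (i := i) (by omega)
      have b1 := h.box (i := i + 1) (by omega)
      have b2 := h.box (i := i + 1 + 1) (by omega)
      refine h.sys.not_three (h.mem_F i (by omega)) (h.mem_F (i + 1) (by omega))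
        (h.mem_F (i + 1 + 1) (by omega)) (h.ne (by omega) (by omega) (by omega))
        (h.ne (by omega) (by omega) (by omega)) (h.ne (by omega) (by omega) (by omega))
        (z := (xlo (A (i + 1)), yhi (A j))) (b0.mem_iff.2 ⟨⟨?_, hi'.ge⟩, hc i (by omega)⟩)
        (b1.mem_iff.2 ⟨⟨le_rfl, b1.1.le⟩, hc _ (by omega)⟩)
        (b2.mem_iff.2 ⟨⟨?_, h1.ge⟩, hc _ (by omega)⟩)
      · exact hi' ▸ b0.1.le
      · exact h1 ▸ b2.1.le
  classical
  -- Several cells may have this top height; taking the last one makes all later tops up to `A k`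
  -- strictly higher.
  have hex : j ∈ (Finset.range (k + 1)).filter fun i => yhi (A i) = yhi (A j) := by
    simp [hj]
  obtain ⟨l, hl, hlmax⟩ := Finset.exists_max_image _ (fun i : ℕ => i) ⟨j, hex⟩
  simp only [Finset.mem_filter, Finset.mem_range] at hl hlmax
  refine WindowChain.exists_closedBackbone (F := F) (j := l) (k := k) ⟨h, ?_, by omega, hright, ?_, ?_, ?_⟩
  · refine lt_of_le_of_ne (by omega) fun hc' => ?_
    rw [hc'] at hl
    linarith
  · intro i hi
    rw [hl.2]
    exact hc i (by omega)
  · intro i h1 h2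
    rw [hl.2]
    refine lt_of_le_of_ne (hc i (by omega)).2 fun h3 => ?_
    have := hlmax i ⟨by omega, h3.symm⟩
    omega
  · rw [hl.2]
    exact hu

theorem exists_closedBackbone_of_up {m j : ℕ} (hm : m ≤ n + 1)
    (hj : j < m) (hc : ∀ i < m, ylo (A i) ≤ yhi (A j) ∧ yhi (A j) ≤ yhi (A i))
    (hu : yhi (A j) < ylo (A m)) :
    ∃ q, IsClosedBackbone (⋃₀ X) (A 0 ∩ A 1) (A n ∩ A (n + 1)) q := by
  rcases (h.sys.touch _ (h.mem_F 0 (by omega)) _ (h.mem_F 1 (by omega))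
    (h.ne (by omega) (by omega) (by omega)) (h.touch 0 (by omega))).1 with hx | hx
  · exact h.exists_closedBackbone_of_right_up hx hm hj hc hu
  · have hσ : ∀ p, flipX (flipX p) = p := fun p => by simp [flipX_apply]
    have himg := fun i (hi : i ≤ n + 1) => (h.box hi).image_flipX.2
    refine exists_closedBackbone_of_image hσ (fun _ _ => Iff.rfl)
      ((h.image hσ h.sys.image_flipX).exists_closedBackbone_of_right_up ?_ hm hj ?_ ?_)
    · rw [(himg 0 (by omega)).2.1, (himg 1 (by omega)).1, hx]
    · intro i hi
      rw [(himg i (by omega)).2.2.1, (himg i (by omega)).2.2.2, (himg j (by omega)).2.2.2]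
      exact hc i hi
    · rw [(himg m hm).2.2.1, (himg j (by omega)).2.2.2]
      exact hu

/-- A corridor without horizontal crossing has a backbone point on its first door. -/
theorem exists_closedBackbone
    (hc : ¬ IsOpenCorridor (⋃₀ X) (A 0 ∩ A 1) (A n ∩ A (n + 1))) :
    ∃ q, IsClosedBackbone (⋃₀ X) (A 0 ∩ A 1) (A n ∩ A (n + 1)) q := by
  classical
  -- The first cell at which the common height is lost lies entirely above the lowest top, or
  -- entirely below the highest bottom, of the cells before it.
  have hex : ∃ m, m ≤ n + 1 ∧ ¬ ∃ y, ∀ i ≤ m, ylo (A i) ≤ y ∧ y ≤ yhi (A i) := by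
    refine ⟨n + 1, le_rfl, ?_⟩
    rintro ⟨y, hy⟩
    exact hc ⟨y, h.mem_crossingHeights_iff.2 hy⟩
  obtain ⟨hm, hno⟩ := Nat.find_spec hex
  set m := Nat.find hex with hmdef
  have hm0 : 0 < m := by
    refine Nat.pos_of_ne_zero fun h0 => hno ⟨ylo (A 0), fun i hi => ?_⟩
    obtain rfl : i = 0 := by omega
    exact ⟨le_rfl, (h.box (by omega)).2.1.le⟩
  have hprev : ∃ y, ∀ i < m, ylo (A i) ≤ y ∧ y ≤ yhi (A i) := by
    have := Nat.find_min hex (m := m - 1) (by omega)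
    push Not at this
    obtain ⟨y, hy⟩ := this (by omega)
    exact ⟨y, fun i hi => hy i (by omega)⟩
  obtain ⟨y, hy⟩ := hprev
  obtain ⟨j, hj, hjmin⟩ := Finset.exists_min_image (Finset.range m) (fun i => yhi (A i))
    ⟨0, by simpa using hm0⟩
  obtain ⟨l, hl, hlmax⟩ := Finset.exists_max_image (Finset.range m) (fun i => ylo (A i))
    ⟨0, by simpa using hm0⟩
  simp only [Finset.mem_range] at hj hjmin hl hlmax
  by_cases h1 : yhi (A j) < ylo (A m)
  · exact h.exists_closedBackbone_of_up hm hj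
      (fun i hi => ⟨(hy i hi).1.trans (hy j hj).2, hjmin i hi⟩) h1
  by_cases h2 : yhi (A m) < ylo (A l)
  · have hσ : ∀ p, flipY (flipY p) = p := fun p => by simp [flipY_apply]
    have himg := fun i (hi : i ≤ n + 1) => (h.box hi).image_flipY.2
    refine exists_closedBackbone_of_image hσ (fun p q => by simp [flipY_apply])
      ((h.image hσ h.sys.image_flipY).exists_closedBackbone_of_up hm hl ?_ ?_)
    · intro i hi
      rw [(himg i (by omega)).2.2.1, (himg i (by omega)).2.2.2, (himg l (by omega)).2.2.2,
        neg_le_neg_iff, neg_le_neg_iff]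
      exact ⟨(hy l hl).1.trans (hy i hi).2, hlmax i hi⟩
    · rw [(himg m hm).2.2.1, (himg l (by omega)).2.2.2]
      exact neg_lt_neg h2
  push Not at h1 h2
  -- In the remaining case the highest of all bottoms is a common height.
  refine (hno ⟨max (ylo (A l)) (ylo (A m)), fun i hi => ?_⟩).elim
  rcases eq_or_lt_of_le hi with rfl | hi
  · exact ⟨le_max_right _ _, max_le h2 (h.box hm).2.1.le⟩
  · exact ⟨(hlmax i hi).trans (le_max_left _ _),
      (max_le ((hy l hl).1.trans (hy j hj).2) h1).trans (hjmin i hi)⟩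

end BoxChain


/-! Finiteness of the set of backbone points, and existence of cut-line trees. -/

/-- The heights of the horizontal sides of the cells. -/
def cellHeights (F : Set (Set Pt)) : Set ℝ := Set.image ylo F ∪ Set.image yhi F

/-- The abscissas of the vertical sides of the cells. -/
def cellAbscissas (F : Set (Set Pt)) : Set ℝ := Set.image xlo F ∪ Set.image xhi F

namespace CellSystem

variable {F : Set (Set Pt)} (hF : CellSystem F)
include hF

theorem finite_cellHeights : (cellHeights F).Finite :=
  (hF.finite.image _).union (hF.finite.image _)

theorem finite_cellAbscissas : (cellAbscissas F).Finite :=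
  (hF.finite.image _).union (hF.finite.image _)

theorem mem_of_height {A : Set Pt} (hA : A ∈ F) {x y y' : ℝ}
    (h : Disjoint (Set.uIcc y y') (cellHeights F)) (hp : ((x, y) : Pt) ∈ A) : ((x, y') : Pt) ∈ A := by
  have bA := hF.box A hA
  rw [bA.mem_iff] at hp ⊢
  simp only at hp ⊢
  refine ⟨hp.1, ?_, ?_⟩
  · by_contra! hc
    exact Set.disjoint_left.1 h (Set.mem_uIcc.2 (Or.inr ⟨hc.le, hp.2.1⟩)) (Or.inl ⟨A, hA, rfl⟩)
  · by_contra! hc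
    exact Set.disjoint_left.1 h (Set.mem_uIcc.2 (Or.inl ⟨hp.2.2, hc.le⟩)) (Or.inr ⟨A, hA, rfl⟩)

theorem segment_subset_of_height {X : Set (Set Pt)} (hX : X ⊆ F) {a b y y' : ℝ}
    (h : Disjoint (Set.uIcc y y') (cellHeights F))
    (hs : segment ℝ ((a, y) : Pt) (b, y) ⊆ ⋃₀ X) : segment ℝ ((a, y') : Pt) (b, y') ⊆ ⋃₀ X := by
  intro z hz
  obtain ⟨hz1, hz2⟩ := (mem_segment_horiz (by rfl)).1 hz
  obtain ⟨A, hA, hzA⟩ := hs ((mem_segment_horiz (z := (z.1, y)) (by rfl)).2 ⟨rfl, hz2⟩)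
  refine ⟨A, hA, ?_⟩
  have := hF.mem_of_height (hX hA) h hzA
  rwa [show z = (z.1, y') from Prod.ext rfl hz1]

theorem exists_pos_disjoint {y : ℝ} (hy : y ∉ cellHeights F) :
    ∃ ε > 0, ∀ y', |y' - y| < ε → Disjoint (Set.uIcc y y') (cellHeights F) := by
  obtain ⟨ε, hε, h⟩ := Metric.isOpen_iff.1 hF.finite_cellHeights.isClosed.isOpen_compl y hy
  refine ⟨ε, hε, fun y' hy' => Set.disjoint_left.2 fun z hz => h ?_⟩
  rw [Metric.mem_ball, Real.dist_eq]
  refine lt_of_le_of_lt ?_ hy'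
  exact Set.abs_sub_left_of_mem_uIcc hz

end CellSystem

/-! ### Backbone points have the coordinates of cell sides. -/

namespace RectilinearDomain

variable {h : ℕ} {P : RectilinearDomain h}

theorem isCell_of_mem_regionCells {J : Set (Set Pt)} {R₀ R : Set Pt} (h₀ : P.IsCell R₀)
    (h₁ : R₀ ∉ J) (hR : R ∈ P.regionCells J R₀) : P.IsCell R ∧ R ∉ J := by
  rcases Relation.ReflTransGen.cases_tail hR with rfl | ⟨_, _, hc⟩
  · exact ⟨h₀, h₁⟩
  · exact hc.2

/-- The doors of a corridor are common sides of two cells. -/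
theorem IsCorridor.exists_door {J : Set (Set Pt)} (hJ : ∀ R ∈ J, P.IsCell R) {C d₁ d₂ : Set Pt}
    (hC : P.IsCorridor J C d₁ d₂) : ∀ d, d = d₁ ∨ d = d₂ →
      ∃ R R', P.IsCell R ∧ P.IsCell R' ∧ R ≠ R' ∧ d = R ∩ R' := by
  rcases hC with ⟨R₀, h0, h1, rfl, hne, hd⟩ | ⟨R, hR, R', hR', hadj, rfl, rfl, rfl⟩
  · intro d hdd
    have : d ∈ doors J (P.regionCells J R₀) := by
      rw [hd]
      simpa using hdd
    obtain ⟨R, hR, R', hR', hadj, rfl⟩ := this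
    exact ⟨R, R', (isCell_of_mem_regionCells h0 h1 hR).1, hJ R' hR', hadj.1, rfl⟩
  · rintro d (rfl | rfl) <;> exact ⟨R, R', hJ R hR, hJ R' hR', hadj.1, rfl⟩

theorem IsCorridor.segment_subset_of_height (hP : P.GeneralPosition) {J : Set (Set Pt)}
    (hJ : ∀ R ∈ J, P.IsCell R) {C d₁ d₂ : Set Pt} (hC : P.IsCorridor J C d₁ d₂) {a b y y' : ℝ}
    (h : Disjoint (Set.uIcc y y') (cellHeights {R | P.IsCell R}))
    (hs : segment ℝ ((a, y) : Pt) (b, y) ⊆ C) : segment ℝ ((a, y') : Pt) (b, y') ⊆ C := by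
  rcases hC with ⟨R₀, h0, h1, rfl, hne, hd⟩ | ⟨R, hR, R', hR', hadj, rfl, rfl, rfl⟩
  · exact (cellSystem hP).segment_subset_of_height
      (fun R hR => (isCell_of_mem_regionCells h0 h1 hR).1) h hs
  · rw [Set.subset_inter_iff] at hs ⊢
    have key : ∀ A, P.IsCell A → segment ℝ ((a, y) : Pt) (b, y) ⊆ A →
        segment ℝ ((a, y') : Pt) (b, y') ⊆ A := fun A hA hsA => by
      have := (cellSystem hP).segment_subset_of_height (X := {A}) (by simpa using hA) h
        (by simpa using hsA)
      simpa using this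
    exact ⟨key R (hJ R hR) hs.1, key R' (hJ R' hR') hs.2⟩

theorem IsCorridor.mem_door_of_height (hP : P.GeneralPosition) {J : Set (Set Pt)}
    (hJ : ∀ R ∈ J, P.IsCell R) {C d₁ d₂ : Set Pt} (hC : P.IsCorridor J C d₁ d₂) {d : Set Pt}
    (hd : d = d₁ ∨ d = d₂) {x y y' : ℝ}
    (h : Disjoint (Set.uIcc y y') (cellHeights {R | P.IsCell R}))
    (hp : ((x, y) : Pt) ∈ d) : ((x, y') : Pt) ∈ d := by
  obtain ⟨R, R', hR, hR', -, rfl⟩ := hC.exists_door hJ d hd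
  exact ⟨(cellSystem hP).mem_of_height hR h hp.1, (cellSystem hP).mem_of_height hR' h hp.2⟩

theorem IsCorridor.fst_mem (hP : P.GeneralPosition) {J : Set (Set Pt)}
    (hJ : ∀ R ∈ J, P.IsCell R) {C d₁ d₂ : Set Pt} (hC : P.IsCorridor J C d₁ d₂) {d : Set Pt}
    (hd : d = d₁ ∨ d = d₂) {q : Pt} (hq : q ∈ d) : q.1 ∈ cellAbscissas {R | P.IsCell R} := by
  obtain ⟨R, R', hR, hR', hne, rfl⟩ := hC.exists_door hJ d hd
  have h1 := ((cellSystem hP).touch R hR R' hR' hne ⟨q, hq⟩).1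
  obtain ⟨a, b⟩ := hq
  rw [hR.isBox.mem_iff] at a
  rw [hR'.isBox.mem_iff] at b
  rcases h1 with h1 | h1
  · exact Or.inr ⟨R, hR, by linarith⟩
  · exact Or.inl ⟨R, hR, by linarith⟩

theorem IsCorridor.crossingHeights_of_height (hP : P.GeneralPosition) {J : Set (Set Pt)}
    (hJ : ∀ R ∈ J, P.IsCell R) {C d₁ d₂ : Set Pt} (hC : P.IsCorridor J C d₁ d₂) {y y' : ℝ}
    (h : Disjoint (Set.uIcc y y') (cellHeights {R | P.IsCell R}))
    (hy : y ∈ crossingHeights C d₁ d₂) : y' ∈ crossingHeights C d₁ d₂ := by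
  obtain ⟨p₁, hp₁, p₂, hp₂, rfl, h2, hs⟩ := hy
  refine ⟨(p₁.1, y'), hC.mem_door_of_height hP hJ (Or.inl rfl) h hp₁, (p₂.1, y'),
    hC.mem_door_of_height hP hJ (Or.inr rfl) (y := p₁.2) h ?_, rfl, rfl,
    hC.segment_subset_of_height hP hJ (y := p₁.2) h ?_⟩
  · rwa [← h2]
  · rwa [show ((p₂.1, p₁.2) : Pt) = p₂ from Prod.ext rfl h2.symm]

/-- Away from the heights of cell sides a crossing can be moved up and down a little, so its height
is not extreme. -/
theorem IsCorridor.snd_mem_of_isOpenBackbone (hP : P.GeneralPosition) {J : Set (Set Pt)}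
    (hJ : ∀ R ∈ J, P.IsCell R) {C d₁ d₂ : Set Pt} (hC : P.IsCorridor J C d₁ d₂) {q : Pt}
    (hq : IsOpenBackbone C d₁ d₂ q) : q.2 ∈ cellHeights {R | P.IsCell R} := by
  by_contra hc
  obtain ⟨ε, hε, hd⟩ := (cellSystem hP).exists_pos_disjoint hc
  rcases hq.2 with h1 | h1
  · have := h1.2 (hC.crossingHeights_of_height hP hJ (hd (q.2 + ε / 2) (by
      rw [add_sub_cancel_left, abs_of_pos] <;> linarith)) h1.1)
    linarith
  · have := h1.2 (hC.crossingHeights_of_height hP hJ (hd (q.2 - ε / 2) (by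
      rw [sub_sub_cancel_left, abs_neg, abs_of_pos] <;> linarith)) h1.1)
    linarith

/-- Away from the heights of cell sides lines of sight can be moved up and down, so a neighborhood
of the midpoint of the window would belong to the histogram. But the window lies on its frontier. -/
theorem IsCorridor.snd_mem_of_isClosedBackbone (hP : P.GeneralPosition) {J : Set (Set Pt)}
    (hJ : ∀ R ∈ J, P.IsCell R) {C d₁ d₂ : Set Pt} (hC : P.IsCorridor J C d₁ d₂) {q : Pt}
    (hq : IsClosedBackbone C d₁ d₂ q) : q.2 ∈ cellHeights {R | P.IsCell R} := by
  by_contra hc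
  obtain ⟨ε, hε, hd⟩ := (cellSystem hP).exists_pos_disjoint hc
  obtain ⟨hqd, w, ⟨a, b, hab, rfl, hw, ho, -, -⟩, -, hp⟩ := hq
  set p := midpoint ℝ a b
  have hpi : p ∈ interior C := ho (midpoint_mem_openSegment a b)
  have hpw : p ∈ segment ℝ a b := midpoint_mem_segment a b
  obtain ⟨hp2, hps⟩ := hp p hpw
  refine (hw hpw).2 (mem_interior_iff_mem_nhds.2 ?_)
  obtain ⟨δ, hδ, hball⟩ := Metric.mem_nhds_iff.1 (mem_interior_iff_mem_nhds.1 hpi)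
  refine Metric.mem_nhds_iff.2 ⟨min δ ε, lt_min hδ hε, fun p' hp' => ?_⟩
  have hp'δ : p' ∈ Metric.ball p δ := Metric.ball_subset_ball (min_le_left _ _) hp'
  have hp'ε : |p'.2 - q.2| < ε := by
    rw [← hp2, ← Real.dist_eq]
    exact lt_of_le_of_lt (le_max_right _ _) (Metric.ball_subset_ball (min_le_right _ _) hp')
  have hdis := hd p'.2 hp'ε
  refine ⟨(q.1, p'.2), hC.mem_door_of_height hP hJ (Or.inl rfl) hdis hqd, rfl, ?_⟩
  intro z hz
  obtain ⟨hz1, hz2⟩ := (mem_segment_horiz (by rfl)).1 hz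
  have hmid : ((p.1, p'.2) : Pt) ∈ Metric.ball p δ := by
    rw [Metric.mem_ball, Prod.dist_eq, max_lt_iff] at hp'δ ⊢
    refine ⟨?_, hp'δ.2⟩
    simpa using hδ
  rcases Set.uIcc_subset_uIcc_union_uIcc (b := p.1) hz2 with h3 | h3
  · refine hball ((convex_ball p δ).segment_subset hp'δ hmid ?_)
    exact (mem_segment_horiz (by rfl)).2 ⟨hz1, h3⟩
  · refine hC.segment_subset_of_height hP hJ (a := p.1) (b := q.1) hdis ?_
      ((mem_segment_horiz (by rfl)).2 ⟨hz1, h3⟩)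
    rwa [show ((p.1, q.2) : Pt) = p from Prod.ext rfl hp2.symm]

theorem finite_backbone (hP : P.GeneralPosition) {J : Set (Set Pt)} (hJ : ∀ R ∈ J, P.IsCell R) :
    (P.backbone J).Finite := by
  refine ((cellSystem hP).finite_cellAbscissas.prod (cellSystem hP).finite_cellHeights).subset ?_
  rintro q ⟨C, d₁, d₂, hC, ⟨-, hq⟩ | ⟨-, hq⟩⟩
  · refine ⟨?_, hC.snd_mem_of_isOpenBackbone hP hJ hq⟩
    rcases hq.1 with h1 | h1
    · exact hC.fst_mem hP hJ (Or.inl rfl) h1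
    · exact hC.fst_mem hP hJ (Or.inr rfl) h1
  · exact ⟨hC.fst_mem hP hJ (Or.inl rfl) hq.1, hC.snd_mem_of_isClosedBackbone hP hJ hq⟩

end RectilinearDomain

/-- Take the rightmost point with at most half of the points strictly to its left. If more than half
were strictly to its right, the next abscissa would satisfy the same bound. -/
theorem exists_median {V : Set Pt} (hV : V.Finite) (hne : V.Nonempty) :
    ∃ m ∈ V, 2 * (leftOf V m.1).encard ≤ V.encard ∧ 2 * (rightOf V m.1).encard ≤ V.encard := by
  have hl : ∀ x, (leftOf V x).Finite := fun x => hV.subset fun _ h => h.1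
  have hr : ∀ x, (rightOf V x).Finite := fun x => hV.subset fun _ h => h.1
  have key : ∃ m ∈ V, 2 * (leftOf V m.1).ncard ≤ V.ncard ∧ 2 * (rightOf V m.1).ncard ≤ V.ncard := by
    obtain ⟨m₀, hm₀, hmin⟩ := Set.exists_min_image V Prod.fst hV hne
    have h0 : leftOf V m₀.1 = ∅ := by
      rw [Set.eq_empty_iff_forall_notMem]
      rintro p ⟨hp, hlt⟩
      exact absurd (hmin p hp) (not_le.2 hlt)
    obtain ⟨m, ⟨hm, hml⟩, hmax⟩ := Set.exists_max_image
      {m | m ∈ V ∧ 2 * (leftOf V m.1).ncard ≤ V.ncard} Prod.fst (hV.subset fun _ h => h.1)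
      ⟨m₀, hm₀, by rw [h0]; simp⟩
    refine ⟨m, hm, hml, ?_⟩
    by_contra! hc
    have hrne : (rightOf V m.1).Nonempty := by
      rw [Set.nonempty_iff_ne_empty]
      intro he
      rw [he] at hc
      simp at hc
    obtain ⟨m', ⟨hm', hlt⟩, hmin'⟩ := Set.exists_min_image _ Prod.fst (hr m.1) hrne
    have hdisj : Disjoint (leftOf V m'.1) (rightOf V m.1) := by
      rw [Set.disjoint_left]
      rintro p ⟨-, hp⟩ hp'
      exact absurd (hmin' p hp') (not_le.2 hp)
    have hsum : (leftOf V m'.1).ncard + (rightOf V m.1).ncard ≤ V.ncard := by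
      rw [← Set.ncard_union_eq hdisj (hl _) (hr _)]
      exact Set.ncard_le_ncard (Set.union_subset (fun _ h => h.1) fun _ h => h.1) hV
    have := hmax m' ⟨hm', by omega⟩
    linarith
  obtain ⟨m, hm, h1, h2⟩ := key
  refine ⟨m, hm, ?_, ?_⟩
  · rw [← (hl _).cast_ncard_eq, ← hV.cast_ncard_eq]
    exact_mod_cast h1
  · rw [← (hr _).cast_ncard_eq, ← hV.cast_ncard_eq]
    exact_mod_cast h2

theorem exists_isCutTree {V : Set Pt} (hV : V.Finite) : ∃ T : CutTree, T.IsCutTree V := by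
  induction hn : V.ncard using Nat.strong_induction_on generalizing V with
  | _ n ih =>
    rcases V.eq_empty_or_nonempty with rfl | hne
    · exact ⟨.leaf, rfl⟩
    · obtain ⟨m, hm, h1, h2⟩ := exists_median hV hne
      obtain ⟨l, hl⟩ := ih (leftOf V m.1).ncard (hn ▸ Set.ncard_lt_ncard
        ⟨fun _ h => h.1, fun hc => lt_irrefl _ (hc hm).2⟩ hV) (hV.subset fun _ h => h.1) rfl
      obtain ⟨r, hr⟩ := ih (rightOf V m.1).ncard (hn ▸ Set.ncard_lt_ncard
        ⟨fun _ h => h.1, fun hc => lt_irrefl _ (hc hm).2⟩ hV) (hV.subset fun _ h => h.1) rfl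
      exact ⟨.node m l r, hm, h1, h2, hl, hr⟩


/-! Paths in the reduced graph. -/

/-- Descending the tree, the two points stay in the same subtree until a cut-line does not have both
strictly on one side. -/
theorem CutTree.IsCutTree.exists_separating {T : CutTree} {V : Set Pt} (hT : T.IsCutTree V)
    {u v : Pt} (hu : u ∈ V) (hv : v ∈ V) :
    ∃ x U, T.HasNode V x U ∧ u ∈ U ∧ v ∈ U ∧ x ∈ Set.uIcc u.1 v.1 := by
  induction T generalizing V with
  | leaf =>
    obtain rfl : V = ∅ := hT
    exact hu.elim
  | node m l r ihl ihr =>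
    obtain ⟨-, -, -, hl, hr⟩ := hT
    by_cases h1 : u.1 < m.1 ∧ v.1 < m.1
    · obtain ⟨x, U, h2, h3⟩ := ihl hl ⟨hu, h1.1⟩ ⟨hv, h1.2⟩
      exact ⟨x, U, Or.inr (Or.inl h2), h3⟩
    by_cases h2 : m.1 < u.1 ∧ m.1 < v.1
    · obtain ⟨x, U, h3, h4⟩ := ihr hr ⟨hu, h2.1⟩ ⟨hv, h2.2⟩
      exact ⟨x, U, Or.inr (Or.inr h3), h4⟩
    refine ⟨m.1, V, Or.inl ⟨rfl, rfl⟩, hu, hv, Set.mem_uIcc.2 ?_⟩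
    rcases le_total u.1 v.1 with h | h
    · left
      by_contra hc
      rw [not_and_or, not_le, not_le] at hc
      rcases hc with hc | hc
      · exact h2 ⟨hc, by linarith⟩
      · exact h1 ⟨by linarith, hc⟩
    · right
      by_contra hc
      rw [not_and_or, not_le, not_le] at hc
      rcases hc with hc | hc
      · exact h2 ⟨by linarith, hc⟩
      · exact h1 ⟨hc, by linarith⟩

theorem CutTree.HasNode.subset {T : CutTree} {V U : Set Pt} {x : ℝ} (h : T.HasNode V x U) :
    U ⊆ V := by
  induction T generalizing V with
  | leaf => exact h.elim
  | node m l r ihl ihr =>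
    rcases h with ⟨-, rfl⟩ | h | h
    · exact subset_rfl
    · exact (ihl h).trans fun _ h => h.1
    · exact (ihr h).trans fun _ h => h.1

/-- There is a path in the graph `E` from `u` to `v` of weight at most `L`. -/
def Reaches (E : GraphEdge → Prop) (u v : Pt) (L : ℝ) : Prop :=
  ∃ γ, IsGraphPath E u v γ ∧ graphWeight γ ≤ L

namespace Reaches

variable {E : GraphEdge → Prop} {u v w : Pt} {L M : ℝ}

theorem refl (u : Pt) : Reaches E u u 0 := ⟨[], rfl, by simp [graphWeight]⟩

theorem mono (h : Reaches E u v L) (hL : L ≤ M) : Reaches E u v M := by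
  obtain ⟨γ, h1, h2⟩ := h
  exact ⟨γ, h1, h2.trans hL⟩

theorem edge (e : GraphEdge) (he : E e) : Reaches E e.src e.tgt e.weight :=
  ⟨[e], ⟨he, rfl, rfl⟩, by simp [graphWeight]⟩

theorem trans (h₁ : Reaches E u v L) (h₂ : Reaches E v w M) : Reaches E u w (L + M) := by
  obtain ⟨γ, h1, h2⟩ := h₁
  obtain ⟨γ', h3, h4⟩ := h₂
  refine ⟨γ ++ γ', ?_, ?_⟩
  · induction γ generalizing u L with
    | nil =>
      obtain rfl : u = v := h1
      exact h3
    | cons e γ ih => exact ⟨h1.1, h1.2.1, ih h1.2.2 le_rfl⟩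
  · simp only [graphWeight, List.map_append, List.sum_append] at h2 h4 ⊢
    linarith

end Reaches

/-- All horizontal segments at heights between those of `u` and `v` and between the vertical lines
through `u` and `v` lie in `D`. -/
def BoxFree (D : Set Pt) (u v : Pt) : Prop :=
  ∀ y ∈ Set.uIcc u.2 v.2, segment ℝ ((u.1, y) : Pt) (v.1, y) ⊆ D

section Ordinary

variable {h : ℕ} {P : RectilinearDomain h} {J : Set (Set Pt)} {B : Set Pt} {T : CutTree}

theorem steinerPoints_finite {D U : Set Pt} (hU : U.Finite) (x : ℝ) : (steinerPoints D U x).Finite := by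
  refine (hU.image fun v => ((x, v.2) : Pt)).subset ?_
  rintro z ⟨h1, v, hv, h2, -⟩
  exact ⟨v, hv, Prod.ext h1.symm h2⟩

/-- Induction on the number of Steiner points strictly between: if there are none, the two points
are consecutive. -/
theorem reaches_steinerPoints {x : ℝ} {U : Set Pt} (hU : T.HasNode B x U) (hUf : U.Finite) {p q : Pt}
    (hp : p ∈ steinerPoints P.carrier U x) (hq : q ∈ steinerPoints P.carrier U x) (hle : p.2 ≤ q.2)
    (hs : segment ℝ p q ⊆ P.carrier) :
    Reaches (P.reducedGraph J B T) p q (l1 p q) ∧ Reaches (P.reducedGraph J B T) q p (l1 p q) := by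
  have hx : p.1 = q.1 := hp.1.trans hq.1.symm
  induction hn : {z | z ∈ steinerPoints P.carrier U x ∧ p.2 < z.2 ∧ z.2 < q.2}.ncard
    using Nat.strong_induction_on generalizing p q with
  | _ n ih =>
    rcases eq_or_lt_of_le hle with heq | hlt
    · obtain rfl : p = q := Prod.ext hx heq
      rw [l1_self]
      exact ⟨.refl _, .refl _⟩
    have hfin : {z | z ∈ steinerPoints P.carrier U x ∧ p.2 < z.2 ∧ z.2 < q.2}.Finite :=
      (steinerPoints_finite hUf x).subset fun _ h => h.1
    by_cases hz : ∃ z ∈ steinerPoints P.carrier U x, p.2 < z.2 ∧ z.2 < q.2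
    · obtain ⟨z, hz, h1, h2⟩ := hz
      have hzs : z ∈ segment ℝ p q := (mem_segment_vert hx).2
        ⟨hz.1.trans hp.1.symm, Set.mem_uIcc.2 (Or.inl ⟨h1.le, h2.le⟩)⟩
      have k1 := ih _ (hn ▸ Set.ncard_lt_ncard ⟨fun a ha => ⟨ha.1, ha.2.1, ha.2.2.trans h2⟩,
        fun hc => lt_irrefl z.2 (hc ⟨hz, h1, h2⟩).2.2⟩ hfin) hp hz h1.le
        (((convex_segment p q).segment_subset (left_mem_segment ℝ _ _) hzs).trans hs)
        (hp.1.trans hz.1.symm) rfl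
      have k2 := ih _ (hn ▸ Set.ncard_lt_ncard ⟨fun a ha => ⟨ha.1, h1.trans ha.2.1, ha.2.2⟩,
        fun hc => lt_irrefl z.2 (hc ⟨hz, h1, h2⟩).2.1⟩ hfin) hz hq h2.le
        (((convex_segment p q).segment_subset hzs (right_mem_segment ℝ _ _)).trans hs)
        (hz.1.trans hq.1.symm) rfl
      rw [← l1_add_of_mem_segment (Or.inl hx) hzs]
      refine ⟨k1.1.trans k2.1, ?_⟩
      rw [add_comm]
      exact k2.2.trans k1.2
    · have hE : IsOrdinaryEdge P.carrier B T p q :=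
        ⟨x, U, hU, Or.inr ⟨hp, hq, hlt, fun z hz' hc => hz ⟨z, hz', hc⟩, hs⟩⟩
      refine ⟨Reaches.edge (.ordinary p q) (Or.inl hE), ?_⟩
      rw [l1_comm]
      exact Reaches.edge (.ordinary q p) (Or.inr hE)

/-- Two points of `B` with a free box between them are joined by a path of length equal to their
distance. -/
theorem BoxFree.reaches (hT : T.IsCutTree B) (hB : B.Finite) {u v : Pt} (hu : u ∈ B) (hv : v ∈ B)
    (h : BoxFree P.carrier u v) : Reaches (P.reducedGraph J B T) u v (l1 u v) := by
  -- Both points project freely to this cut-line, and the stretch between the projections lies in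
  -- the box.
  obtain ⟨x, U, hU, huU, hvU, hx⟩ := hT.exists_separating hu hv
  have hsub : ∀ y ∈ Set.uIcc u.2 v.2, ∀ x₁ ∈ Set.uIcc u.1 v.1, ∀ x₂ ∈ Set.uIcc u.1 v.1,
      segment ℝ ((x₁, y) : Pt) (x₂, y) ⊆ P.carrier := by
    intro y hy x₁ h1 x₂ h2
    refine ((convex_segment _ _).segment_subset ?_ ?_).trans (h y hy)
    · exact (mem_segment_horiz (by rfl)).2 ⟨rfl, h1⟩
    · exact (mem_segment_horiz (by rfl)).2 ⟨rfl, h2⟩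
  have hus := hsub u.2 Set.left_mem_uIcc u.1 Set.left_mem_uIcc x hx
  have hvs := hsub v.2 Set.right_mem_uIcc v.1 Set.right_mem_uIcc x hx
  have hu' : ((x, u.2) : Pt) ∈ steinerPoints P.carrier U x := ⟨rfl, u, huU, rfl, hus⟩
  have hv' : ((x, v.2) : Pt) ∈ steinerPoints P.carrier U x := ⟨rfl, v, hvU, rfl, hvs⟩
  have hmid : ∀ y₁ ∈ Set.uIcc u.2 v.2, ∀ y₂ ∈ Set.uIcc u.2 v.2,
      segment ℝ ((x, y₁) : Pt) (x, y₂) ⊆ P.carrier := by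
    intro y₁ h1 y₂ h2 z hz
    obtain ⟨hz1, hz2⟩ := (mem_segment_vert (by rfl)).1 hz
    have := hsub z.2 (Set.uIcc_subset_uIcc h1 h2 hz2) x hx x hx
    rw [segment_same, Set.singleton_subset_iff] at this
    rwa [show z = (x, z.2) from Prod.ext hz1 rfl]
  have e1 : Reaches (P.reducedGraph J B T) u (x, u.2) (l1 u (x, u.2)) :=
    Reaches.edge (.ordinary u (x, u.2)) (Or.inl ⟨x, U, hU, Or.inl ⟨huU, rfl, hus⟩⟩)
  have e2 : Reaches (P.reducedGraph J B T) (x, v.2) v (l1 (x, v.2) v) :=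
    Reaches.edge (.ordinary (x, v.2) v) (Or.inr ⟨x, U, hU, Or.inl ⟨hvU, rfl, hvs⟩⟩)
  have hUf := hB.subset hU.subset
  have e3 : Reaches (P.reducedGraph J B T) (x, u.2) (x, v.2) (l1 (x, u.2) (x, v.2)) := by
    rcases le_total u.2 v.2 with hle | hle
    · exact (reaches_steinerPoints hU hUf hu' hv' hle
        (hmid _ Set.left_mem_uIcc _ Set.right_mem_uIcc)).1
    · rw [l1_comm]
      exact (reaches_steinerPoints hU hUf hv' hu' hle
        (hmid _ Set.right_mem_uIcc _ Set.left_mem_uIcc)).2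
  refine ((e1.trans e3).trans e2).mono ?_
  simp only [l1, sub_self, abs_zero, add_zero, zero_add]
  have : |u.1 - x| + |x - v.1| = |u.1 - v.1| := by
    rcases Set.mem_uIcc.1 hx with ⟨h1, h2⟩ | ⟨h1, h2⟩
    · rw [abs_of_nonpos (by linarith), abs_of_nonpos (by linarith), abs_of_nonpos (by linarith)]
      ring
    · rw [abs_of_nonneg (by linarith), abs_of_nonneg (by linarith), abs_of_nonneg (by linarith)]
      ring
  linarith

theorem IsOrdinaryEdge.axis_parallel {D : Set Pt} {p q : Pt} (h : IsOrdinaryEdge D B T p q) :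
    (p.1 = q.1 ∨ p.2 = q.2) ∧ segment ℝ p q ⊆ D := by
  obtain ⟨x, U, -, ⟨-, rfl, h1⟩ | ⟨h1, h2, -, -, h3⟩⟩ := h
  · exact ⟨Or.inr rfl, h1⟩
  · exact ⟨Or.inl (h1.1.trans h2.1.symm), h3⟩

end Ordinary

/-! Realization of graph paths in the plane. -/

section Realization

variable {h : ℕ} {P : RectilinearDomain h} {J : Set (Set Pt)} {B : Set Pt} {T : CutTree}

theorem regionCells_reflTransGen_start {R₀ R : Set Pt}
    (hR : R ∈ P.regionCells J R₀) : Relation.ReflTransGen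
      (fun A B => A ∈ P.regionCells J R₀ ∧ B ∈ P.regionCells J R₀ ∧ CellAdj A B) R R₀ := by
  induction hR with
  | refl => exact .refl
  | tail h2 h3 ih =>
    exact .head ⟨h2.tail h3, h2, h3.1.symm⟩ ih

/-- Degenerate corridors are always open, so corridor edges come from regions of cells only. -/
theorem isOpenCorridor_inter {R R' : Set Pt} (hadj : CellAdj R R') :
    IsOpenCorridor (R ∩ R') (R ∩ R') (R ∩ R') := by
  obtain ⟨z, hz⟩ := hadj.2.nonempty
  exact ⟨z.2, z, hz, z, hz, rfl, rfl, by simpa [segment_same] using hz⟩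

theorem exists_corridor_path (hP : P.GeneralPosition) {C d₁ d₂ : Set Pt}
    (hC : P.IsCorridor J C d₁ d₂) (ho : ¬ IsOpenCorridor C d₁ d₂) {q₁ q₂ : Pt} (h₁ : q₁ ∈ d₁)
    (h₂ : q₂ ∈ d₂) : C ⊆ P.carrier ∧ ∃ π, IsShortestRectPath C q₁ q₂ π := by
  rcases hC with ⟨R₀, h0, h1, rfl, hne, hd⟩ | ⟨R, hR, R', hR', hadj, rfl, rfl, rfl⟩
  swap
  · exact (ho (isOpenCorridor_inter hadj)).elim
  have hsub : P.regionCells J R₀ ⊆ {R | P.IsCell R} := fun R hR =>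
    (RectilinearDomain.isCell_of_mem_regionCells h0 h1 hR).1
  have hfin := (RectilinearDomain.finite_cells hP).subset hsub
  have hb : ∀ R ∈ P.regionCells J R₀, IsBox R := fun R hR => (hsub hR).isBox
  have hdoor : ∀ d, d = d₁ ∨ d = d₂ → ∃ R ∈ P.regionCells J R₀, d ⊆ R := by
    intro d hdd
    have : d ∈ RectilinearDomain.doors J (P.regionCells J R₀) := by
      rw [hd]
      simpa using hdd
    obtain ⟨R, hR, R', hR', hadj, rfl⟩ := this
    exact ⟨R, hR, Set.inter_subset_left⟩
  obtain ⟨R, hR, hdR⟩ := hdoor d₁ (Or.inl rfl)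
  obtain ⟨R', hR', hdR'⟩ := hdoor d₂ (Or.inr rfl)
  refine ⟨Set.sUnion_subset fun R hR => (hsub hR).subset, ?_⟩
  have e1 := regionCells_reflTransGen_start hR
  have e2 := reflTransGen_symm (fun A B h => ⟨h.2.1, h.1, h.2.2.symm⟩)
    (regionCells_reflTransGen_start hR')
  obtain ⟨L, hL⟩ := conn_of_reflTransGen hb hR (Relation.ReflTransGen.mono
    (fun A B h => ⟨h.1, h.2.1, h.2.2.2.nonempty⟩) _ _ (e1.trans e2)) (hdR h₁) (hdR' h₂)
  exact exists_isShortestRectPath hfin hb hL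

theorem exists_realizes (hP : P.GeneralPosition) {e : GraphEdge} (he : P.reducedGraph J B T e) :
    ∃ π, e.Realizes π := by
  cases e with
  | ordinary p q => exact ⟨_, rfl⟩
  | corridor C p q =>
    obtain ⟨d₁, d₂, hC, ho, h1, h2⟩ := he
    exact (exists_corridor_path hP hC ho h1.1 h2.1).2

theorem GraphEdge.Realizes.isRectPath (hP : P.GeneralPosition) {e : GraphEdge}
    (he : P.reducedGraph J B T e) {π : List Pt} (hπ : e.Realizes π) :
    IsRectPath P.carrier e.src e.tgt π ∧ pathLength π = e.weight := by
  cases e with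
  | ordinary p q =>
    obtain rfl : π = [p, q] := hπ
    have : (p.1 = q.1 ∨ p.2 = q.2) ∧ segment ℝ p q ⊆ P.carrier := by
      rcases he with h | h
      · exact h.axis_parallel
      · have := h.axis_parallel
        rw [segment_symm]
        exact ⟨this.1.imp Eq.symm Eq.symm, this.2⟩
    refine ⟨isRectPath_cons_cons.2 ⟨rfl, this.1, this.2, isRectPath_singleton
      (this.2 (right_mem_segment ℝ _ _))⟩, ?_⟩
    simp [pathLength, GraphEdge.weight]
  | corridor C p q =>
    obtain ⟨d₁, d₂, hC, ho, h1, h2⟩ := he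
    exact ⟨hπ.1.mono (exists_corridor_path hP hC ho h1.1 h2.1).1, hπ.pathLength_eq⟩

theorem IsGraphPath.exists_realizesPath (hP : P.GeneralPosition) {p q : Pt} {γ : List GraphEdge}
    (hγ : IsGraphPath (P.reducedGraph J B T) p q γ) : ∃ π, RealizesPath p γ π := by
  induction γ generalizing p with
  | nil => exact ⟨_, rfl⟩
  | cons e γ ih =>
    obtain ⟨π₂, h2⟩ := ih hγ.2.2
    obtain ⟨π₁, h1⟩ := exists_realizes hP hγ.1
    exact ⟨_, π₁, π₂, h1, h2, rfl⟩

/-- This gives the lower bound: no graph path weighs less than a shortest planar path. -/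
theorem IsGraphPath.isRectPath_of_realizesPath (hP : P.GeneralPosition) {p q : Pt}
    {γ : List GraphEdge} (hγ : IsGraphPath (P.reducedGraph J B T) p q γ) (hp : p ∈ P.carrier)
    {π : List Pt} (hπ : RealizesPath p γ π) :
    IsRectPath P.carrier p q π ∧ pathLength π = graphWeight γ := by
  induction γ generalizing p π with
  | nil =>
    obtain rfl : p = q := hγ
    obtain rfl : π = [p] := hπ
    exact ⟨isRectPath_singleton hp, by simp [pathLength, graphWeight]⟩
  | cons e γ ih =>
    obtain ⟨he, rfl, hγ⟩ := hγ
    obtain ⟨π₁, π₂, h1, h2, rfl⟩ := hπ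
    obtain ⟨k1, k2⟩ := h1.isRectPath hP he
    have htgt : e.tgt ∈ P.carrier := k1.2.2.1 _ (List.mem_of_getLast? k1.2.1)
    obtain ⟨k3, k4⟩ := ih hγ htgt h2
    obtain ⟨k5, k6⟩ := k3.append k1
    refine ⟨k5, ?_⟩
    rw [k6, k2, k4]
    simp [graphWeight]

end Realization


/-! Visibility funnels: the graph reaches every point of a gate with a free box in front of it. -/

/-- The gate `{x} × [lo, hi]` is passed at height `y₀` at cost `L`: each of its points is reached, at the
cost of moving along the gate, through a free box from a point of `B` within the heights of the gate. -/
def Funnel (E : GraphEdge → Prop) (D B : Set Pt) (s : Pt) (x lo hi y₀ L : ℝ) : Prop :=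
  y₀ ∈ Set.Icc lo hi ∧ ∀ y ∈ Set.Icc lo hi, ∃ u ∈ B, ∃ M, Reaches E s u M ∧ u.2 ∈ Set.Icc lo hi ∧
    M + l1 u (x, y) ≤ L + |y - y₀| ∧ BoxFree D u (x, y)

theorem BoxFree.extend {D : Set Pt} {u v : Pt} {x : ℝ} (h : BoxFree D u v)
    (h' : ∀ y ∈ Set.uIcc u.2 v.2, segment ℝ ((v.1, y) : Pt) (x, y) ⊆ D) : BoxFree D u (x, v.2) := by
  intro y hy z hz
  obtain ⟨hz1, hz2⟩ := (mem_segment_horiz (by rfl)).1 hz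
  rcases Set.uIcc_subset_uIcc_union_uIcc (b := v.1) hz2 with h3 | h3
  · exact h y hy ((mem_segment_horiz (by rfl)).2 ⟨hz1, h3⟩)
  · exact h' y hy ((mem_segment_horiz (by rfl)).2 ⟨hz1, h3⟩)

/-- A free box may be cut at an intermediate height on its far side. -/
theorem BoxFree.cut {D : Set Pt} {u v : Pt} (h : BoxFree D u v) {y : ℝ} (hy : y ∈ Set.uIcc u.2 v.2) :
    BoxFree D u (v.1, y) ∧ BoxFree D (v.1, y) v ∧ l1 u (v.1, y) + l1 (v.1, y) v = l1 u v := by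
  refine ⟨fun z hz => h z (Set.uIcc_subset_uIcc_left hy hz), fun z hz => ?_, ?_⟩
  · have := h z (Set.uIcc_subset_uIcc_right hy hz)
    simp only [segment_same, Set.singleton_subset_iff]
    exact this (right_mem_segment ℝ _ _)
  · simp only [l1, sub_self, abs_zero, zero_add]
    have : |u.2 - y| + |y - v.2| = |u.2 - v.2| := by
      rcases Set.mem_uIcc.1 hy with ⟨h1, h2⟩ | ⟨h1, h2⟩
      · rw [abs_of_nonpos (by linarith), abs_of_nonpos (by linarith), abs_of_nonpos (by linarith)]
        ring
      · rw [abs_of_nonneg (by linarith), abs_of_nonneg (by linarith), abs_of_nonneg (by linarith)]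
        ring
    linarith

namespace Funnel

variable {E : GraphEdge → Prop} {D B : Set Pt} {s : Pt} {x lo hi y₀ L : ℝ}

/-- A point of `B` is a gate of height zero. -/
theorem start {u : Pt} (hu : u ∈ B) (hD : u ∈ D) (h : Reaches E s u L) :
    Funnel E D B s u.1 u.2 u.2 u.2 L := by
  refine ⟨by simp, fun y hy => ⟨u, hu, L, h, by simp, ?_, ?_⟩⟩
  all_goals
    rw [Set.Icc_self, Set.mem_singleton_iff] at hy
    subst hy
  · rw [show ((u.1, u.2) : Pt) = u from rfl, l1_self]
    simp
  · intro y hy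
    simp only [Set.uIcc_self, Set.mem_singleton_iff] at hy
    subst hy
    simpa [segment_same] using hD

theorem finish (hreach : ∀ u ∈ B, ∀ v ∈ B, BoxFree D u v → Reaches E u v (l1 u v)) {v : Pt}
    (hv : v ∈ B) (h : Funnel E D B s v.1 v.2 v.2 v.2 L) : Reaches E s v L := by
  obtain ⟨u, hu, M, h1, -, h3, h4⟩ := h.2 v.2 (by simp)
  refine (h1.trans (hreach u hu v hv h4)).mono ?_
  simpa using h3

/-- Above or below the old gate, a point of the new one is reached by turning at the respective end
of the old gate, which is in `B`. At the heights of the old gate the current point of `B` is kept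
and its free box prolonged. -/
theorem step (hreach : ∀ u ∈ B, ∀ v ∈ B, BoxFree D u v → Reaches E u v (l1 u v))
    (h : Funnel E D B s x lo hi y₀ L) (hlo : ((x, lo) : Pt) ∈ B) (hhi : ((x, hi) : Pt) ∈ B)
    {x' lo' hi' y₀' : ℝ} (hlo' : ((x', lo') : Pt) ∈ B) (hhi' : ((x', hi') : Pt) ∈ B)
    (hy₀' : y₀' ∈ Set.Icc lo' hi')
    (hlink : ∀ y, min lo lo' ≤ y → y ≤ max hi hi' → segment ℝ ((x, y) : Pt) (x', y) ⊆ D) :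
    Funnel E D B s x' lo' hi' y₀' (L + l1 (x, y₀) (x', y₀')) := by
  refine ⟨hy₀', fun y hy => ?_⟩
  have hle : lo ≤ hi := h.1.1.trans h.1.2
  have key : ∃ u ∈ B, ∃ M, Reaches E s u M ∧
      M + l1 u (x', y) ≤ L + l1 (x, y₀) (x', y₀') + |y - y₀'| ∧ BoxFree D u (x', y) := by
    have htri : |y - y₀| ≤ |y - y₀'| + |y₀ - y₀'| := by
      rw [abs_sub_comm y₀ y₀']
      exact abs_sub_le _ _ _
    have hl1 : l1 (x, y₀) (x', y₀') = |x - x'| + |y₀ - y₀'| := rfl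
    rcases lt_or_ge y lo with hc | hc
    · obtain ⟨u, hu, M, h1, -, h3, h4⟩ := h.2 lo ⟨le_rfl, hle⟩
      refine ⟨(x, lo), hlo, _, h1.trans (hreach u hu _ hlo h4), ?_, ?_⟩
      · have : l1 (x, lo) (x', y) = |x - x'| + |lo - y| := rfl
        have e1 : |lo - y| = lo - y := abs_of_nonneg (by linarith)
        have e2 : |lo - y₀| = y₀ - lo := by rw [abs_sub_comm]; exact abs_of_nonneg (by linarith [h.1.1])
        have e3 : |y - y₀| = y₀ - y := by
          rw [abs_sub_comm]; exact abs_of_nonneg (by linarith [h.1.1])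
        linarith
      · intro η hη
        simp only [Set.uIcc_of_ge hc.le, Set.mem_Icc] at hη
        exact hlink η ((min_le_right _ _).trans (hy.1.trans hη.1)) (hη.2.trans (hle.trans (le_max_left _ _)))
    rcases lt_or_ge hi y with hd | hd
    · obtain ⟨u, hu, M, h1, -, h3, h4⟩ := h.2 hi ⟨hle, le_rfl⟩
      refine ⟨(x, hi), hhi, _, h1.trans (hreach u hu _ hhi h4), ?_, ?_⟩
      · have : l1 (x, hi) (x', y) = |x - x'| + |hi - y| := rfl
        have e1 : |hi - y| = y - hi := by rw [abs_sub_comm]; exact abs_of_nonneg (by linarith)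
        have e2 : |hi - y₀| = hi - y₀ := abs_of_nonneg (by linarith [h.1.2])
        have e3 : |y - y₀| = y - y₀ := abs_of_nonneg (by linarith [h.1.2])
        linarith
      · intro η hη
        simp only [Set.uIcc_of_le hd.le, Set.mem_Icc] at hη
        exact hlink η ((min_le_left _ _).trans (hle.trans hη.1)) (hη.2.trans (hy.2.trans (le_max_right _ _)))
    · obtain ⟨u, hu, M, h1, h2, h3, h4⟩ := h.2 y ⟨hc, hd⟩
      refine ⟨u, hu, M, h1, ?_, h4.extend fun η hη => ?_⟩
      · have := l1_triangle u (x, y) (x', y)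
        have e : l1 (x, y) (x', y) = |x - x'| := by simp [l1]
        linarith
      · have : η ∈ Set.Icc lo hi := Set.uIcc_subset_Icc h2 ⟨hc, hd⟩ hη
        exact hlink η ((min_le_left _ _).trans this.1) (this.2.trans (le_max_left _ _))
  obtain ⟨u, hu, M, h1, h2, h3⟩ := key
  -- The invariant asks for a point of `B` within the heights of the new gate; if `u` is outside,
  -- the path turns at the nearer end of that gate.
  rcases lt_or_ge u.2 lo' with hc | hc
  · obtain ⟨k1, k2, k3⟩ := h3.cut (y := lo') (Set.mem_uIcc.2 (Or.inl ⟨hc.le, hy.1⟩))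
    refine ⟨(x', lo'), hlo', _, h1.trans (hreach u hu _ hlo' k1), ⟨le_rfl, hy.1.trans hy.2⟩, ?_, k2⟩
    simp only at k3
    linarith
  rcases lt_or_ge hi' u.2 with hd | hd
  · obtain ⟨k1, k2, k3⟩ := h3.cut (y := hi') (Set.mem_uIcc.2 (Or.inr ⟨hy.2, hd.le⟩))
    refine ⟨(x', hi'), hhi', _, h1.trans (hreach u hu _ hhi' k1), ⟨hy.1.trans hy.2, le_rfl⟩, ?_, k2⟩
    simp only at k3
    linarith
  · exact ⟨u, hu, M, h1, ⟨hc, hd⟩, h2, h3⟩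

end Funnel


/-! Passing a corridor. -/

theorem Conn.symm {D : Set Pt} {p q : Pt} {L : ℝ} (h : Conn D p q L) : Conn D q p L := by
  refine Conn.induction (motive := fun p L => Conn D q p L) (fun hq => Conn.refl hq) ?_ h
  intro p a L h1 h2 _ ih
  rw [add_comm, l1_comm]
  exact ih.trans (Conn.seg (h1.imp Eq.symm Eq.symm) (by rwa [segment_symm]))

/-- A path from a door to the other one may be rerouted through the backbone point of the door. -/
theorem IsClosedBackbone.reroute {C d d' : Set Pt} {p p' q : Pt} {L : ℝ}
    (h : IsClosedBackbone C d d' q) (hp : p ∈ d) (hx : p.1 = q.1) (hp' : p' ∈ d')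
    (hL : Conn C p p' L) : ∃ M, Conn C q p' M ∧ l1 p q + M ≤ L := by
  obtain ⟨-, w, -, hsep, hw⟩ := h
  obtain ⟨S, hS, hc, h1, h2, h3⟩ := hL.exists_trace
  obtain ⟨z, hzS, hzw⟩ := hsep S hS hc ⟨p, h1, hp⟩ ⟨p', h2, hp'⟩
  obtain ⟨L₁, L₂, k1, k2, rfl⟩ := h3 z hzS
  obtain ⟨m1, m2⟩ := hw z hzw
  refine ⟨_, (Conn.seg (Or.inr m1.symm) (by rwa [segment_symm])).trans k2, ?_⟩
  -- Here `p` and `q` are on one vertical, `q` and `z` on one horizontal, so going via `q` is no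
  -- detour.
  have : l1 p q + l1 q z = l1 p z := by
    simp [l1, hx, m1]
    ring
  linarith [k1.l1_le]

theorem crossingHeights_comm (C d d' : Set Pt) : crossingHeights C d d' = crossingHeights C d' d := by
  ext y
  constructor <;>
  · rintro ⟨p₁, h1, p₂, h2, h3, h4, h5⟩
    exact ⟨p₂, h2, p₁, h1, h4, h3, by rwa [segment_symm]⟩

namespace ChainCost

variable {p q : Pt} {ℓ : List (Set Pt)} {L : ℝ}

theorem end_mem (h : ChainCost q p ℓ L) {A : Set Pt} (hA : ℓ.getLast? = some A) : q ∈ A := by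
  induction h with
  | last hp hq =>
    obtain rfl : _ = A := by simpa using hA
    exact hq
  | cons _ _ _ ih =>
    rw [List.getLast?_cons_cons] at hA
    exact ih hA

theorem exists_mem (h : ChainCost q p ℓ L) {A : Set Pt} (hA : A ∈ ℓ) :
    ∃ a ∈ A, l1 p a + l1 a q ≤ L := by
  induction h with
  | @last p B hp hq =>
    obtain rfl : A = B := by simpa using hA
    exact ⟨p, hp, by rw [l1_self, zero_add]⟩
  | @cons p z B B' ℓ L hp hz h ih =>
    rcases List.mem_cons.1 hA with rfl | hA
    · exact ⟨z, hz, by linarith [h.l1_le]⟩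
    · obtain ⟨a, ha, h1⟩ := ih hA
      exact ⟨a, ha, by linarith [l1_triangle p z a]⟩

theorem isChain (h : ChainCost q p ℓ L) : ℓ.IsChain fun A B => (A ∩ B).Nonempty := by
  induction h with
  | last => exact List.isChain_singleton _
  | cons hp hz h ih => exact List.isChain_cons_cons.2 ⟨⟨_, hz, h.start_mem⟩, ih⟩

theorem exists_start {A : Set Pt} (h : ChainCost q p (A :: ℓ) L) {p' : Pt} (hp' : p' ∈ A) :
    ∃ M, ChainCost q p' (A :: ℓ) M ∧ M ≤ l1 p' p + L := by
  cases h with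
  | last hp hq => exact ⟨_, last hp' hq, l1_triangle _ _ _⟩
  | @cons _ z _ B ℓ L hp hz h => exact ⟨_, cons hp' hz h, by linarith [l1_triangle p' p z]⟩

end ChainCost

/-- The cells of a chain without repetitions that starts and ends in the pruned dual graph all belong
to it. -/
theorem PrunesTo.mem_of_chain {F K : Set (Set Pt)} (hF : CellSystem F) (hK : PrunesTo F K)
    {ℓ : List (Set Pt)} (hℓ : ∀ A ∈ ℓ, A ∈ F) (hc : ℓ.IsChain fun A B => (A ∩ B).Nonempty)
    (hn : ℓ.Nodup) (hfirst : ∀ A, ℓ.head? = some A → A ∈ K)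
    (hlast : ∀ A, ℓ.getLast? = some A → A ∈ K) : ∀ A ∈ ℓ, A ∈ K := by
  refine hK.subset_of_two_neighbors (Y := {A | A ∈ ℓ}) hℓ fun A hA => ?_
  obtain ⟨i, hi, rfl⟩ := List.getElem_of_mem hA
  rcases Nat.eq_zero_or_pos i with rfl | hi0
  · exact Or.inl (hfirst _ (by rw [List.head?_eq_getElem?, List.getElem?_eq_getElem hi]))
  rcases Nat.lt_or_ge (i + 1) ℓ.length with hi1 | hi1
  · right
    have hadj : ∀ j (hj : j + 1 < ℓ.length), CellAdj ℓ[j] ℓ[j + 1] := fun j hj => by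
      rw [hF.cellAdj_iff (hℓ _ (List.getElem_mem _)) (hℓ _ (List.getElem_mem _))]
      refine ⟨fun he => ?_, List.isChain_iff_getElem.1 hc j hj⟩
      have := (hn.getElem_inj_iff).1 he
      omega
    refine ⟨ℓ[i - 1], Or.inl (List.getElem_mem _), ℓ[i + 1], Or.inl (List.getElem_mem _), ?_, ?_,
      hadj i hi1⟩
    · intro he
      have := (hn.getElem_inj_iff).1 he
      omega
    · have := (hadj (i - 1) (by omega)).symm
      simpa only [Nat.sub_add_cancel hi0] using this
  · refine Or.inl (hlast _ ?_)
    rw [List.getLast?_eq_getElem?, List.getElem?_eq_getElem (by omega)]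
    congr 2
    omega

/-! ### Corridors cut out by a chain in the pruned dual graph. -/

section Passage

variable {h : ℕ} {P : RectilinearDomain h} {K : Set (Set Pt)}

/-- The cells between two junction rectangles on a chain in the pruned dual graph make up a corridor
chain. -/
theorem exists_corridorChain (hP : P.GeneralPosition) (hK : P.IsPrunedDual K) {A A' : Set Pt}
    {mid : List (Set Pt)} (hmid : mid ≠ []) (hA : A ∈ junctions K) (hA' : A' ∈ junctions K)
    (hm : ∀ R ∈ mid, R ∈ K ∧ R ∉ junctions K) (hn : (A :: (mid ++ [A'])).Nodup)
    (hc : (A :: (mid ++ [A'])).IsChain fun A B => (A ∩ B).Nonempty) :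
    ∃ (X : Set (Set Pt)) (f : ℕ → Set Pt), CorridorChain {R | P.IsCell R} K X mid.length f ∧
      f 0 = A ∧ mid.head? = some (f 1) ∧ mid.getLast? = some (f mid.length) ∧
      f (mid.length + 1) = A' ∧
      (∀ i, 1 ≤ i → i ≤ mid.length → f i ∈ mid) ∧ ⋃₀ X ⊆ P.carrier ∧ (∀ R ∈ mid, R ∈ X) ∧
      P.IsCorridor (junctions K) (⋃₀ X) (f 0 ∩ f 1) (f mid.length ∩ f (mid.length + 1)) ∧
      P.IsCorridor (junctions K) (⋃₀ X) (f mid.length ∩ f (mid.length + 1)) (f 0 ∩ f 1) := by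
  classical
  set g := A :: (mid ++ [A']) with hg
  have hlen : g.length = mid.length + 2 := by simp [hg]
  have hpos : 0 < mid.length := List.length_pos_iff.2 hmid
  -- The default value plays no role: only indices up to `mid.length + 1` matter.
  set f : ℕ → Set Pt := fun i => g.getD i ∅ with hf
  have hfi : ∀ i (hi : i < g.length), f i = g[i] := fun i hi => List.getD_eq_getElem _ _ hi
  have hf0 : f 0 = A := rfl
  have hfmid : ∀ i (h1 : 1 ≤ i) (h2 : i ≤ mid.length), f i = mid[i - 1] := by
    intro i h1 h2
    rw [hfi i (by omega)]
    obtain ⟨j, rfl⟩ : ∃ j, i = j + 1 := ⟨i - 1, by omega⟩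
    simp only [hg, List.getElem_cons_succ, Nat.add_sub_cancel]
    exact List.getElem_append_left _
  have hflast : f (mid.length + 1) = A' := by
    rw [hfi _ (by omega)]
    simp [hg]
  have hfmem : ∀ i, 1 ≤ i → i ≤ mid.length → f i ∈ mid := fun i h1 h2 => by
    rw [hfmid i h1 h2]
    exact List.getElem_mem _
  have hcell : ∀ R ∈ K, P.IsCell R := fun R hR => hK.1.subset hR
  have hfK : ∀ i ≤ mid.length + 1, f i ∈ K := by
    intro i hi
    rcases Nat.eq_zero_or_pos i with rfl | h0
    · exact hA.1
    rcases Nat.lt_or_ge mid.length i with h1 | h1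
    · obtain rfl : i = mid.length + 1 := by omega
      rw [hflast]
      exact hA'.1
    · exact (hm _ (hfmem i h0 h1)).1
  have hinj : ∀ i ≤ mid.length + 1, ∀ j ≤ mid.length + 1, f i = f j → i = j := by
    intro i hi j hj hij
    rw [hfi i (by omega), hfi j (by omega)] at hij
    exact hn.getElem_inj_iff.1 hij
  have htouch : ∀ i ≤ mid.length, (f i ∩ f (i + 1)).Nonempty := by
    intro i hi
    rw [hfi i (by omega), hfi (i + 1) (by omega)]
    exact List.isChain_iff_getElem.1 hc i (by omega)
  have hsys := RectilinearDomain.cellSystem hP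
  have hadj : ∀ i ≤ mid.length, CellAdj (f i) (f (i + 1)) := fun i hi => by
    rw [hsys.cellAdj_iff (hcell _ (hfK i (by omega))) (hcell _ (hfK (i + 1) (by omega)))]
    refine ⟨fun he => ?_, htouch i hi⟩
    have := hinj i (by omega) (i + 1) (by omega) he
    omega
  have h1J : f 1 ∉ junctions K := (hm _ (hfmem 1 le_rfl hpos)).2
  have h1c : P.IsCell (f 1) := hcell _ (hfK 1 (by omega))
  set X := P.regionCells (junctions K) (f 1) with hX
  have hXc : ∀ R ∈ X, P.IsCell R ∧ R ∉ junctions K := fun R hR =>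
    RectilinearDomain.isCell_of_mem_regionCells h1c h1J hR
  have hfX : ∀ i, 1 ≤ i → i ≤ mid.length → f i ∈ X := by
    intro i h1
    induction i, h1 using Nat.le_induction with
    | base => exact fun _ => Relation.ReflTransGen.refl
    | succ i h1 ih =>
      intro h2
      exact (ih (by omega)).tail ⟨hadj i (by omega), hcell _ (hfK _ (by omega)),
        (hm _ (hfmem _ (by omega) h2)).2⟩
  have hCC : CorridorChain {R | P.IsCell R} K X mid.length f := by
    refine ⟨hsys, hK.1, hpos, hinj, hfK, ?_, fun hx => (hXc _ hx).2 hA, ?_, htouch,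
      fun R hR => (hXc R hR).1, hfX, fun R hR => regionCells_reflTransGen_start hR⟩
    -- Cells of `K` that are not junctions have degree two by definition.
    · intro i h1 h2
      by_contra hd
      exact (hm _ (hfmem i h1 h2)).2 ⟨hfK i (by omega), hd⟩
    · intro hx
      rw [hflast] at hx
      exact (hXc _ hx).2 hA'
  have hdoors : RectilinearDomain.doors (junctions K) X =
      {f 0 ∩ f 1, f mid.length ∩ f (mid.length + 1)} := by
    ext d
    constructor
    · rintro ⟨R, hR, R', hR', hRR, rfl⟩
      rcases hCC.door_eq hR hR'.1 (fun hx => (hXc _ hx).2 hR') hRR with ⟨rfl, rfl⟩ | ⟨rfl, rfl⟩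
      · exact Or.inl (Set.inter_comm _ _)
      · exact Or.inr rfl
    · rintro (rfl | rfl)
      · exact ⟨f 1, hfX 1 le_rfl hpos, f 0, hA, (hadj 0 (by omega)).symm, Set.inter_comm _ _⟩
      · exact ⟨_, hfX _ hpos le_rfl, _, hflast ▸ hA', hadj _ le_rfl, rfl⟩
  refine ⟨X, f, hCC, hf0, ?_, ?_, hflast, hfmem, Set.sUnion_subset fun R hR => (hXc R hR).1.subset, ?_,
    Or.inl ⟨f 1, h1c, h1J, rfl, hCC.doors_ne, hdoors⟩,
    Or.inl ⟨f 1, h1c, h1J, rfl, hCC.doors_ne.symm, by rw [hdoors, Set.pair_comm]⟩⟩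
  · rw [hfmid 1 le_rfl hpos, List.head?_eq_getElem?, List.getElem?_eq_getElem hpos]
  · rw [hfmid _ hpos le_rfl, List.getLast?_eq_getElem?, List.getElem?_eq_getElem (by omega)]
  · intro R hR
    obtain ⟨i, hi, rfl⟩ := List.getElem_of_mem hR
    have := hfX (i + 1) (by omega) (by omega)
    rw [hfmid _ (by omega) (by omega)] at this
    simpa using this

end Passage


/-! ### From chains of cells to graph paths. -/

section Passage

variable {h : ℕ} {P : RectilinearDomain h} {K : Set (Set Pt)} {B : Set Pt} {T : CutTree}

/-- A chain from `A` to `A'` of cost `L` between `p` and `z` passes two gates of equal heights with all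
horizontals between them in the domain. -/
def OpenPassage (D B A A' : Set Pt) (p z : Pt) (L : ℝ) : Prop :=
  ∃ x x₁ lo hi y y₁, y ∈ Set.Icc lo hi ∧ y₁ ∈ Set.Icc lo hi ∧
    ((x, lo) : Pt) ∈ B ∧ ((x, hi) : Pt) ∈ B ∧ ((x₁, lo) : Pt) ∈ B ∧ ((x₁, hi) : Pt) ∈ B ∧
    (∀ η ∈ Set.Icc lo hi, ((x, η) : Pt) ∈ A ∧ ((x₁, η) : Pt) ∈ A' ∧
      segment ℝ ((x, η) : Pt) (x₁, η) ⊆ D) ∧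
    l1 p (x, y) + l1 (x, y) (x₁, y₁) + l1 (x₁, y₁) z ≤ L

/-- A chain from `A` to `A'` of cost `L` between `p` and `z` may be replaced by a graph path between two
points of `B`. -/
def ClosedPassage (E : GraphEdge → Prop) (B A A' : Set Pt) (p z : Pt) (L : ℝ) : Prop :=
  ∃ q ∈ B, ∃ q' ∈ B, q ∈ A ∧ q' ∈ A' ∧ ∃ W, Reaches E q q' W ∧ l1 p q + W + l1 q' z ≤ L

/-- In a degenerate corridor both gates are the shared diagonal. Each of its heights is a crossing
height, so its two ends are backbone points. -/
theorem openPassage_inter (hP : P.GeneralPosition) {J : Set (Set Pt)} (hJ : ∀ R ∈ J, P.IsCell R)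
    (hB : P.backbone J ⊆ B) {A A' : Set Pt} (hA : A ∈ J) (hA' : A' ∈ J) (hne : A ≠ A') {p z : Pt}
    (hz : z ∈ A ∩ A') : OpenPassage P.carrier B A A' p z (l1 p z) := by
  have hsys := RectilinearDomain.cellSystem hP
  have bA := (hJ A hA).isBox
  have bA' := (hJ A' hA').isBox
  have hadj : CellAdj A A' := (hsys.cellAdj_iff (hJ A hA) (hJ A' hA')).2 ⟨hne, z, hz⟩
  have hcor : P.IsCorridor J (A ∩ A') (A ∩ A') (A ∩ A') :=
    Or.inr ⟨A, hA, A', hA', hadj, rfl, rfl, rfl⟩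
  have m1 := bA.mem_iff.1 hz.1
  have m2 := bA'.mem_iff.1 hz.2
  have hzm : z.2 ∈ Set.Icc (max (ylo A) (ylo A')) (min (yhi A) (yhi A')) :=
    ⟨max_le m1.2.1 m2.2.1, le_min m1.2.2 m2.2.2⟩
  have hmem : ∀ η ∈ Set.Icc (max (ylo A) (ylo A')) (min (yhi A) (yhi A')),
      ((z.1, η) : Pt) ∈ A ∩ A' := fun η hη =>
    ⟨bA.mem_iff.2 ⟨m1.1, (le_max_left _ _).trans hη.1, hη.2.trans (min_le_left _ _)⟩,
      bA'.mem_iff.2 ⟨m2.1, (le_max_right _ _).trans hη.1, hη.2.trans (min_le_right _ _)⟩⟩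
  have hseg : ∀ η, ((z.1, η) : Pt) ∈ A ∩ A' → segment ℝ ((z.1, η) : Pt) (z.1, η) ⊆ A ∩ A' :=
    fun η hη => by rwa [segment_same, Set.singleton_subset_iff]
  have hch : crossingHeights (A ∩ A') (A ∩ A') (A ∩ A') =
      Set.Icc (max (ylo A) (ylo A')) (min (yhi A) (yhi A')) := by
    ext η
    constructor
    · rintro ⟨p₁, hp₁, -, -, rfl, -⟩
      have n1 := bA.mem_iff.1 hp₁.1
      have n2 := bA'.mem_iff.1 hp₁.2
      exact ⟨max_le n1.2.1 n2.2.1, le_min n1.2.2 n2.2.2⟩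
    · intro hη
      exact ⟨_, hmem η hη, _, hmem η hη, rfl, rfl, hseg η (hmem η hη)⟩
  have hle := hzm.1.trans hzm.2
  have hlo : ((z.1, max (ylo A) (ylo A')) : Pt) ∈ B := by
    refine hB ⟨_, _, _, hcor, Or.inl ⟨isOpenCorridor_inter hadj, Or.inl (hmem _ ⟨le_rfl, hle⟩), Or.inr ?_⟩⟩
    rw [hch]
    exact isLeast_Icc hle
  have hhi : ((z.1, min (yhi A) (yhi A')) : Pt) ∈ B := by
    refine hB ⟨_, _, _, hcor, Or.inl ⟨isOpenCorridor_inter hadj, Or.inl (hmem _ ⟨hle, le_rfl⟩), Or.inl ?_⟩⟩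
    rw [hch]
    exact isGreatest_Icc hle
  refine ⟨z.1, z.1, _, _, z.2, z.2, hzm, hzm, hlo, hhi, hlo, hhi, fun η hη =>
    ⟨(hmem η hη).1, (hmem η hη).2, ((hseg η (hmem η hη)).trans Set.inter_subset_left).trans
      (hJ A hA).subset⟩, ?_⟩
  rw [show ((z.1, z.2) : Pt) = z from rfl, l1_self]
  simp

/-- Every stretch of a chain between two successive junction rectangles is an open or a closed passage. -/
theorem passage (hP : P.GeneralPosition) (hK : P.IsPrunedDual K)
    (hB : P.backbone (junctions K) ⊆ B) {A A' : Set Pt} {mid : List (Set Pt)}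
    (hA : A ∈ junctions K) (hA' : A' ∈ junctions K)
    (hm : ∀ R ∈ mid, R ∈ K ∧ R ∉ junctions K) (hn : (A :: (mid ++ [A'])).Nodup)
    (hc : (A :: (mid ++ [A'])).IsChain fun A B => (A ∩ B).Nonempty) {p z : Pt} {L : ℝ}
    (hcost : ChainCost z p (A :: mid) L) (hz : z ∈ A') :
    OpenPassage P.carrier B A A' p z L ∨
      ClosedPassage (P.reducedGraph (junctions K) B T) B A A' p z L := by
  have hJ : ∀ R ∈ junctions K, P.IsCell R := fun R hR => hK.1.subset hR.1
  rcases eq_or_ne mid [] with rfl | hmid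
  · cases hcost with
    | last hp hzA =>
      refine Or.inl (openPassage_inter hP hJ hB hA hA' ?_ ⟨hzA, hz⟩)
      rintro rfl
      simp at hn
  obtain ⟨X, f, hCC, hf0, hhead, hlast, hf1, hfm, hXP, hmX, hcor, hcor'⟩ :=
    exists_corridorChain hP hK hmid hA hA' hm hn hc
  obtain ⟨A₁, rest, rfl⟩ : ∃ A₁ rest, mid = A₁ :: rest := List.exists_cons_of_ne_nil hmid
  set n := (A₁ :: rest).length with hndef
  have h := hCC.boxChain
  cases hcost with
  | @cons _ z₀ _ _ _ M hp hz₀ hcost =>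
  obtain rfl : A₁ = f 1 := by simpa using hhead
  have hz0 : z₀ ∈ f 0 ∩ f 1 := ⟨hf0 ▸ hz₀, hcost.start_mem⟩
  have hzn : z ∈ f n ∩ f (n + 1) := ⟨hcost.end_mem hlast, hf1 ▸ hz⟩
  by_cases ho : IsOpenCorridor (⋃₀ X) (f 0 ∩ f 1) (f n ∩ f (n + 1))
  · left
    obtain ⟨lo, hi, hle, hch, ⟨i, hin, hi'⟩, ⟨j, hjn, hj'⟩⟩ := h.exists_crossing_interval ho
    have hY : ∀ y ∈ Set.Icc lo hi, ∀ i ≤ n + 1, ylo (f i) ≤ y ∧ y ≤ yhi (f i) := fun y hy => by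
      rw [← hch] at hy
      exact h.mem_crossingHeights_iff.1 hy
    have hmem0 : ∀ y ∈ Set.Icc lo hi, ((z₀.1, y) : Pt) ∈ f 0 ∩ f 1 := fun y hy =>
      h.mem_inter (i := 0) (by omega) hz0 (hY y hy 0 (by omega)) (hY y hy 1 (by omega))
    have hmemn : ∀ y ∈ Set.Icc lo hi, ((z.1, y) : Pt) ∈ f n ∩ f (n + 1) := fun y hy =>
      h.mem_inter (i := n) le_rfl hzn (hY y hy n (by omega)) (hY y hy (n + 1) (by omega))
    have hlow : IsLeast (crossingHeights (⋃₀ X) (f 0 ∩ f 1) (f n ∩ f (n + 1))) lo := by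
      rw [hch]
      exact isLeast_Icc hle
    have hhigh : IsGreatest (crossingHeights (⋃₀ X) (f 0 ∩ f 1) (f n ∩ f (n + 1))) hi := by
      rw [hch]
      exact isGreatest_Icc hle
    have hbb : ∀ q : Pt, q ∈ (f 0 ∩ f 1) ∪ (f n ∩ f (n + 1)) → q.2 = lo ∨ q.2 = hi → q ∈ B := by
      intro q hq hq2
      refine hB ⟨_, _, _, hcor, Or.inl ⟨ho, hq, ?_⟩⟩
      rcases hq2 with h2 | h2 <;> rw [h2]
      · exact Or.inr hlow
      · exact Or.inl hhigh
    -- The chain visits every cell, in particular those whose sides bound the strip; clamping needs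
    -- exactly this.
    have hvisit : ∀ i ≤ n + 1, ∃ a ∈ f i, l1 z₀ a + l1 a z ≤ M := by
      intro i hi
      rcases Nat.eq_zero_or_pos i with rfl | h0
      · exact ⟨z₀, hz0.1, by rw [l1_self, zero_add]; exact hcost.l1_le⟩
      rcases Nat.lt_or_ge n i with h1 | h1
      · obtain rfl : i = n + 1 := by omega
        exact ⟨z, hzn.2, by rw [l1_self, add_zero]; exact hcost.l1_le⟩
      · exact hcost.exists_mem (hfm i h0 h1)
    obtain ⟨a, ha, ha'⟩ := hvisit j hjn
    obtain ⟨b, hb, hb'⟩ := hvisit i hin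
    have hcl := clamp_l1_le hle (p := z₀) (q := z) (a := a) (b := b)
      (hj' ▸ ((h.box hjn).mem_iff.1 ha).2.2) (hi' ▸ ((h.box hin).mem_iff.1 hb).2.1) ha' hb'
    have hIlo : lo ∈ Set.Icc lo hi := ⟨le_rfl, hle⟩
    have hIhi : hi ∈ Set.Icc lo hi := ⟨hle, le_rfl⟩
    refine ⟨z₀.1, z.1, lo, hi, clamp lo hi z₀.2, clamp lo hi z.2, clamp_mem hle _, clamp_mem hle _,
      hbb _ (Or.inl (hmem0 _ hIlo)) (Or.inl rfl), hbb _ (Or.inl (hmem0 _ hIhi)) (Or.inr rfl),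
      hbb _ (Or.inr (hmemn _ hIlo)) (Or.inl rfl), hbb _ (Or.inr (hmemn _ hIhi)) (Or.inr rfl),
      fun η hη => ⟨hf0 ▸ (hmem0 η hη).1, hf1 ▸ (hmemn η hη).2, ?_⟩, ?_⟩
    · have hη' := hη
      rw [← hch] at hη'
      obtain ⟨p₁, hp₁, p₂, hp₂, e1, e2, hs⟩ := hη'
      have x1 := h.sys.fst_eq (h.mem_F 0 (by omega)) (h.mem_F 1 (by omega))
        (h.ne (by omega) (by omega) (by omega)) hp₁ hz0
      have x2 := h.sys.fst_eq (h.mem_F n (by omega)) (h.mem_F (n + 1) (by omega))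
        (h.ne (by omega) (by omega) (by omega)) hp₂ hzn
      rw [show ((z₀.1, η) : Pt) = p₁ from Prod.ext x1.symm e1.symm,
        show ((z.1, η) : Pt) = p₂ from Prod.ext x2.symm e2.symm]
      exact hs.trans hXP
    · linarith [l1_triangle p z₀ (z₀.1, clamp lo hi z₀.2)]
  · right
    have ho' : ¬ IsOpenCorridor (⋃₀ X) (f n ∩ f (n + 1)) (f 0 ∩ f 1) := by
      unfold IsOpenCorridor
      rwa [crossingHeights_comm]
    obtain ⟨q, hq⟩ := h.exists_closedBackbone ho
    obtain ⟨q', hq'⟩ : ∃ q', IsClosedBackbone (⋃₀ X) (f n ∩ f (n + 1)) (f 0 ∩ f 1) q' := by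
      have := h.reverse.exists_closedBackbone
      simp only [Nat.sub_zero, Nat.add_sub_cancel, Nat.add_sub_cancel_left, Nat.sub_self,
        Set.inter_comm (f (n + 1)), Set.inter_comm (f 1)] at this
      exact this ho'
    have hqB : q ∈ B := hB ⟨_, _, _, hcor, Or.inr ⟨ho, hq⟩⟩
    have hqB' : q' ∈ B := hB ⟨_, _, _, hcor', Or.inr ⟨ho', hq'⟩⟩
    refine ⟨q, hqB, q', hqB', hf0 ▸ hq.1.1, hf1 ▸ hq'.1.2, _,
      Reaches.edge (.corridor (⋃₀ X) q q') ⟨_, _, hcor, ho, hq, hq'⟩, ?_⟩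
    have hconn : Conn (⋃₀ X) z₀ z M := hcost.conn fun R hR =>
      ⟨h.sys.box R (h.subset (hmX R hR)), Set.subset_sUnion_of_mem (hmX R hR)⟩
    have x1 := h.sys.fst_eq (h.mem_F 0 (by omega)) (h.mem_F 1 (by omega))
      (h.ne (by omega) (by omega) (by omega)) hz0 hq.1
    have x2 := h.sys.fst_eq (h.mem_F n (by omega)) (h.mem_F (n + 1) (by omega))
      (h.ne (by omega) (by omega) (by omega)) hzn hq'.1
    -- The path is led through `q` on the first door and then, read backwards, through `q'` on the
    -- other.
    obtain ⟨M₁, k1, k2⟩ := hq.reroute hz0 x1 hzn hconn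
    obtain ⟨M₂, k3, k4⟩ := hq'.reroute hzn x2 hq.1 k1.symm
    have k5 := k3.symm.geodesicDist_le
    have k6 := l1_triangle p z₀ q
    rw [l1_comm z q'] at k4
    change l1 p q + geodesicDist (⋃₀ X) q q' + l1 q' z ≤ _
    linarith

/-- The graph path that corresponds to a chain of cells, built along the junction rectangles. -/
theorem reaches_of_chain (hP : P.GeneralPosition) (hK : P.IsPrunedDual K)
    (hB : P.backbone (junctions K) ⊆ B) (hBf : B.Finite) (hT : T.IsCutTree B) {s t : Pt} (ht : t ∈ B)
    {ℓ : List (Set Pt)} {A : Set Pt} (hA : A ∈ junctions K) (hℓ : ∀ R ∈ ℓ, R ∈ K)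
    (hn : (A :: ℓ).Nodup) (hlast : ∀ R, (A :: ℓ).getLast? = some R → R ∈ junctions K)
    {x lo hi y L M : ℝ} (hcost : ChainCost t (x, y) (A :: ℓ) M)
    (hfun : Funnel (P.reducedGraph (junctions K) B T) P.carrier B s x lo hi y L)
    (hlo : ((x, lo) : Pt) ∈ B) (hhi : ((x, hi) : Pt) ∈ B)
    (hgate : ∀ η ∈ Set.Icc lo hi, ((x, η) : Pt) ∈ A) :
    Reaches (P.reducedGraph (junctions K) B T) s t (L + M) := by
  classical
  have hJ : ∀ R ∈ junctions K, P.IsCell R := fun R hR => hK.1.subset hR.1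
  have hreach : ∀ u ∈ B, ∀ v ∈ B, BoxFree P.carrier u v →
      Reaches (P.reducedGraph (junctions K) B T) u v (l1 u v) :=
    fun u hu v hv h => h.reaches hT hBf hu hv
  induction hlen : ℓ.length using Nat.strong_induction_on generalizing ℓ A x lo hi y L M with
  | _ N ih =>
    have bA := (hJ A hA).isBox
    have hle : lo ≤ hi := hfun.1.1.trans hfun.1.2
    -- Both gates lie in the rectangle `A`, hence so do the horizontals between them.
    have hlink : ∀ x' lo' hi', (∀ η ∈ Set.Icc lo' hi', ((x', η) : Pt) ∈ A) → lo' ≤ hi' →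
        ∀ η, min lo lo' ≤ η → η ≤ max hi hi' → segment ℝ ((x, η) : Pt) (x', η) ⊆ P.carrier := by
      intro x' lo' hi' hg hle' η h1 h2
      have a1 := bA.mem_iff.1 (hgate lo ⟨le_rfl, hle⟩)
      have a2 := bA.mem_iff.1 (hgate hi ⟨hle, le_rfl⟩)
      have a3 := bA.mem_iff.1 (hg lo' ⟨le_rfl, hle'⟩)
      have a4 := bA.mem_iff.1 (hg hi' ⟨hle', le_rfl⟩)
      have hη : ylo A ≤ η ∧ η ≤ yhi A :=
        ⟨(le_min a1.2.1 a3.2.1).trans h1, h2.trans (max_le a2.2.2 a4.2.2)⟩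
      exact (bA.convex.segment_subset ((bA.mem_iff (p := (x, η))).2 ⟨a1.1, hη⟩)
        ((bA.mem_iff (p := (x', η))).2 ⟨a3.1, hη⟩)).trans
        (hJ A hA).subset
    -- A target point in `A` is a gate of height zero.
    have hpoint : ∀ q : Pt, q ∈ A → q ∈ B →
        Reaches (P.reducedGraph (junctions K) B T) s q (L + l1 (x, y) q) := by
      intro q hqA hqB
      refine Funnel.finish hreach hqB (hfun.step hreach hlo hhi (x' := q.1) (lo' := q.2)
        (hi' := q.2) (y₀' := q.2) hqB hqB (by simp) (hlink _ _ _ ?_ le_rfl))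
      intro η hη
      rw [Set.Icc_self, Set.mem_singleton_iff] at hη
      subst hη
      exact hqA
    rcases eq_or_ne ℓ [] with rfl | hne
    · cases hcost with
      | last hp htA => exact hpoint t htA ht
    -- The stretch before the next junction rectangle, which exists because the last cell is one.
    set mid := ℓ.takeWhile (fun R => decide (R ∉ junctions K)) with hmid
    set rest := ℓ.dropWhile (fun R => decide (R ∉ junctions K)) with hrest
    have hsplit : mid ++ rest = ℓ := List.takeWhile_append_dropWhile
    have hmidJ : ∀ R ∈ mid, R ∈ K ∧ R ∉ junctions K := fun R hR =>
      ⟨hℓ R (hsplit ▸ List.mem_append_left _ hR), by simpa using List.mem_takeWhile_imp hR⟩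
    have hrne : rest ≠ [] := by
      intro hr
      rw [hr, List.append_nil] at hsplit
      obtain ⟨R, hR⟩ : ∃ R, ℓ.getLast? = some R := ⟨_, List.getLast?_eq_some_getLast hne⟩
      have h1 : R ∈ junctions K := hlast R (by
        obtain ⟨a, l, rfl⟩ := List.exists_cons_of_ne_nil hne
        rwa [List.getLast?_cons_cons])
      exact (hmidJ R (hsplit ▸ List.mem_of_getLast? hR)).2 h1
    obtain ⟨A', ℓ', hr⟩ := List.exists_cons_of_ne_nil hrne
    have hA' : A' ∈ junctions K := by
      have := List.head_dropWhile_not (fun R => decide (R ∉ junctions K)) hrne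
      simp only [← hrest, hr, List.head_cons] at this
      simpa using this
    rw [hr] at hsplit
    have hchain := hcost.isChain
    rw [← hsplit, ← List.cons_append] at hcost hn hchain hlast
    have hpre : (A :: mid) ++ A' :: ℓ' = (A :: (mid ++ [A'])) ++ ℓ' := by simp
    obtain ⟨z, L₁, L₂, c1, c2, rfl⟩ := hcost.split (by simp)
    have hpass := passage (T := T) hP hK hB hA hA' hmidJ
      ((hpre ▸ hn).of_append_left) ((List.isChain_append.1 (hpre ▸ hchain)).1) c1 c2.start_mem
    have hn' : (A' :: ℓ').Nodup := hn.of_append_right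
    have hlast' : ∀ R, (A' :: ℓ').getLast? = some R → R ∈ junctions K := by
      intro R hR
      refine hlast R ?_
      rw [List.getLast?_append, hR]
      rfl
    have hℓ' : ∀ R ∈ ℓ', R ∈ K := fun R hR => hℓ R (by rw [← hsplit]; simp [hR])
    have hlt : ℓ'.length < N := by
      rw [← hlen, ← hsplit]
      simp only [List.length_append, List.length_cons]
      omega
    rcases hpass with ⟨x₁, x₂, lo', hi', y₁, y₂, m1, m2, b1, b2, b3, b4, hg, hL⟩ |
      ⟨q, hqB, q', hqB', hqA, hqA', W, hW, hL⟩
    -- One step crosses `A` to the near gate and a second one the corridor; the remaining chain is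
    -- entered at the far gate.
    · have f1 := hfun.step hreach hlo hhi b1 b2 m1 (hlink _ _ _ (fun η hη => (hg η hη).1)
        (m1.1.trans m1.2))
      have f2 := f1.step hreach b1 b2 b3 b4 m2 fun η h1 h2 =>
        (hg η ⟨by simpa using h1, by simpa using h2⟩).2.2
      obtain ⟨M', c3, c4⟩ := c2.exists_start (hg y₂ m2).2.1
      refine (ih _ hlt hA' hℓ' hn' hlast' c3 f2 b3 b4 (fun η hη => (hg η hη).2.1) rfl).mono ?_
      linarith
    -- The funnel closes at `q`, the corridor edge is taken, and a new funnel opens at `q'`.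
    · have f1 := (hpoint q hqA hqB).trans hW
      obtain ⟨M', c3, c4⟩ := c2.exists_start hqA'
      have f2 := Funnel.start (D := P.carrier) hqB' ((hJ A' hA').subset hqA') f1
      refine (ih _ hlt hA' hℓ' hn' hlast' (x := q'.1) (y := q'.2) c3 f2 hqB' hqB' ?_ rfl).mono ?_
      · intro η hη
        rw [Set.Icc_self, Set.mem_singleton_iff] at hη
        subst hη
        exact hqA'
      · linarith

end Passage

/-- Connectedness of the domain links any two cells by touching cells, so a path exists; the minimum
is then attained as in any finite union of boxes. -/
theorem RectilinearDomain.exists_isShortestRectPath {h : ℕ} {P : RectilinearDomain h}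
    (hP : P.GeneralPosition) {s t : Pt} (hs : s ∈ P.carrier) (ht : t ∈ P.carrier) :
    ∃ π, IsShortestRectPath P.carrier s t π := by
  have hfin := finite_cells hP
  have hbox : ∀ R ∈ {R | P.IsCell R}, IsBox R := fun R hR => IsCell.isBox hR
  have hU := sUnion_cells hP
  obtain ⟨R, hR, hsR⟩ : s ∈ ⋃₀ {R | P.IsCell R} := hU ▸ hs
  obtain ⟨R', hR', htR'⟩ : t ∈ ⋃₀ {R | P.IsCell R} := hU ▸ ht
  have := P.isConnected.isPreconnected.reflTransGen_of_finite_closed hfin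
    (fun A hA => (hbox A hA).isCompact.isClosed) hU.ge hR hR' ⟨s, hs, hsR⟩ ⟨t, ht, htR'⟩
  obtain ⟨L, hL⟩ := conn_of_reflTransGen hbox hR (Relation.ReflTransGen.mono
    (fun A B h => ⟨h.1, h.2.1, h.2.2.mono Set.inter_subset_left⟩) _ _ this) hsR htR'
  rw [← hU]
  exact _root_.exists_isShortestRectPath hfin hbox hL

theorem mainTheorem3 {h : ℕ} (P : RectilinearDomain h) (hP : P.GeneralPosition)
    (K : Set (Set Pt)) (hK : P.IsPrunedDual K)
    (s t : Pt) (hs : ∃ R ∈ junctions K, s ∈ R) (ht : ∃ R ∈ junctions K, t ∈ R)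
    (B : Set Pt) (hB : B = P.backbone (junctions K) ∪ {s, t}) :
    B.Finite ∧ (∃ T : CutTree, T.IsCutTree B) ∧
      ∀ T : CutTree, T.IsCutTree B →
        (∃ γ, IsShortestGraphPath (P.reducedGraph (junctions K) B T) s t γ) ∧
        ∀ γ, IsShortestGraphPath (P.reducedGraph (junctions K) B T) s t γ →
          (∃ π, RealizesPath s γ π) ∧
          ∀ π, RealizesPath s γ π →
            IsShortestRectPath P.carrier s t π ∧ pathLength π = graphWeight γ := by
  have hJ : ∀ R ∈ junctions K, P.IsCell R := fun R hR => hK.1.subset hR.1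
  have hBf : B.Finite := by
    rw [hB]
    exact (RectilinearDomain.finite_backbone hP hJ).union (Set.toFinite _)
  refine ⟨hBf, exists_isCutTree hBf, fun T hT => ?_⟩
  have hBB : P.backbone (junctions K) ⊆ B := hB ▸ Set.subset_union_left
  have hsB : s ∈ B := by simp [hB]
  have htB : t ∈ B := by simp [hB]
  obtain ⟨R, hR, hsR⟩ := hs
  obtain ⟨R', hR', htR'⟩ := ht
  have hsP : s ∈ P.carrier := (hJ R hR).subset hsR
  have htP : t ∈ P.carrier := (hJ R' hR').subset htR'
  obtain ⟨π₀, hπ₀⟩ := RectilinearDomain.exists_isShortestRectPath hP hsP htP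
  have hsys := RectilinearDomain.cellSystem hP
  -- Upper bound: the shortest planar path, as a chain of surviving cells between junction
  -- rectangles, yields a graph path that is no longer.
  have hkey : Reaches (P.reducedGraph (junctions K) B T) s t (pathLength π₀) := by
    have hconn : Conn (⋃₀ {R | P.IsCell R}) s t (pathLength π₀) := by
      rw [RectilinearDomain.sUnion_cells hP]
      exact ⟨π₀, hπ₀.1, rfl⟩
    obtain ⟨ℓ, M, h1, h2, h3, h4, h5⟩ := hconn.exists_nodup_chainCost hsys.finite hsys.box
      (hJ R hR) hsR (hJ R' hR') htR'
    have hlast : ∀ A, (R :: ℓ).getLast? = some A → A ∈ junctions K := fun A hA => by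
      rw [h5, Option.some_inj] at hA
      exact hA ▸ hR'
    have hℓK := hK.1.mem_of_chain hsys h1 h2.isChain h4
      (fun A hA => by
        rw [List.head?_cons, Option.some_inj] at hA
        exact hA ▸ hR.1) (fun A hA => (hlast A hA).1)
    have hstart := Funnel.start (E := P.reducedGraph (junctions K) B T) hsB hsP (Reaches.refl s)
    refine (reaches_of_chain hP hK hBB hBf hT htB hR
      (fun A hA => hℓK A (List.mem_cons_of_mem _ hA)) h4 hlast (x := s.1) (y := s.2) h2 hstart hsB hsB
      ?_).mono (by linarith)
    intro η hη
    rw [Set.Icc_self, Set.mem_singleton_iff] at hη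
    subst hη
    exact hsR
  -- Lower bound: every graph path is realized in the domain at its weight.
  have hlower : ∀ γ, IsGraphPath (P.reducedGraph (junctions K) B T) s t γ →
      pathLength π₀ ≤ graphWeight γ := by
    intro γ hγ
    obtain ⟨π, hπ⟩ := hγ.exists_realizesPath hP
    obtain ⟨k1, k2⟩ := hγ.isRectPath_of_realizesPath hP hsP hπ
    exact k2 ▸ hπ₀.2 π k1
  obtain ⟨γ₀, hγ₀, hw⟩ := hkey
  refine ⟨⟨γ₀, hγ₀, fun γ hγ => hw.trans (hlower γ hγ)⟩, fun γ hγ =>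
    ⟨hγ.1.exists_realizesPath hP, fun π hπ => ?_⟩⟩
  obtain ⟨k1, k2⟩ := hγ.1.isRectPath_of_realizesPath hP hsP hπ
  refine ⟨⟨k1, fun π' hπ' => ?_⟩, k2⟩
  rw [k2]
  exact ((hγ.2 γ₀ hγ₀).trans hw).trans (hπ₀.2 π' hπ')
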